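/- Let $(\mathcal C,\wedge,S)$ be a symmetric monoidal category with finite coproducts and a zero object, such that for all finite families $(A_i)_{i\in I}$ and all $B$ the canonical morphism $\bigvee_{i}(A_i\wedge B)\to(\bigvee_i A_i)\wedge B$ is an isomorphism. For a finite pointed set $K$ put $X\wedge K=\bigvee_{K\setminus *}X$; thus $X\wedge S^n$, with $S^n=(\Delta[1]/\partial\Delta[1])^{\wedge n}$, is a simplicial object of $\mathcal C$. Let $\mathcal B\subseteq\mathcal C$ be a full subcategory containing $S$ and closed under $\wedge$, let $\sigma:P\to T$ be a morphism of $\mathcal C$, and let $E$ be a commutative symmetric ring $T$-spectrum in $\mathcal C$, i.e. objects $E_n$ with left $\Sigma_n$-actions, $\Sigma_n\times\Sigma_m$-equivariant associative and unital multiplications $\mu_{n,m}:E_n\wedge E_m\to E_{n+m}$ with unit $\iota_0:S\to E_0$, and a central map $\iota_1:T\to E_1$, such that $\chi_{n,m}\circ\mu_{n,m}=\mu_{m,n}\circ \mathrm{twist}$ for the shuffles $\chi_{n,m}\in\Sigma_{n+m}$. Then the pointed simplicial sets $\mathbf 1^E_n=\mathrm{Hom}_{\mathcal C}(P^{\wedge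 n},E_n\wedge S^n)$ (pointed at zero, $\Sigma_n$ acting by conjugation), with the multiplications $(f,g)\mapsto(\mu_{n,m}\wedge S^{n+m})\circ(f\wedge g)$ and with the units given by $\iota_0$ and by $\iota_1\circ\sigma$, form a commutative symmetric ring $S^1$-spectrum $\mathbf 1^E$. The category $\mathrm{Mod}\,\mathbf 1^E$ of right $\mathbf 1^E$-modules is closed symmetric monoidal under the smash product over $\mathbf 1^E$ (the product representing $\mathbf 1^E$-bilinear bimorphisms, with unit $\mathbf 1^E$ and the usual coherence isomorphisms). For $X,Y\in\mathcal B$ the symmetric $S^1$-spectrum $$\mathrm{Corr}^{E,\sigma}_*(X,Y)=\big(\mathrm{Hom}_{\mathcal C}(X\wedge P^{\wedge n},\,Y\wedge E_n\wedge S^n)\big)_{n\ge 0},$$ whose structure maps are induced by $f\mapsto f\wedge\sigma$ and $E_n\wedge T\to E_{n+1}$, is a right $\mathbf 1^E$-module with action $(f,g)\mapsto (Y\wedge\mu_{n,m}\wedge S^{n+m})\circ \mathrm{tw}\circ(f\wedge g)$. With these modules as objects of morphisms, $\mathcal B$ becomes a symmetric monoidal $\mathrm{Mod}\,\mathbf 1^E$-category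 $\mathrm{Corr}^{E,\sigma}_*(\mathcal B)$ with the same monoidal product on objects and the same unit object as $\mathcal B$. Precisely: * the composition is the morphism of modules given by the pairings sending $f:X\wedge P^{\wedge n}\to Y\wedge E_n\wedge S^n$ and $g:Y\wedge P^{\wedge m}\to Z\wedge E_m\wedge S^m$ to $$X\wedge P^{\wedge n}\wedge P^{\wedge m}\xrightarrow{f\wedge P^{\wedge m}}Y\wedge E_n\wedge S^n\wedge P^{\wedge m}\cong Y\wedge P^{\wedge m}\wedge E_n\wedge S^n\xrightarrow{g\wedge E_n\wedge S^n}Z\wedge E_m\wedge S^m\wedge E_n\wedge S^n\cong Z\wedge E_n\wedge E_m\wedge S^n\wedge S^m\xrightarrow{Z\wedge\mu_{n,m}\wedge S^{n+m}}Z\wedge E_{n+m}\wedge S^{n+m};$$ * the identity of $X$ is $X\cong X\wedge S\xrightarrow{X\wedge\iota_0}X\wedge E_0$; * the monoidal product on objects of morphisms is given by the pairings sending $f:X\wedge P^{\wedge n}\to X'\wedge E_n\wedge S^n$ and $g:Y\wedge P^{\wedge m}\to Y'\wedge E_m\wedge S^m$ to $$X\wedge Y\wedge P^{\wedge n}\wedge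 P^{\wedge m}\cong X\wedge P^{\wedge n}\wedge Y\wedge P^{\wedge m}\xrightarrow{f\wedge g}X'\wedge E_n\wedge S^n\wedge Y'\wedge E_m\wedge S^m\cong X'\wedge Y'\wedge E_n\wedge E_m\wedge S^{n+m}\xrightarrow{X'\wedge Y'\wedge\mu_{n,m}\wedge S^{n+m}}X'\wedge Y'\wedge E_{n+m}\wedge S^{n+m};$$ * the associativity, unit and symmetry isomorphisms are the images of those of $\mathcal B$ under $h\mapsto(X\cong X\wedge S\xrightarrow{h\wedge\iota_0}Y\wedge E_0)$. -/

import Mathlib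

open CategoryTheory MonoidalCategory Limits Opposite

universe v u w

noncomputable section

set_option linter.unusedSectionVars false

/-! ### Symmetric sequences -/

/-- The groupoid of the finite sets `{0, …, n - 1}` and their bijections, i.e. the disjoint union
of the symmetric groups. A functor from it is a sequence of objects `X n` with a left action of
the symmetric group on `n` letters on `X n`. -/
structure FinBij where
  card : ℕ

instance : Category FinBij where
  Hom a b := Fin a.card ≃ Fin b.card
  id a := Equiv.refl _
  comp e f := e.trans f

/-- A bijection `Fin n ≃ Fin m` as a morphism of `FinBij`. -/
def FinBij.of {n m : ℕ} (e : Fin n ≃ Fin m) : (FinBij.mk n ⟶ FinBij.mk m) := e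

/-- The block sum of two bijections; for permutations this is the standard embedding
`Σ_n × Σ_m ⊆ Σ_{n+m}`. -/
def blockSum {n n' m m' : ℕ} (e : Fin n ≃ Fin n') (f : Fin m ≃ Fin m') :
    Fin (n + m) ≃ Fin (n' + m') :=
  finSumFinEquiv.symm.trans ((Equiv.sumCongr e f).trans finSumFinEquiv)

/-- The shuffle `χ_{n,m}`, moving the first `n` letters past the last `m` letters:
`i ↦ i + m` for `i < n` and `n + j ↦ j` for `j < m`. -/
def shuffle (n m : ℕ) : Fin (n + m) ≃ Fin (m + n) := finAddFlip

/-! ### Tensor powers and the action of the symmetric groups on them -/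

section Pow
variable {C : Type u} [Category.{v} C] [MonoidalCategory C] [SymmetricCategory C] (P : C)

/-- The tensor power `P^{∧n}`. -/
def powObj : ℕ → C
  | 0 => 𝟙_ C
  | n + 1 => powObj n ⊗ P

/-- The symmetry applied to the last two factors of `P^{∧(n+2)}`. -/
def swapLast (n : ℕ) : powObj P (n + 2) ⟶ powObj P (n + 2) :=
  (α_ (powObj P n) P P).hom ≫ powObj P n ◁ (β_ P P).hom ≫ (α_ (powObj P n) P P).inv

/-- The isomorphism of `P^{∧(n+1)}` that moves the factor in position `a` to the last position and
keeps the order of the other factors. -/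
def toLast : ∀ (n : ℕ), Fin (n + 1) → (powObj P (n + 1) ⟶ powObj P (n + 1))
  | 0, _ => 𝟙 _
  | n + 1, a => Fin.lastCases (motive := fun _ => powObj P (n + 2) ⟶ powObj P (n + 2))
      (𝟙 _) (fun b => (toLast n b ▷ P : powObj P (n + 2) ⟶ powObj P (n + 2)) ≫ swapLast P n) a

/-- The bijection induced by `e` on the complements of `e⁻¹ b` and `b`, renumbered in order. -/
def delEquiv {n m : ℕ} (e : Fin (n + 1) ≃ Fin (m + 1)) (b : Fin (m + 1)) : Fin n ≃ Fin m :=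
  Equiv.removeNone ((finSuccEquiv' (e.symm b)).symm.trans (e.trans (finSuccEquiv' b)))

/-- The map `P^{∧n} ⟶ P^{∧m}` moving the factor in position `i` to position `e i`. -/
def powPerm : ∀ {n m : ℕ}, (Fin n ≃ Fin m) → (powObj P n ⟶ powObj P m)
  | 0, 0, _ => 𝟙 _
  | 0, _ + 1, e => (e.symm 0).elim0
  | _ + 1, 0, e => (e 0).elim0
  | n + 1, m + 1, e => toLast P n (e.symm (Fin.last m)) ≫
      (powPerm (delEquiv e (Fin.last m)) ▷ P : powObj P (n + 1) ⟶ powObj P (m + 1))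

/-- Tensoring a map between tensor powers with `P` on the right. -/
abbrev wk {n m : ℕ} (f : powObj P n ⟶ powObj P m) : powObj P (n + 1) ⟶ powObj P (m + 1) := f ▷ P

theorem delEquiv_spec {n m : ℕ} (e : Fin (n + 1) ≃ Fin (m + 1)) (b : Fin (m + 1)) (i : Fin n) :
    b.succAbove (delEquiv e b i) = e ((e.symm b).succAbove i) := by
  have h : some (delEquiv e b i) = ((finSuccEquiv' (e.symm b)).symm.trans (e.trans (finSuccEquiv' b)))
      (some i) := by
    refine Equiv.removeNone_some _ ?_
    obtain ⟨j, hj⟩ := Fin.exists_succAbove_eq (x := e ((e.symm b).succAbove i)) (y := b) (by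
      intro h
      have := congrArg e.symm h
      simp at this)
    exact ⟨j, by simp [← hj]⟩
  have h2 := congrArg (finSuccEquiv' b).symm h
  simpa using h2

theorem delEquiv_unique {n m : ℕ} (e : Fin (n + 1) ≃ Fin (m + 1)) (a : Fin (n + 1)) (b : Fin (m + 1))
    (hab : e a = b) (e' : Fin n ≃ Fin m) (h : ∀ i, b.succAbove (e' i) = e (a.succAbove i)) :
    delEquiv e b = e' := by
  subst hab
  ext i : 1
  have := delEquiv_spec e (e a) i
  rw [Equiv.symm_apply_apply, ← h] at this
  exact Fin.succAbove_right_injective this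

@[simp] theorem toLast_last (n : ℕ) : toLast P n (Fin.last n) = 𝟙 _ := by
  cases n <;> simp [toLast]

theorem wk_comp {n m k : ℕ} (f : powObj P n ⟶ powObj P m) (g : powObj P m ⟶ powObj P k) :
    wk P (f ≫ g) = wk P f ≫ wk P g := comp_whiskerRight _ _ _

theorem wk_id (n : ℕ) : wk P (𝟙 (powObj P n)) = 𝟙 (powObj P (n + 1)) := id_whiskerRight _ _

theorem toLast_castSucc (n : ℕ) (b : Fin (n + 1)) : toLast P (n + 1) b.castSucc =
    wk P (toLast P n b) ≫ swapLast P n := by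
  simp [toLast]
  rfl

theorem swap_nat {n m : ℕ} (f : powObj P n ⟶ powObj P m) :
    wk P (wk P f) ≫ swapLast P m = swapLast P n ≫ wk P (wk P f) := by
  have h : ∀ {A B : C} (f : A ⟶ B), (f ▷ P) ▷ P ≫ (α_ B P P).hom ≫ B ◁ (β_ P P).hom ≫
      (α_ B P P).inv = ((α_ A P P).hom ≫ A ◁ (β_ P P).hom ≫ (α_ A P P).inv) ≫ (f ▷ P) ▷ P := by
    intro A B f
    rw [associator_naturality_left_assoc, ← whisker_exchange_assoc]
    simp
  exact h f

theorem swap_swap (n : ℕ) : swapLast P n ≫ swapLast P n = 𝟙 _ := by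
  have h : ∀ A : C, ((α_ A P P).hom ≫ A ◁ (β_ P P).hom ≫ (α_ A P P).inv) ≫
    ((α_ A P P).hom ≫ A ◁ (β_ P P).hom ≫ (α_ A P P).inv) = 𝟙 _ := by
    intro A
    simp [← whiskerLeft_comp_assoc]
  exact h _

theorem swap_braid (n : ℕ) : wk P (swapLast P n) ≫ swapLast P (n + 1) ≫ wk P (swapLast P n) =
    swapLast P (n + 1) ≫ wk P (swapLast P n) ≫ swapLast P (n + 1) := by
  have h : ∀ A : C, ((α_ A P P).hom ≫ A ◁ (β_ P P).hom ≫ (α_ A P P).inv) ▷ P ≫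
      ((α_ (A ⊗ P) P P).hom ≫ (A ⊗ P) ◁ (β_ P P).hom ≫ (α_ (A ⊗ P) P P).inv) ≫
      ((α_ A P P).hom ≫ A ◁ (β_ P P).hom ≫ (α_ A P P).inv) ▷ P =
      ((α_ (A ⊗ P) P P).hom ≫ (A ⊗ P) ◁ (β_ P P).hom ≫ (α_ (A ⊗ P) P P).inv) ≫
      ((α_ A P P).hom ≫ A ◁ (β_ P P).hom ≫ (α_ A P P).inv) ▷ P ≫
      ((α_ (A ⊗ P) P P).hom ≫ (A ⊗ P) ◁ (β_ P P).hom ≫ (α_ (A ⊗ P) P P).inv) := by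
    intro A
    have e := BraidedCategory.yang_baxter P P P
    calc _ = 𝟙 _ ⊗≫ A ◁ ((α_ P P P).inv ≫ (β_ P P).hom ▷ P ≫ (α_ P P P).hom ≫
              P ◁ (β_ P P).hom ≫ (α_ P P P).inv ≫ (β_ P P).hom ▷ P ≫ (α_ P P P).hom) ⊗≫ 𝟙 _ := by
            monoidal
      _ = _ := by
            rw [e]
            monoidal
  exact h _

theorem toLast_toLast : ∀ (n : ℕ) (a b : Fin (n + 2)) (c d : Fin (n + 1)),
    a.succAbove c = b → b.succAbove d = a →
    toLast P (n + 1) a ≫ wk P (toLast P n c) ≫ swapLast P n =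
      toLast P (n + 1) b ≫ wk P (toLast P n d) := by
  intro n
  induction n with
  | zero =>
    intro a b c d h1 h2
    obtain rfl : c = Fin.last 0 := Subsingleton.elim (α := Fin 1) _ _
    obtain rfl : d = Fin.last 0 := Subsingleton.elim (α := Fin 1) _ _
    subst h1
    induction a using Fin.lastCases with
    | last =>
      rw [Fin.succAbove_last, toLast_castSucc, toLast_last, toLast_last, wk_id]
      simp
    | cast a =>
      obtain rfl : a = Fin.last 0 := Subsingleton.elim (α := Fin 1) _ _
      have : (Fin.last 0).castSucc.succAbove (Fin.last 0) = Fin.last 1 := rfl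
      rw [this, toLast_castSucc, toLast_last, toLast_last, wk_id]
      simp [swap_swap]
  | succ n ih =>
    intro a b c d h1 h2
    induction a using Fin.lastCases with
    | last =>
      have hb : b = c.castSucc := by rw [← h1, Fin.succAbove_last]
      subst hb
      have hd : d = Fin.last _ := by
        apply Fin.succAbove_right_injective (p := c.castSucc)
        rw [h2, Fin.succAbove_castSucc_of_le _ _ (Fin.le_last c), Fin.succ_last]
      subst hd
      rw [toLast_castSucc, toLast_last, toLast_last, wk_id]
      simp
    | cast a =>
      induction b using Fin.lastCases with
      | last =>
        have hd : d = a := by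
          rw [Fin.succAbove_last] at h2
          exact Fin.castSucc_injective _ h2
        subst hd
        have hc : c = Fin.last _ := by
          apply Fin.succAbove_right_injective (p := d.castSucc)
          rw [h1, Fin.succAbove_castSucc_of_le _ _ (Fin.le_last d), Fin.succ_last]
        subst hc
        rw [toLast_castSucc, toLast_last, toLast_last, wk_id]
        simp [swap_swap]
      | cast b =>
        induction c using Fin.lastCases with
        | last =>
          rw [Fin.succAbove_castSucc_of_le _ _ (Fin.le_last a), Fin.succ_last] at h1
          exact absurd h1 (Fin.castSucc_lt_last b).ne'
        | cast c =>
          induction d using Fin.lastCases with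
          | last =>
            rw [Fin.succAbove_castSucc_of_le _ _ (Fin.le_last b), Fin.succ_last] at h2
            exact absurd h2 (Fin.castSucc_lt_last a).ne'
          | cast d =>
            rw [Fin.castSucc_succAbove_castSucc] at h1 h2
            have hi := congrArg (wk P) (ih a b c d (Fin.castSucc_injective _ h1)
              (Fin.castSucc_injective _ h2))
            simp only [toLast_castSucc, wk_comp, Category.assoc] at hi ⊢
            rw [← reassoc_of% (swap_nat P (toLast P n c)), ← swap_braid,
              reassoc_of% hi, reassoc_of% (swap_nat P (toLast P n d))]

theorem powPerm_succ {n m : ℕ} (e : Fin (n + 1) ≃ Fin (m + 1)) :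
    powPerm P e = toLast P n (e.symm (Fin.last m)) ≫ wk P (powPerm P (delEquiv e (Fin.last m))) := by
  simp [powPerm]

theorem succAbove_comm_aux {n : ℕ} (a b : Fin (n + 2)) (c d : Fin (n + 1)) (h1 : a.succAbove c = b)
    (h2 : b.succAbove d = a) (i : Fin n) :
    a.succAbove (c.succAbove i) = b.succAbove (d.succAbove i) := by
  simp only [Fin.succAbove, Fin.lt_def, Fin.ext_iff, Fin.val_castSucc] at *
  split_ifs at * <;> simp_all <;> omega

theorem powPerm_toLast : ∀ {n m : ℕ} (e : Fin (n + 1) ≃ Fin (m + 1)) (b : Fin (m + 1)),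
    powPerm P e ≫ toLast P m b = toLast P n (e.symm b) ≫ wk P (powPerm P (delEquiv e b)) := by
  intro n
  induction n with
  | zero =>
    intro m e b
    obtain rfl : m = 0 := by simpa using (Fintype.card_congr e).symm
    obtain rfl : b = Fin.last 0 := Subsingleton.elim (α := Fin 1) _ _
    rw [powPerm_succ, toLast_last]
    simp
  | succ n ih =>
    intro m e b
    obtain rfl : m = n + 1 := by simpa using (Fintype.card_congr e).symm
    induction b using Fin.lastCases with
    | last => rw [powPerm_succ, toLast_last, Category.comp_id]
    | cast b =>
      rw [powPerm_succ, toLast_castSucc, Category.assoc, ← reassoc_of% (wk_comp P), ih,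
        powPerm_succ P (delEquiv e _)]
      set a := e.symm (Fin.last (n + 1)) with ha
      set a' := e.symm b.castSucc with ha'
      set e₁ := delEquiv e (Fin.last (n + 1)) with he₁
      set e₂ := delEquiv e b.castSucc with he₂
      have s1 := delEquiv_spec e (Fin.last (n + 1))
      have s2 := delEquiv_spec e b.castSucc
      have k1 : a.succAbove (e₁.symm b) = a' := by
        rw [ha', Equiv.eq_symm_apply, ← s1, ← he₁, Equiv.apply_symm_apply, Fin.succAbove_last]
      have k2 : a'.succAbove (e₂.symm (Fin.last n)) = a := by
        rw [ha, Equiv.eq_symm_apply, ← s2, ← he₂, Equiv.apply_symm_apply,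
          Fin.succAbove_castSucc_of_le _ _ (Fin.le_last b), Fin.succ_last]
      have k3 : delEquiv e₂ (Fin.last n) = delEquiv e₁ b := by
        refine delEquiv_unique _ _ _ (e₂.apply_symm_apply _) _ fun i => ?_
        apply Fin.succAbove_right_injective (p := b.castSucc)
        rw [he₂, s2, ← he₂, ← ha', Fin.succAbove_last, Fin.castSucc_succAbove_castSucc,
          delEquiv_spec, ← Fin.succAbove_last, he₁, s1, ← he₁, ← ha,
          succAbove_comm_aux _ _ _ _ k1 k2]
      rw [wk_comp, wk_comp, Category.assoc, swap_nat, k3, reassoc_of% (toLast_toLast P n _ _ _ _ k1 k2)]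

theorem powPerm_refl : ∀ n : ℕ, powPerm P (Equiv.refl (Fin n)) = 𝟙 _ := by
  intro n
  induction n with
  | zero => rfl
  | succ n ih =>
    rw [powPerm_succ, delEquiv_unique (Equiv.refl _) (Fin.last n) (Fin.last n) rfl (Equiv.refl _)
      (fun i => rfl), ih, wk_id, Equiv.refl_symm, Equiv.refl_apply, toLast_last, Category.comp_id]

theorem powPerm_trans : ∀ {n m k : ℕ} (e : Fin n ≃ Fin m) (f : Fin m ≃ Fin k),
    powPerm P (e.trans f) = powPerm P e ≫ powPerm P f := by
  intro n
  induction n with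
  | zero =>
    intro m k e f
    obtain rfl : m = 0 := by simpa using (Fintype.card_congr e).symm
    obtain rfl : k = 0 := by simpa using (Fintype.card_congr f).symm
    exact (Category.comp_id _).symm
  | succ n ih =>
    intro m k e f
    obtain rfl : m = n + 1 := by simpa using (Fintype.card_congr e).symm
    obtain rfl : k = n + 1 := by simpa using (Fintype.card_congr f).symm
    rw [powPerm_succ P (e.trans f), powPerm_succ P f, reassoc_of% (powPerm_toLast P e), ← wk_comp, ← ih,
      Equiv.symm_trans_apply]
    congr 3
    refine delEquiv_unique _ (e.symm (f.symm (Fin.last n))) _ (by simp) _ fun i => ?_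
    rw [Equiv.trans_apply, delEquiv_spec, delEquiv_spec]
    rfl

/-- The symmetric sequence `n ↦ P^{∧n}`, the symmetric groups permuting the factors. -/
def powFunctor : FinBij ⥤ C where
  obj a := powObj P a.card
  map e := powPerm P e
  map_id _ := powPerm_refl P _
  map_comp e f := powPerm_trans P e f

/-- The canonical isomorphism `P^{∧(n+m)} ≅ P^{∧n} ∧ P^{∧m}`. -/
def powSplit (n : ℕ) : ∀ m : ℕ, powObj P (n + m) ⟶ powObj P n ⊗ powObj P m
  | 0 => (ρ_ (powObj P n)).inv
  | m + 1 => (powSplit n m ▷ P) ≫ (α_ (powObj P n) (powObj P m) P).hom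

end Pow

/-! ### The simplicial spheres -/

/-- The non-basepoint simplices of the simplicial circle `S¹ = Δ[1]/∂Δ[1]` in dimension `k`. -/
abbrev Circ (k : SimplexCategory) : Type :=
  {g : k ⟶ SimplexCategory.mk 1 // Function.Surjective g.toOrderHom}

instance (k : SimplexCategory) : Finite (Circ k) :=
  Finite.of_injective (fun g : Circ k => (g.1.toOrderHom : Fin (k.len + 1) → Fin 2))
    fun _ _ h => Subtype.ext (SimplexCategory.Hom.ext _ _ (OrderHom.ext _ _ h))

/-- `S¹` in dimension `k` is the pointed set `Option (Circ k)`; this is its simplicial structure. -/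
def circRes {k l : SimplexCategory} (f : k ⟶ l) : Option (Circ l) → Option (Circ k)
  | none => none
  | some g => open Classical in
      if h : Function.Surjective (f ≫ g.1).toOrderHom then some ⟨f ≫ g.1, h⟩ else none

/-! ### Pointed simplicial symmetric sequences and symmetric ring spectra -/

/-- Symmetric sequences of pointed simplicial sets. -/
abbrev PtdSymSeq := FinBij ⥤ SimplicialObject Pointed.{w}

namespace PtdSymSeq

/-- The `k`-simplices of the `n`-th pointed simplicial set. -/
def el (X : PtdSymSeq.{w}) (n : ℕ) (k : SimplexCategory) : Type w :=
  ((X.obj ⟨n⟩).obj (op k)).X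

/-- The basepoint. -/
def pt (X : PtdSymSeq.{w}) (n : ℕ) (k : SimplexCategory) : X.el n k :=
  ((X.obj ⟨n⟩).obj (op k)).point

/-- The simplicial structure. -/
def res (X : PtdSymSeq.{w}) {n : ℕ} {k l : SimplexCategory} (f : k ⟶ l) : X.el n l → X.el n k :=
  ((X.obj ⟨n⟩).map f.op).toFun

/-- The action of bijections; for `n = m` this is the left action of the symmetric group. -/
def perm (X : PtdSymSeq.{w}) {n m : ℕ} (e : Fin n ≃ Fin m) {k : SimplexCategory} :
    X.el n k → X.el m k :=
  ((X.map (FinBij.of e)).app (op k)).toFun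

/-- A morphism of symmetric sequences, on simplices. -/
def ap {X Y : PtdSymSeq.{w}} (f : X ⟶ Y) {n : ℕ} {k : SimplexCategory} : X.el n k → Y.el n k :=
  ((f.app ⟨n⟩).app (op k)).toFun

end PtdSymSeq

/-- The data of a symmetric ring `S¹`-spectrum: a symmetric sequence of pointed simplicial sets,
multiplication maps and two unit maps `S⁰ ⟶ R 0`, `S¹ ⟶ R 1`. -/
structure SymRingData where
  seq : PtdSymSeq.{w}
  mul : ∀ {n m : ℕ} {k : SimplexCategory}, seq.el n k → seq.el m k → seq.el (n + m) k
  one₀ : ∀ k : SimplexCategory, seq.el 0 k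
  one₁ : ∀ {k : SimplexCategory}, Option (Circ k) → seq.el 1 k

/-- The axioms of a symmetric ring `S¹`-spectrum. The first four say that `mul` consists of
`Σ_n × Σ_m`-equivariant maps of pointed simplicial sets `R n ∧ R m ⟶ R (n + m)`. -/
structure SymRingData.IsSymRing (R : SymRingData.{w}) : Prop where
  pt_mul : ∀ {n m : ℕ} {k : SimplexCategory} (y : R.seq.el m k),
    R.mul (R.seq.pt n k) y = R.seq.pt (n + m) k
  mul_pt : ∀ {n m : ℕ} {k : SimplexCategory} (x : R.seq.el n k),
    R.mul x (R.seq.pt m k) = R.seq.pt (n + m) k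
  mul_res : ∀ {n m : ℕ} {k l : SimplexCategory} (f : k ⟶ l) (x : R.seq.el n l) (y : R.seq.el m l),
    R.seq.res f (R.mul x y) = R.mul (R.seq.res f x) (R.seq.res f y)
  mul_perm : ∀ {n m : ℕ} {k : SimplexCategory} (e : Equiv.Perm (Fin n)) (f : Equiv.Perm (Fin m))
    (x : R.seq.el n k) (y : R.seq.el m k),
    R.mul (R.seq.perm e x) (R.seq.perm f y) = R.seq.perm (blockSum e f) (R.mul x y)
  mul_assoc : ∀ {n m p : ℕ} {k : SimplexCategory} (x : R.seq.el n k) (y : R.seq.el m k)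
    (z : R.seq.el p k),
    R.seq.perm (finCongr (Nat.add_assoc n m p)) (R.mul (R.mul x y) z) = R.mul x (R.mul y z)
  one₀_res : ∀ {k l : SimplexCategory} (f : k ⟶ l), R.seq.res f (R.one₀ l) = R.one₀ k
  mul_one : ∀ {n : ℕ} {k : SimplexCategory} (x : R.seq.el n k), R.mul x (R.one₀ k) = x
  one_mul : ∀ {n : ℕ} {k : SimplexCategory} (x : R.seq.el n k),
    R.mul (R.one₀ k) x = R.seq.perm (finCongr (Nat.zero_add n).symm) x
  one₁_pt : ∀ k : SimplexCategory, R.one₁ (none : Option (Circ k)) = R.seq.pt 1 k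
  one₁_res : ∀ {k l : SimplexCategory} (f : k ⟶ l) (s : Option (Circ l)),
    R.seq.res f (R.one₁ s) = R.one₁ (circRes f s)
  central : ∀ {n : ℕ} {k : SimplexCategory} (x : R.seq.el n k) (s : Option (Circ k)),
    R.seq.perm (shuffle n 1) (R.mul x (R.one₁ s)) = R.mul (R.one₁ s) x

/-- Commutativity of a symmetric ring spectrum. -/
def SymRingData.IsCommutative (R : SymRingData.{w}) : Prop :=
  ∀ {n m : ℕ} {k : SimplexCategory} (x : R.seq.el n k) (y : R.seq.el m k),
    R.seq.perm (shuffle n m) (R.mul x y) = R.mul y x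

/-- Commutative symmetric ring `S¹`-spectra. -/
structure CommSymRing extends SymRingData.{w} where
  isSymRing : toSymRingData.IsSymRing
  isCommutative : toSymRingData.IsCommutative

/-! ### Right modules and their smash product -/

/-- The data of a right module over a symmetric ring `S¹`-spectrum: a symmetric sequence, the
structure maps `M n ∧ S¹ ⟶ M (n + 1)` of a spectrum, and the action maps
`M n ∧ R m ⟶ M (n + m)`. -/
structure SymModData (R : CommSymRing.{w}) where
  seq : PtdSymSeq.{w}
  str : ∀ {n : ℕ} {k : SimplexCategory}, seq.el n k → Option (Circ k) → seq.el (n + 1) k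
  act : ∀ {n m : ℕ} {k : SimplexCategory}, seq.el n k → R.seq.el m k → seq.el (n + m) k

/-- The axioms of a right module. By `str_eq` the spectrum structure is the one underlying the
action; this makes the structure maps pointed and simplicial and, `one₁` being central, their
iterates `M n ∧ S^p ⟶ M (n + p)` equivariant under `Σ_n × Σ_p`. -/
structure SymModData.IsModule {R : CommSymRing.{w}} (M : SymModData R) : Prop where
  pt_act : ∀ {n m : ℕ} {k : SimplexCategory} (r : R.seq.el m k),
    M.act (M.seq.pt n k) r = M.seq.pt (n + m) k
  act_pt : ∀ {n m : ℕ} {k : SimplexCategory} (x : M.seq.el n k),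
    M.act x (R.seq.pt m k) = M.seq.pt (n + m) k
  act_res : ∀ {n m : ℕ} {k l : SimplexCategory} (f : k ⟶ l) (x : M.seq.el n l) (r : R.seq.el m l),
    M.seq.res f (M.act x r) = M.act (M.seq.res f x) (R.seq.res f r)
  act_perm : ∀ {n m : ℕ} {k : SimplexCategory} (e : Equiv.Perm (Fin n)) (f : Equiv.Perm (Fin m))
    (x : M.seq.el n k) (r : R.seq.el m k),
    M.act (M.seq.perm e x) (R.seq.perm f r) = M.seq.perm (blockSum e f) (M.act x r)
  act_mul : ∀ {n m p : ℕ} {k : SimplexCategory} (x : M.seq.el n k) (r : R.seq.el m k)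
    (s : R.seq.el p k),
    M.seq.perm (finCongr (Nat.add_assoc n m p)) (M.act (M.act x r) s) = M.act x (R.mul r s)
  act_one : ∀ {n : ℕ} {k : SimplexCategory} (x : M.seq.el n k), M.act x (R.one₀ k) = x
  str_eq : ∀ {n : ℕ} {k : SimplexCategory} (x : M.seq.el n k) (s : Option (Circ k)),
    M.str x s = M.act x (R.one₁ s)

/-- Right modules over a commutative symmetric ring spectrum. -/
structure SymMod (R : CommSymRing.{w}) extends SymModData R where
  isModule : toSymModData.IsModule

namespace SymMod

variable {R : CommSymRing.{w}}

/-- Morphisms of right modules. -/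
@[ext]
structure Hom (M N : SymMod R) where
  hom : M.seq ⟶ N.seq
  map_act : ∀ {n m : ℕ} {k : SimplexCategory} (x : M.seq.el n k) (r : R.seq.el m k),
    PtdSymSeq.ap hom (M.act x r) = N.act (PtdSymSeq.ap hom x) r

instance : Category (SymMod R) where
  Hom := Hom
  id M := ⟨𝟙 _, fun _ _ => rfl⟩
  comp f g := ⟨f.hom ≫ g.hom, fun x r =>
    (congrArg (PtdSymSeq.ap g.hom) (f.map_act x r)).trans (g.map_act _ r)⟩

/-- A morphism of modules, on simplices. -/
def ap {M N : SymMod R} (f : M ⟶ N) {n : ℕ} {k : SimplexCategory} :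
    M.seq.el n k → N.seq.el n k :=
  PtdSymSeq.ap (Hom.hom f)

variable (R) in
/-- The ring spectrum `R` as a right module over itself. -/
def regular : SymMod R where
  seq := R.seq
  str x s := R.mul x (R.one₁ s)
  act x r := R.mul x r
  isModule :=
    { pt_act := R.isSymRing.pt_mul
      act_pt := R.isSymRing.mul_pt
      act_res := R.isSymRing.mul_res
      act_perm := R.isSymRing.mul_perm
      act_mul := R.isSymRing.mul_assoc
      act_one := R.isSymRing.mul_one
      str_eq := fun _ _ => rfl }

/-- `R`-bilinear bimorphisms `(X, Y) ⟶ Z`: `Σ_p × Σ_q`-equivariant maps of pointed simplicial sets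
`X p ∧ Y q ⟶ Z (p + q)` such that, for `x`, `y`, `r` of degrees `p`, `q`, `r`,
`b (x, y · r) = b (x, y) · r` and `b (x, y) · r = (1 × χ_{r,q}) b (x · r, y)`. -/
structure BiMor (X Y Z : SymMod R) where
  b : ∀ {p q : ℕ} {k : SimplexCategory}, X.seq.el p k → Y.seq.el q k → Z.seq.el (p + q) k
  pt_b : ∀ {p q : ℕ} {k : SimplexCategory} (y : Y.seq.el q k),
    b (X.seq.pt p k) y = Z.seq.pt (p + q) k
  b_pt : ∀ {p q : ℕ} {k : SimplexCategory} (x : X.seq.el p k),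
    b x (Y.seq.pt q k) = Z.seq.pt (p + q) k
  b_res : ∀ {p q : ℕ} {k l : SimplexCategory} (f : k ⟶ l) (x : X.seq.el p l) (y : Y.seq.el q l),
    Z.seq.res f (b x y) = b (X.seq.res f x) (Y.seq.res f y)
  b_perm : ∀ {p q : ℕ} {k : SimplexCategory} (e : Equiv.Perm (Fin p)) (f : Equiv.Perm (Fin q))
    (x : X.seq.el p k) (y : Y.seq.el q k),
    b (X.seq.perm e x) (Y.seq.perm f y) = Z.seq.perm (blockSum e f) (b x y)
  b_act_right : ∀ {p q m : ℕ} {k : SimplexCategory} (x : X.seq.el p k) (y : Y.seq.el q k)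
    (r : R.seq.el m k),
    b x (Y.act y r) = Z.seq.perm (finCongr (Nat.add_assoc p q m)) (Z.act (b x y) r)
  b_act_left : ∀ {p q m : ℕ} {k : SimplexCategory} (x : X.seq.el p k) (y : Y.seq.el q k)
    (r : R.seq.el m k),
    b x (Y.act y r) = Z.seq.perm ((finCongr (Nat.add_assoc p m q)).trans
      (blockSum (Equiv.refl (Fin p)) (shuffle m q))) (b (X.act x r) y)

/-- The assertion that a symmetric monoidal structure on the category of right `R`-modules is the
smash product over `R`: the unit is `R`, the product `X ⊗ Y` carries the universal `R`-bilinear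
bimorphism `(x, y) ↦ x ∧ y`, and tensor products of morphisms and the coherence isomorphisms are the
standard ones, which are determined by their values on the elements `x ∧ y`. -/
structure SmashStructure (R : CommSymRing.{w}) [MonoidalCategory (SymMod R)]
    [SymmetricCategory (SymMod R)] where
  unitIso : 𝟙_ (SymMod R) ≅ regular R
  smash : ∀ X Y : SymMod R, BiMor X Y (X ⊗ Y)
  universal : ∀ {X Y Z : SymMod R} (c : BiMor X Y Z), ∃! f : X ⊗ Y ⟶ Z,
    ∀ {p q : ℕ} {k : SimplexCategory} (x : X.seq.el p k) (y : Y.seq.el q k),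
      ap f ((smash X Y).b x y) = c.b x y
  tensorHom_smash : ∀ {X X' Y Y' : SymMod R} (f : X ⟶ X') (g : Y ⟶ Y') {p q : ℕ}
    {k : SimplexCategory} (x : X.seq.el p k) (y : Y.seq.el q k),
      ap (f ⊗ₘ g) ((smash X Y).b x y) = (smash X' Y').b (ap f x) (ap g y)
  associator_smash : ∀ {X Y Z : SymMod R} {p q r : ℕ} {k : SimplexCategory} (x : X.seq.el p k)
    (y : Y.seq.el q k) (z : Z.seq.el r k),
      ap (α_ X Y Z).hom ((smash (X ⊗ Y) Z).b ((smash X Y).b x y) z) =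
        (X ⊗ (Y ⊗ Z)).seq.perm (finCongr (Nat.add_assoc p q r).symm)
          ((smash X (Y ⊗ Z)).b x ((smash Y Z).b y z))
  rightUnitor_smash : ∀ {X : SymMod R} {p q : ℕ} {k : SimplexCategory} (x : X.seq.el p k)
    (r : R.seq.el q k), ap (ρ_ X).hom ((smash X (𝟙_ (SymMod R))).b x (ap unitIso.inv r)) = X.act x r
  leftUnitor_smash : ∀ {X : SymMod R} {p q : ℕ} {k : SimplexCategory} (x : X.seq.el p k)
    (r : R.seq.el q k), ap (λ_ X).hom ((smash (𝟙_ (SymMod R)) X).b (ap unitIso.inv r) x) =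
      X.seq.perm (shuffle p q) (X.act x r)
  braiding_smash : ∀ {X Y : SymMod R} {p q : ℕ} {k : SimplexCategory} (x : X.seq.el p k)
    (y : Y.seq.el q k), ap (β_ X Y).hom ((smash X Y).b x y) =
      (Y ⊗ X).seq.perm (shuffle q p) ((smash Y X).b y x)

end SymMod

/-! ### Enriched categories with prescribed morphism objects; symmetric monoidal enriched
categories -/

section Enriched

variable (V : Type u) [Category.{v} V] [MonoidalCategory V]

/-- The structure of a `V`-category with the morphism objects `H X Y`. -/
structure EnrichmentOn {V : Type u} [Category.{v} V] [MonoidalCategory V] {D : Type w}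
    (H : D → D → V) where
  id : ∀ X : D, 𝟙_ V ⟶ H X X
  comp : ∀ X Y Z : D, H X Y ⊗ H Y Z ⟶ H X Z
  id_comp : ∀ X Y : D, (λ_ (H X Y)).inv ≫ id X ▷ H X Y ≫ comp X X Y = 𝟙 _
  comp_id : ∀ X Y : D, (ρ_ (H X Y)).inv ≫ H X Y ◁ id Y ≫ comp X Y Y = 𝟙 _
  assoc : ∀ W X Y Z : D, (α_ (H W X) (H X Y) (H Y Z)).inv ≫ comp W X Y ▷ H Y Z ≫ comp W Y Z =
    H W X ◁ comp X Y Z ≫ comp W X Z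

/-- The `V`-category given by an `EnrichmentOn`. -/
@[reducible]
def EnrichmentOn.toEnrichedCategory {V : Type u} [Category.{v} V] [MonoidalCategory V] {D : Type w}
    {H : D → D → V} (e : EnrichmentOn H) : EnrichedCategory V D where
  Hom := H
  id := e.id
  comp := e.comp
  id_comp := e.id_comp
  comp_id := e.comp_id
  assoc := e.assoc

variable {D : Type w} [EnrichedCategory V D]

/-- Composition in the underlying category of a `V`-category. -/
def uComp {X Y Z : D} (f : 𝟙_ V ⟶ (X ⟶[V] Y)) (g : 𝟙_ V ⟶ (Y ⟶[V] Z)) : 𝟙_ V ⟶ (X ⟶[V] Z) :=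
  (λ_ (𝟙_ V)).inv ≫ (f ⊗ₘ g) ≫ eComp V X Y Z

/-- Composition with an underlying morphism `Y ⟶ Z` on the side of the target. -/
def uPost (X : D) {Y Z : D} (g : 𝟙_ V ⟶ (Y ⟶[V] Z)) : (X ⟶[V] Y) ⟶ (X ⟶[V] Z) :=
  (ρ_ (X ⟶[V] Y)).inv ≫ (X ⟶[V] Y) ◁ g ≫ eComp V X Y Z

/-- Composition with an underlying morphism `X ⟶ Y` on the side of the source. -/
def uPre {X Y : D} (f : 𝟙_ V ⟶ (X ⟶[V] Y)) (Z : D) : (Y ⟶[V] Z) ⟶ (X ⟶[V] Z) :=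
  (λ_ (Y ⟶[V] Z)).inv ≫ f ▷ (Y ⟶[V] Z) ≫ eComp V X Y Z

/-- Isomorphisms in the underlying category of a `V`-category. -/
structure UIso (X Y : D) where
  hom : 𝟙_ V ⟶ (X ⟶[V] Y)
  inv : 𝟙_ V ⟶ (Y ⟶[V] X)
  hom_inv_id : uComp V hom inv = eId V X
  inv_hom_id : uComp V inv hom = eId V Y

/-- A symmetric monoidal structure on a `V`-category `D` with product `tens` and unit `one` on
objects: a `V`-functor `D ⊗ D ⟶ D` which is `tens` on objects, `V`-natural associativity, unit and
symmetry isomorphisms, and the coherence axioms in the underlying category. -/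
structure SymMonEnrichment (V : Type u) [Category.{v} V] [MonoidalCategory V] [SymmetricCategory V]
    {D : Type w} [EnrichedCategory V D] (tens : D → D → D) (one : D) where
  tensorHom : ∀ X X' Y Y' : D, (X ⟶[V] X') ⊗ (Y ⟶[V] Y') ⟶ (tens X Y ⟶[V] tens X' Y')
  tensorHom_id : ∀ X Y : D,
    (λ_ (𝟙_ V)).inv ≫ (eId V X ⊗ₘ eId V Y) ≫ tensorHom X X Y Y = eId V (tens X Y)
  tensorHom_comp : ∀ X X' X'' Y Y' Y'' : D,
    tensorμ (X ⟶[V] X') (Y ⟶[V] Y') (X' ⟶[V] X'') (Y' ⟶[V] Y'') ≫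
        (eComp V X X' X'' ⊗ₘ eComp V Y Y' Y'') ≫ tensorHom X X'' Y Y'' =
      (tensorHom X X' Y Y' ⊗ₘ tensorHom X' X'' Y' Y'') ≫
        eComp V (tens X Y) (tens X' Y') (tens X'' Y'')
  associator : ∀ X Y Z : D, UIso V (tens (tens X Y) Z) (tens X (tens Y Z))
  leftUnitor : ∀ X : D, UIso V (tens one X) X
  rightUnitor : ∀ X : D, UIso V (tens X one) X
  braiding : ∀ X Y : D, UIso V (tens X Y) (tens Y X)
  associator_naturality : ∀ X X' Y Y' Z Z' : D,
    tensorHom X X' Y Y' ▷ (Z ⟶[V] Z') ≫ tensorHom (tens X Y) (tens X' Y') Z Z' ≫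
        uPost V (tens (tens X Y) Z) (associator X' Y' Z').hom =
      (α_ (X ⟶[V] X') (Y ⟶[V] Y') (Z ⟶[V] Z')).hom ≫ (X ⟶[V] X') ◁ tensorHom Y Y' Z Z' ≫
        tensorHom X X' (tens Y Z) (tens Y' Z') ≫
        uPre V (associator X Y Z).hom (tens X' (tens Y' Z'))
  leftUnitor_naturality : ∀ X X' : D,
    (λ_ (X ⟶[V] X')).inv ≫ eId V one ▷ (X ⟶[V] X') ≫ tensorHom one one X X' ≫
        uPost V (tens one X) (leftUnitor X').hom =
      uPre V (leftUnitor X).hom X'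
  rightUnitor_naturality : ∀ X X' : D,
    (ρ_ (X ⟶[V] X')).inv ≫ (X ⟶[V] X') ◁ eId V one ≫ tensorHom X X' one one ≫
        uPost V (tens X one) (rightUnitor X').hom =
      uPre V (rightUnitor X).hom X'
  braiding_naturality : ∀ X X' Y Y' : D,
    tensorHom X X' Y Y' ≫ uPost V (tens X Y) (braiding X' Y').hom =
      (β_ (X ⟶[V] X') (Y ⟶[V] Y')).hom ≫ tensorHom Y Y' X X' ≫
        uPre V (braiding X Y).hom (tens Y' X')
  pentagon : ∀ W X Y Z : D,
    uComp V ((λ_ (𝟙_ V)).inv ≫ ((associator W X Y).hom ⊗ₘ eId V Z) ≫ tensorHom _ _ _ _)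
        (uComp V (associator W (tens X Y) Z).hom
          ((λ_ (𝟙_ V)).inv ≫ (eId V W ⊗ₘ (associator X Y Z).hom) ≫ tensorHom _ _ _ _)) =
      uComp V (associator (tens W X) Y Z).hom (associator W X (tens Y Z)).hom
  triangle : ∀ X Y : D,
    uComp V (associator X one Y).hom
        ((λ_ (𝟙_ V)).inv ≫ (eId V X ⊗ₘ (leftUnitor Y).hom) ≫ tensorHom _ _ _ _) =
      (λ_ (𝟙_ V)).inv ≫ ((rightUnitor X).hom ⊗ₘ eId V Y) ≫ tensorHom _ _ _ _
  hexagon : ∀ X Y Z : D,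
    uComp V (associator X Y Z).hom
        (uComp V (braiding X (tens Y Z)).hom (associator Y Z X).hom) =
      uComp V ((λ_ (𝟙_ V)).inv ≫ ((braiding X Y).hom ⊗ₘ eId V Z) ≫ tensorHom _ _ _ _)
        (uComp V (associator Y X Z).hom
          ((λ_ (𝟙_ V)).inv ≫ (eId V Y ⊗ₘ (braiding X Z).hom) ≫ tensorHom _ _ _ _))
  symmetry : ∀ X Y : D, uComp V (braiding X Y).hom (braiding Y X).hom = eId V (tens X Y)

end Enriched

/-! ### Symmetric ring `T`-spectra -/

section Correspondences

variable {C : Type u} [Category.{v} C] [MonoidalCategory C] [SymmetricCategory C]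

/-- Symmetric ring `T`-spectra in a symmetric monoidal category. -/
structure SymRingTSpectrum (T : C) where
  /-- the objects `E n` with their actions of the symmetric groups -/
  seq : FinBij ⥤ C
  mul : ∀ n m : ℕ, seq.obj ⟨n⟩ ⊗ seq.obj ⟨m⟩ ⟶ seq.obj ⟨n + m⟩
  one₀ : 𝟙_ C ⟶ seq.obj ⟨0⟩
  one₁ : T ⟶ seq.obj ⟨1⟩
  mul_perm : ∀ {n m : ℕ} (e : Equiv.Perm (Fin n)) (f : Equiv.Perm (Fin m)),
    (seq.map (FinBij.of e) ⊗ₘ seq.map (FinBij.of f)) ≫ mul n m =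
      mul n m ≫ seq.map (FinBij.of (blockSum e f))
  mul_assoc : ∀ n m p : ℕ,
    mul n m ▷ seq.obj ⟨p⟩ ≫ mul (n + m) p ≫ seq.map (FinBij.of (finCongr (Nat.add_assoc n m p))) =
      (α_ (seq.obj ⟨n⟩) (seq.obj ⟨m⟩) (seq.obj ⟨p⟩)).hom ≫ seq.obj ⟨n⟩ ◁ mul m p ≫ mul n (m + p)
  mul_one : ∀ n : ℕ,
    (ρ_ (seq.obj ⟨n⟩)).inv ≫ seq.obj ⟨n⟩ ◁ one₀ ≫ mul n 0 = 𝟙 (seq.obj ⟨n⟩)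
  one_mul : ∀ n : ℕ, (λ_ (seq.obj ⟨n⟩)).inv ≫ one₀ ▷ seq.obj ⟨n⟩ ≫ mul 0 n =
    seq.map (FinBij.of (finCongr (Nat.zero_add n).symm))
  central : ∀ n : ℕ,
    seq.obj ⟨n⟩ ◁ one₁ ≫ mul n 1 ≫ seq.map (FinBij.of (shuffle n 1)) =
      (β_ (seq.obj ⟨n⟩) T).hom ≫ one₁ ▷ seq.obj ⟨n⟩ ≫ mul 1 n

/-- Commutativity of a symmetric ring `T`-spectrum. -/
def SymRingTSpectrum.IsCommutative {T : C} (E : SymRingTSpectrum T) : Prop :=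
  ∀ n m : ℕ, E.mul n m ≫ E.seq.map (FinBij.of (shuffle n m)) =
    (β_ (E.seq.obj ⟨n⟩) (E.seq.obj ⟨m⟩)).hom ≫ E.mul m n

/-! ### The objects `A ∧ S^n` -/

variable [HasFiniteCoproducts C]

/-- `A ∧ S^n` in simplicial degree `k`: the coproduct of copies of `A` indexed by the non-basepoint
`k`-simplices of `S^n = S¹ ∧ ⋯ ∧ S¹`, i.e. by the `n`-tuples of non-basepoint `k`-simplices of
`S¹`. -/
def wedge (A : C) (n : ℕ) (k : SimplexCategory) : C := ∐ fun _ : Fin n → Circ k => A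

/-- The inclusion of the summand of `A ∧ S^n` with index `s`. -/
def wedgeι (A : C) {n : ℕ} {k : SimplexCategory} (s : Fin n → Circ k) : A ⟶ wedge A n k :=
  Sigma.ι (fun _ : Fin n → Circ k => A) s

/-- A morphism out of `A ∧ S^n`, given on the summands. -/
def wedgeDesc {A : C} {n : ℕ} {k : SimplexCategory} {Z : C} (f : (Fin n → Circ k) → (A ⟶ Z)) :
    wedge A n k ⟶ Z :=
  Sigma.desc f

@[simp]
theorem wedgeι_desc {A : C} {n : ℕ} {k : SimplexCategory} {Z : C} (f : (Fin n → Circ k) → (A ⟶ Z))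
    (s : Fin n → Circ k) : wedgeι A s ≫ wedgeDesc f = f s :=
  Sigma.ι_desc _ _

@[simp]
theorem wedgeι_desc_assoc {A : C} {n : ℕ} {k : SimplexCategory} {Z W : C}
    (f : (Fin n → Circ k) → (A ⟶ Z)) (s : Fin n → Circ k) (h : Z ⟶ W) :
    wedgeι A s ≫ wedgeDesc f ≫ h = f s ≫ h := by
  rw [← Category.assoc, wedgeι_desc]

theorem wedge_ext {A : C} {n : ℕ} {k : SimplexCategory} {Z : C} {f g : wedge A n k ⟶ Z}
    (h : ∀ s, wedgeι A s ≫ f = wedgeι A s ≫ g) : f = g :=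
  Sigma.hom_ext _ _ h

/-- Functoriality of `A ∧ S^n` in `A`. -/
def wedgeMap {A B : C} (f : A ⟶ B) (n : ℕ) (k : SimplexCategory) : wedge A n k ⟶ wedge B n k :=
  wedgeDesc fun s => f ≫ wedgeι B s

/-- The action of bijections on `A ∧ S^n` through the factors of `S^n`. -/
def wedgePerm (A : C) {n m : ℕ} (e : Fin n ≃ Fin m) (k : SimplexCategory) :
    wedge A n k ⟶ wedge A m k :=
  wedgeDesc fun s => wedgeι A (s ∘ e.symm)

/-- The identification `(A ∧ S^m) ∧ S^n ≅ A ∧ S^{n+m}`, the coordinates of `S^n` coming first. -/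
def wedgeFlatten (A : C) (n m : ℕ) (k : SimplexCategory) :
    wedge (wedge A m k) n k ⟶ wedge A (n + m) k :=
  wedgeDesc fun s => wedgeDesc fun t => wedgeι A (Fin.append s t)

section Zero

variable [HasZeroMorphisms C]

open Classical in
/-- The simplicial structure of `A ∧ S^n`: a summand whose index is sent to the basepoint is mapped
by the zero morphism. -/
def wedgeRes (A : C) (n : ℕ) {k l : SimplexCategory} (f : k ⟶ l) : wedge A n l ⟶ wedge A n k :=
  wedgeDesc fun s =>
    if h : ∀ i, Function.Surjective (f ≫ (s i).1).toOrderHom then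
      wedgeι A fun i => ⟨f ≫ (s i).1, h i⟩
    else 0

theorem wedgeRes_id (A : C) (n : ℕ) (k : SimplexCategory) : wedgeRes A n (𝟙 k) = 𝟙 _ := by
  refine wedge_ext fun s => ?_
  have h : ∀ i, Function.Surjective (𝟙 k ≫ (s i).1).toOrderHom := fun i => by
    rw [Category.id_comp]; exact (s i).2
  rw [wedgeRes, wedgeι_desc, dif_pos h, Category.comp_id]
  simp only [Category.id_comp]

theorem wedgeRes_comp (A : C) (n : ℕ) {j k l : SimplexCategory} (g : j ⟶ k) (f : k ⟶ l) :
    wedgeRes A n (g ≫ f) = wedgeRes A n f ≫ wedgeRes A n g := by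
  refine wedge_ext fun s => ?_
  simp only [wedgeRes, wedgeι_desc, wedgeι_desc_assoc]
  by_cases h : ∀ i, Function.Surjective (f ≫ (s i).1).toOrderHom
  · rw [dif_pos h, wedgeι_desc]
    simp only [Category.assoc]
  · rw [dif_neg h, zero_comp, dif_neg]
    intro h'
    refine h fun i => ?_
    have := h' i
    rw [Category.assoc] at this
    exact Function.Surjective.of_comp (g := g.toOrderHom) this

theorem wedgePerm_res (A : C) {n m : ℕ} (e : Fin n ≃ Fin m) {k l : SimplexCategory} (f : k ⟶ l) :
    wedgePerm A e l ≫ wedgeRes A m f = wedgeRes A n f ≫ wedgePerm A e k := by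
  refine wedge_ext fun s => ?_
  simp only [wedgePerm, wedgeRes, wedgeι_desc, wedgeι_desc_assoc]
  by_cases h : ∀ i, Function.Surjective (f ≫ (s i).1).toOrderHom
  · have h' : ∀ i, Function.Surjective (f ≫ ((s ∘ e.symm) i).1).toOrderHom :=
      fun i => h (e.symm i)
    rw [dif_pos h, dif_pos h', wedgeι_desc]
    rfl
  · rw [dif_neg h, zero_comp, dif_neg]
    intro h'
    refine h fun i => ?_
    simpa using h' (e i)

theorem wedgeMap_res {A B : C} (g : A ⟶ B) (n : ℕ) {k l : SimplexCategory} (f : k ⟶ l) :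
    wedgeMap g n l ≫ wedgeRes B n f = wedgeRes A n f ≫ wedgeMap g n k := by
  refine wedge_ext fun s => ?_
  simp only [wedgeMap, wedgeRes, wedgeι_desc, wedgeι_desc_assoc, Category.assoc]
  split_ifs <;> simp

end Zero

theorem wedgePerm_trans (A : C) {n m p : ℕ} (e : Fin n ≃ Fin m) (f : Fin m ≃ Fin p)
    (k : SimplexCategory) : wedgePerm A (e.trans f) k = wedgePerm A e k ≫ wedgePerm A f k := by
  refine wedge_ext fun s => ?_
  simp only [wedgePerm, wedgeι_desc, wedgeι_desc_assoc]
  rfl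

theorem wedgePerm_refl (A : C) (n : ℕ) (k : SimplexCategory) :
    wedgePerm A (Equiv.refl (Fin n)) k = 𝟙 _ := by
  refine wedge_ext fun s => ?_
  simp only [wedgePerm, wedgeι_desc, Category.comp_id]
  rfl

theorem wedgeMap_id (A : C) (n : ℕ) (k : SimplexCategory) : wedgeMap (𝟙 A) n k = 𝟙 _ := by
  refine wedge_ext fun s => ?_
  simp [wedgeMap]

theorem wedgeMap_comp {A B D : C} (f : A ⟶ B) (g : B ⟶ D) (n : ℕ) (k : SimplexCategory) :
    wedgeMap (f ≫ g) n k = wedgeMap f n k ≫ wedgeMap g n k := by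
  refine wedge_ext fun s => ?_
  simp [wedgeMap]

theorem wedgeMap_perm {A B : C} (g : A ⟶ B) {n m : ℕ} (e : Fin n ≃ Fin m) (k : SimplexCategory) :
    wedgeMap g n k ≫ wedgePerm B e k = wedgePerm A e k ≫ wedgeMap g m k := by
  refine wedge_ext fun s => ?_
  simp [wedgeMap, wedgePerm]

/-- The canonical isomorphism `(A ∧ S^n) ∧ B ≅ (A ∧ B) ∧ S^n`. -/
def wedgeTensorRight [∀ B : C, PreservesFiniteCoproducts (tensorRight B)] (A B : C) (n : ℕ)
    (k : SimplexCategory) : wedge A n k ⊗ B ⟶ wedge (A ⊗ B) n k :=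
  (PreservesCoproduct.iso (tensorRight B) fun _ : Fin n → Circ k => A).hom

/-- The canonical isomorphism `A ∧ (B ∧ S^n) ≅ (A ∧ B) ∧ S^n`. -/
def wedgeTensorLeft [∀ B : C, PreservesFiniteCoproducts (tensorRight B)] (A B : C) (n : ℕ)
    (k : SimplexCategory) : A ⊗ wedge B n k ⟶ wedge (A ⊗ B) n k :=
  (β_ A (wedge B n k)).hom ≫ wedgeTensorRight B A n k ≫ wedgeMap (β_ B A).hom n k

/-- The smash product of `f : A ⟶ X ∧ S^n` and `g : B ⟶ Y ∧ S^m`, followed by the canonical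
isomorphism `(X ∧ S^n) ∧ (Y ∧ S^m) ≅ (X ∧ Y) ∧ S^{n+m}`. -/
def smashMaps [∀ B : C, PreservesFiniteCoproducts (tensorRight B)] {A B X Y : C} {n m : ℕ}
    {k : SimplexCategory} (f : A ⟶ wedge X n k) (g : B ⟶ wedge Y m k) :
    A ⊗ B ⟶ wedge (X ⊗ Y) (n + m) k :=
  (f ⊗ₘ g) ≫ wedgeTensorRight X (wedge Y m k) n k ≫ wedgeMap (wedgeTensorLeft X Y m k) n k ≫
    wedgeFlatten (X ⊗ Y) n m k

/-! ### The ring spectrum `1^E` and the correspondences -/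

variable [HasZeroMorphisms C]

/-- The symmetric sequence of pointed simplicial sets `n ↦ Hom_C (G n, F n ∧ S^n)`, pointed at the
zero morphisms; a permutation `τ` acts by `f ↦ (τ ∧ τ) ∘ f ∘ τ⁻¹`. -/
def homSeq (G F : FinBij ⥤ C) : PtdSymSeq.{v} where
  obj a :=
    { obj := fun k => ⟨G.obj a ⟶ wedge (F.obj a) a.card k.unop, 0⟩
      map := fun f => ⟨fun g => g ≫ wedgeRes (F.obj a) a.card f.unop, zero_comp⟩
      map_id := fun k => Pointed.Hom.ext (funext fun g => by
        simp [wedgeRes_id])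
      map_comp := fun f f' => Pointed.Hom.ext (funext fun g => by
        simp [wedgeRes_comp]) }
  map {a b} e :=
    { app := fun k => ⟨fun g => G.map (FinBij.of (Equiv.symm e) : b ⟶ a) ≫ g ≫
          wedgeMap (F.map e) a.card k.unop ≫ wedgePerm (F.obj b) e k.unop, by simp⟩
      naturality := fun k l f => Pointed.Hom.ext (funext fun g => by
        simp [wedgePerm_res, reassoc_of% (wedgeMap_res (F.map e))]) }
  map_id a := by
    refine NatTrans.ext (funext fun k => Pointed.Hom.ext (funext fun g => ?_))
    have h1 : G.map (FinBij.of (Equiv.symm (𝟙 a : a ⟶ a)) : a ⟶ a) = 𝟙 (G.obj a) := G.map_id a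
    have h2 : wedgePerm (F.obj a) (𝟙 a : a ⟶ a) k.unop = 𝟙 _ := wedgePerm_refl _ _ _
    change G.map (FinBij.of (Equiv.symm (𝟙 a : a ⟶ a)) : a ⟶ a) ≫ g ≫
      wedgeMap (F.map (𝟙 a)) a.card k.unop ≫ wedgePerm (F.obj a) (𝟙 a : a ⟶ a) k.unop = g
    rw [h1, h2, F.map_id, wedgeMap_id]
    simp
  map_comp {a b c} e f := by
    refine NatTrans.ext (funext fun k => Pointed.Hom.ext (funext fun g => ?_))
    have h1 : G.map (FinBij.of (Equiv.symm (e ≫ f)) : c ⟶ a) =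
        G.map (FinBij.of (Equiv.symm f) : c ⟶ b) ≫ G.map (FinBij.of (Equiv.symm e) : b ⟶ a) :=
      G.map_comp _ _
    have h2 : wedgePerm (F.obj c) (e ≫ f) k.unop =
        wedgePerm (F.obj c) e k.unop ≫ wedgePerm (F.obj c) f k.unop := wedgePerm_trans _ _ _ _
    change G.map (FinBij.of (Equiv.symm (e ≫ f)) : c ⟶ a) ≫ g ≫
      wedgeMap (F.map (e ≫ f)) a.card k.unop ≫ wedgePerm (F.obj c) (e ≫ f) k.unop =
      G.map (FinBij.of (Equiv.symm f) : c ⟶ b) ≫ (G.map (FinBij.of (Equiv.symm e) : b ⟶ a) ≫ g ≫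
        wedgeMap (F.map e) a.card k.unop ≫ wedgePerm (F.obj b) e k.unop) ≫
        wedgeMap (F.map f) b.card k.unop ≫ wedgePerm (F.obj c) f k.unop
    rw [h1, h2, F.map_comp, wedgeMap_comp]
    simp only [Category.assoc]
    rw [← reassoc_of% (wedgeMap_perm (F.map f) e k.unop)]

variable {P T : C} (σ : P ⟶ T) (E : SymRingTSpectrum T)
variable [∀ B : C, PreservesFiniteCoproducts (tensorRight B)]

/-- The ring spectrum `1^E`, with `n`-th term `Hom_C (P^{∧n}, E n ∧ S^n)`. The unit `S¹ ⟶ 1^E 1`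
takes a simplex `s` to `P ⟶ T ⟶ E 1 ⟶ E 1 ∧ S¹`, the last map being the inclusion of the summand
`s`. -/
def oneE : SymRingData.{v} where
  seq := homSeq (powFunctor P) E.seq
  mul {n m k} (f : powObj P n ⟶ wedge (E.seq.obj ⟨n⟩) n k)
      (g : powObj P m ⟶ wedge (E.seq.obj ⟨m⟩) m k) :=
    (powSplit P n m ≫ smashMaps f g ≫ wedgeMap (E.mul n m) (n + m) k :
      powObj P (n + m) ⟶ wedge (E.seq.obj ⟨n + m⟩) (n + m) k)
  one₀ k := (E.one₀ ≫ wedgeι (E.seq.obj ⟨0⟩) (fun i => i.elim0) :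
    powObj P 0 ⟶ wedge (E.seq.obj ⟨0⟩) 0 k)
  one₁ {k} s := (match s with
    | none => 0
    | some s => (λ_ P).hom ≫ σ ≫ E.one₁ ≫ wedgeι (E.seq.obj ⟨1⟩) (fun _ => s) :
    powObj P 1 ⟶ wedge (E.seq.obj ⟨1⟩) 1 k)

/-- The sets `Corr_n(X, Y) = Hom_C (X ∧ P^{∧n}, Y ∧ E n ∧ S^n)` of correspondences, in simplicial
degree `k`. -/
abbrev Corr (P : C) {T : C} (E : SymRingTSpectrum T) (X Y : C) (n : ℕ) (k : SimplexCategory) :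
    Type v :=
  X ⊗ powObj P n ⟶ wedge (Y ⊗ E.seq.obj ⟨n⟩) n k

/-- The symmetric sequence `n ↦ Corr_n(X, Y)`. -/
def corrSeq (P : C) {T : C} (E : SymRingTSpectrum T) (X Y : C) : PtdSymSeq.{v} :=
  homSeq (powFunctor P ⋙ tensorLeft X) (E.seq ⋙ tensorLeft Y)

/-- The action `θ` of `1^E` on the correspondences. -/
def corrAct {X Y : C} {n m : ℕ} {k : SimplexCategory} (f : Corr P E X Y n k)
    (g : powObj P m ⟶ wedge (E.seq.obj ⟨m⟩) m k) : Corr P E X Y (n + m) k :=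
  X ◁ powSplit P n m ≫ (α_ X (powObj P n) (powObj P m)).inv ≫ smashMaps f g ≫
    wedgeMap ((α_ Y (E.seq.obj ⟨n⟩) (E.seq.obj ⟨m⟩)).hom ≫ Y ◁ E.mul n m) (n + m) k

/-- The structure maps `Corr_n(X, Y) ∧ S¹ ⟶ Corr_{n+1}(X, Y)`: the summand of index `s` takes `f` to
`f ∧ σ`, followed by the structure map `E n ∧ T ⟶ E (n + 1)` and the inclusion of the summand `s`
of `(Y ∧ E (n + 1) ∧ S^n) ∧ S¹`. -/
def corrStr {X Y : C} {n : ℕ} {k : SimplexCategory} (f : Corr P E X Y n k) :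
    Option (Circ k) → Corr P E X Y (n + 1) k
  | none => 0
  | some s => (α_ X (powObj P n) P).inv ≫ (f ⊗ₘ σ) ≫
      wedgeTensorRight (Y ⊗ E.seq.obj ⟨n⟩) T n k ≫
      wedgeMap ((α_ Y (E.seq.obj ⟨n⟩) T).hom ≫ Y ◁ (E.seq.obj ⟨n⟩ ◁ E.one₁ ≫ E.mul n 1)) n k ≫
      wedgeDesc fun t => wedgeι (Y ⊗ E.seq.obj ⟨n + 1⟩) (Fin.snoc t s)

/-- The composition pairing `φ` of correspondences. -/
def corrComp {X Y Z : C} {n m : ℕ} {k : SimplexCategory} (f : Corr P E X Y n k)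
    (g : Corr P E Y Z m k) : Corr P E X Z (n + m) k :=
  X ◁ powSplit P n m ≫ (α_ X (powObj P n) (powObj P m)).inv ≫ f ▷ powObj P m ≫
    wedgeTensorRight (Y ⊗ E.seq.obj ⟨n⟩) (powObj P m) n k ≫
    wedgeMap ((α_ Y (E.seq.obj ⟨n⟩) (powObj P m)).hom ≫
      Y ◁ (β_ (E.seq.obj ⟨n⟩) (powObj P m)).hom ≫ (α_ Y (powObj P m) (E.seq.obj ⟨n⟩)).inv ≫
      g ▷ E.seq.obj ⟨n⟩ ≫ wedgeTensorRight (Z ⊗ E.seq.obj ⟨m⟩) (E.seq.obj ⟨n⟩) m k ≫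
      wedgeMap ((α_ Z (E.seq.obj ⟨m⟩) (E.seq.obj ⟨n⟩)).hom ≫
        Z ◁ ((β_ (E.seq.obj ⟨m⟩) (E.seq.obj ⟨n⟩)).hom ≫ E.mul n m)) m k) n k ≫
    wedgeFlatten (Z ⊗ E.seq.obj ⟨n + m⟩) n m k

/-- The monoidal product `ψ` of correspondences. -/
def corrTensor {X X' Y Y' : C} {n m : ℕ} {k : SimplexCategory} (f : Corr P E X X' n k)
    (g : Corr P E Y Y' m k) : Corr P E (X ⊗ Y) (X' ⊗ Y') (n + m) k :=
  (X ⊗ Y) ◁ powSplit P n m ≫ tensorμ X Y (powObj P n) (powObj P m) ≫ smashMaps f g ≫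
    wedgeMap (tensorμ X' (E.seq.obj ⟨n⟩) Y' (E.seq.obj ⟨m⟩) ≫ (X' ⊗ Y') ◁ E.mul n m) (n + m) k

/-- The correspondence of level `0` given by a morphism of `C`. For `f = 𝟙 X` this is the identity
correspondence of `X`. -/
def corrOfHom (P : C) {T : C} (E : SymRingTSpectrum T) {X Y : C} (f : X ⟶ Y)
    (k : SimplexCategory) : Corr P E X Y 0 k :=
  (f ⊗ₘ E.one₀) ≫ wedgeι (Y ⊗ E.seq.obj ⟨0⟩) (fun i => i.elim0)

/-- The commutative symmetric ring spectrum `1^E`, given the proofs of the axioms. -/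
def oneERing (hR : (oneE σ E).IsSymRing) (hc : (oneE σ E).IsCommutative) : CommSymRing.{v} where
  toSymRingData := oneE σ E
  isSymRing := hR
  isCommutative := hc

/-- The data of the right `1^E`-module of correspondences from `X` to `Y`. -/
def corrData (hR : (oneE σ E).IsSymRing) (hc : (oneE σ E).IsCommutative) (X Y : C) :
    SymModData.{v} (oneERing σ E hR hc) where
  seq := corrSeq P E X Y
  str f s := corrStr σ E f s
  act f g := corrAct E f g

/-- The right `1^E`-module of correspondences from `X` to `Y`, given the proof of the axioms. -/
def corrMod (hR : (oneE σ E).IsSymRing) (hc : (oneE σ E).IsCommutative) (X Y : C)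
    (hM : (corrData σ E hR hc X Y).IsModule) : SymMod.{v} (oneERing σ E hR hc) where
  toSymModData := corrData σ E hR hc X Y
  isModule := hM

end Correspondences

end

/-!
The argument separates the algebra of modules from the algebra of correspondences.

*Modules.* Symmetric sequences, ring spectra and modules are handled through their simplices. The
smash product of right modules over a commutative symmetric ring spectrum `R` is the quotient
`SmashEl` of the set of triples `(e, x, y)`, with `e` a bijection out of a block sum, by the
relations that a bimorphism respects. It represents bimorphisms (`smashBi`, `smashDesc`), so a
morphism out of an iterated smash product is determined by its values on products of elements
(`tensor_hom_ext`), and every coherence axiom reduces to an identity between bijections of block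
sums. The `k`-simplices of the internal hom in degree `n` are the `R`-linear families over the
simplices of `Δ[k]` that raise the degree by `n`, and currying (`ihomEquiv`) makes the category of
modules closed.

*Parametrised morphisms.* Composition and monoidal product of correspondences only use the
symmetric monoidal structure: `f : X ∧ G ⟶ Y ∧ F` and `g : Y ∧ G' ⟶ Z ∧ F'` compose to
`X ∧ (G ∧ G') ⟶ Z ∧ (F ∧ F')` (`paramComp`), and there is likewise a monoidal product
`paramTensor`. These operations are associative, unital and symmetric up to the coherence
isomorphisms of the parameters, and they satisfy the interchange law `paramComp_paramTensor`.

*Convolution.* The powers `P^{∧n}` form a cocommutative graded comonoid (`powSplit_assoc`,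
`powPerm_blockSum`, `powPerm_shuffle`). Since `∧` distributes over finite coproducts
(`wedgeTensorLeft_isIso`), the objects `E n ∧ S^n` form, in each simplicial degree, a commutative
graded monoid `wedgeMon`; its commutativity combines that of `E` with the fact that the shuffle
exchanges the two spheres in `S^n ∧ S^m`. Precomposing with the comultiplication and postcomposing
with the multiplication turns parametrised morphisms into graded ones, `GrHom`, where the laws above
hold up to the permutations prescribed by the structure of modules (`GrHom.comp_assoc`,
`GrHom.comp_tensor`, `GrHom.tensor_assoc`, `GrHom.tensor_braiding`).

*Correspondences.* Distributivity identifies correspondences with graded morphisms for `wedgeMon`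
(`toCorr`), and this identification respects composition, monoidal product, permutations and the
action of `1^E`, the last being composition with a scalar (`corrComp_eq`, `corrTensor_eq`,
`toCorr_perm`, `corrAct_eq`). Hence composition and monoidal product are bimorphisms of modules
(`compBi`, `tensorBi`), and their linear extensions satisfy the axioms of a monoidal enriched
category, because these may be tested on elements. A morphism `h` of `C` gives a morphism of modules
`unitOfHom` from the unit, compatibly with composition and monoidal product (`unitOfHom_comp`,
`unitOfHom_tensor`); so the pentagon, triangle, hexagon and symmetry identities are the images of
those of `C`.
-/

noncomputable section

set_option linter.unusedSectionVars false

/-! ### Bijections of block sums -/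

section Bijections

@[simp] theorem blockSum_castAdd {n n' m m' : ℕ} (e : Fin n ≃ Fin n') (f : Fin m ≃ Fin m')
    (i : Fin n) : blockSum e f (Fin.castAdd m i) = Fin.castAdd m' (e i) := by
  simp [blockSum]

@[simp] theorem blockSum_natAdd {n n' m m' : ℕ} (e : Fin n ≃ Fin n') (f : Fin m ≃ Fin m')
    (j : Fin m) : blockSum e f (Fin.natAdd n j) = Fin.natAdd n' (f j) := by
  simp [blockSum]

@[simp] theorem shuffle_castAdd {n m : ℕ} (i : Fin n) :
    shuffle n m (Fin.castAdd m i) = Fin.natAdd m i := by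
  simp [shuffle]

@[simp] theorem shuffle_natAdd {n m : ℕ} (j : Fin m) :
    shuffle n m (Fin.natAdd n j) = Fin.castAdd n j := by
  simp [shuffle]

@[simp] theorem cast_assoc_left {n m p : ℕ} (h : n + m + p = n + (m + p)) (i : Fin n) :
    Fin.cast h (Fin.castAdd p (Fin.castAdd m i)) = Fin.castAdd (m + p) i := rfl

@[simp] theorem cast_assoc_mid {n m p : ℕ} (h : n + m + p = n + (m + p)) (i : Fin m) :
    Fin.cast h (Fin.castAdd p (Fin.natAdd n i)) = Fin.natAdd n (Fin.castAdd p i) := rfl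

@[simp] theorem cast_assoc_right {n m p : ℕ} (h : n + m + p = n + (m + p)) (i : Fin p) :
    Fin.cast h (Fin.natAdd (n + m) i) = Fin.natAdd n (Fin.natAdd m i) :=
  Fin.ext (Nat.add_assoc _ _ _)

@[simp] theorem cast_assoc_symm_left {n m p : ℕ} (h : n + (m + p) = n + m + p) (i : Fin n) :
    Fin.cast h (Fin.castAdd (m + p) i) = Fin.castAdd p (Fin.castAdd m i) := rfl

@[simp] theorem cast_assoc_symm_mid {n m p : ℕ} (h : n + (m + p) = n + m + p) (i : Fin m) :
    Fin.cast h (Fin.natAdd n (Fin.castAdd p i)) = Fin.castAdd p (Fin.natAdd n i) := rfl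

@[simp] theorem cast_assoc_symm_right {n m p : ℕ} (h : n + (m + p) = n + m + p) (i : Fin p) :
    Fin.cast h (Fin.natAdd n (Fin.natAdd m i)) = Fin.natAdd (n + m) i :=
  Fin.ext (Nat.add_assoc _ _ _).symm

@[simp] theorem blockSum_refl_refl {n m : ℕ} :
    blockSum (Equiv.refl (Fin n)) (Equiv.refl (Fin m)) = Equiv.refl _ := by
  simp [Equiv.ext_iff, Fin.forall_fin_add]

theorem blockSum_refl_zero {n m : ℕ} (e : Fin n ≃ Fin m) :
    blockSum e (Equiv.refl (Fin 0)) = e := by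
  ext i
  refine Fin.addCases (fun i => ?_) (fun i => i.elim0) i
  rw [blockSum_castAdd]
  rfl

@[simp] theorem shuffle_zero_left {m : ℕ} :
    shuffle 0 m = finCongr (Nat.zero_add m : 0 + m = m + 0) := by
  ext i
  refine Fin.addCases (fun i => i.elim0) (fun j => ?_) i
  rw [shuffle_natAdd]
  exact (Nat.zero_add _).symm

@[simp] theorem shuffle_zero_right {n : ℕ} :
    shuffle n 0 = finCongr (Nat.zero_add n).symm := by
  ext i
  refine Fin.addCases (fun i => ?_) (fun i => i.elim0) i
  rw [shuffle_castAdd]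
  exact (Nat.zero_add _)

end Bijections

/-! ### Elements of symmetric sequences -/

namespace PtdSymSeq

variable {X Y Z : PtdSymSeq.{w}} {n m p : ℕ} {k l j : SimplexCategory}

@[simp] theorem perm_refl (x : X.el n k) : X.perm (Equiv.refl _) x = x := by
  have h : X.map (FinBij.of (Equiv.refl (Fin n))) = 𝟙 _ := X.map_id _
  simp only [perm]
  rw [h]
  rfl

@[simp] theorem perm_perm (e : Fin n ≃ Fin m) (f : Fin m ≃ Fin p) (x : X.el n k) :
    X.perm f (X.perm e x) = X.perm (e.trans f) x := by
  have h : X.map (FinBij.of (e.trans f)) = X.map (FinBij.of e) ≫ X.map (FinBij.of f) :=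
    X.map_comp _ _
  simp only [perm]
  rw [h]
  rfl

theorem perm_symm_eq {e : Fin n ≃ Fin m} {x : X.el n k} {y : X.el m k} (h : X.perm e x = y) :
    X.perm e.symm y = x := by
  simp [← h]

theorem eq_perm_symm {e : Fin n ≃ Fin m} {x : X.el n k} {y : X.el m k} (h : X.perm e x = y) :
    x = X.perm e.symm y := (perm_symm_eq h).symm

/-- A bijection `Fin n ≃ Fin n` that fixes every element acts trivially. This is used for the
bijections `finCongr` between types that are equal by definition. -/
theorem perm_eq_self (e : Fin n ≃ Fin n) (he : ∀ i, e i = i) (x : X.el n k) : X.perm e x = x := by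
  rw [show e = Equiv.refl _ from Equiv.ext he, perm_refl]

@[simp] theorem perm_pt (e : Fin n ≃ Fin m) : X.perm e (X.pt n k) = X.pt m k :=
  ((X.map (FinBij.of e)).app (op k)).map_point

@[simp] theorem res_pt (f : k ⟶ l) : X.res f (X.pt n l) = X.pt n k :=
  ((X.obj ⟨n⟩).map f.op).map_point

@[simp] theorem res_id (x : X.el n k) : X.res (𝟙 k) x = x := by
  have h : (X.obj ⟨n⟩).map (𝟙 k : k ⟶ k).op = 𝟙 _ := (X.obj ⟨n⟩).map_id _
  simp only [res]
  rw [h]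
  rfl

@[simp] theorem res_res (f : j ⟶ k) (g : k ⟶ l) (x : X.el n l) :
    X.res f (X.res g x) = X.res (f ≫ g) x := by
  have h : (X.obj ⟨n⟩).map (f ≫ g).op = (X.obj ⟨n⟩).map g.op ≫ (X.obj ⟨n⟩).map f.op :=
    (X.obj ⟨n⟩).map_comp _ _
  simp only [res]
  rw [h]
  rfl

theorem res_perm (f : k ⟶ l) (e : Fin n ≃ Fin m) (x : X.el n l) :
    X.res f (X.perm e x) = X.perm e (X.res f x) :=
  (congrFun (congrArg Pointed.Hom.toFun ((X.map (FinBij.of e)).naturality f.op)) x).symm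

@[simp] theorem ap_pt (f : X ⟶ Y) : ap f (X.pt n k) = Y.pt n k :=
  ((f.app ⟨n⟩).app (op k)).map_point

theorem ap_res (φ : X ⟶ Y) (f : k ⟶ l) (x : X.el n l) : ap φ (X.res f x) = Y.res f (ap φ x) :=
  congrFun (congrArg Pointed.Hom.toFun ((φ.app ⟨n⟩).naturality f.op)) x

theorem ap_perm (φ : X ⟶ Y) (e : Fin n ≃ Fin m) (x : X.el n k) :
    ap φ (X.perm e x) = Y.perm e (ap φ x) :=
  congrFun (congrArg Pointed.Hom.toFun
    (congrArg (fun t => NatTrans.app t (op k)) (φ.naturality (FinBij.of e)))) x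

theorem hom_ext {φ ψ : X ⟶ Y} (h : ∀ (n : ℕ) (k : SimplexCategory) (x : X.el n k),
    ap φ x = ap ψ x) : φ = ψ :=
  NatTrans.ext (funext fun a => NatTrans.ext (funext fun k =>
    Pointed.Hom.ext (funext fun x => h a.card k.unop x)))

/-- A symmetric sequence of pointed simplicial sets from its elements and operations. -/
def ofEl (A : ℕ → SimplexCategory → Type w) (pt : ∀ n k, A n k)
    (res : ∀ {n : ℕ} {k l : SimplexCategory}, (k ⟶ l) → A n l → A n k)
    (perm : ∀ {n m : ℕ} {k : SimplexCategory}, (Fin n ≃ Fin m) → A n k → A m k)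
    (res_pt : ∀ {n : ℕ} {k l : SimplexCategory} (f : k ⟶ l), res f (pt n l) = pt n k)
    (res_id : ∀ {n : ℕ} {k : SimplexCategory} (x : A n k), res (𝟙 k) x = x)
    (res_res : ∀ {n : ℕ} {j k l : SimplexCategory} (f : j ⟶ k) (g : k ⟶ l) (x : A n l),
      res (f ≫ g) x = res f (res g x))
    (perm_pt : ∀ {n m : ℕ} {k : SimplexCategory} (e : Fin n ≃ Fin m), perm e (pt n k) = pt m k)
    (perm_refl : ∀ {n : ℕ} {k : SimplexCategory} (x : A n k), perm (Equiv.refl _) x = x)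
    (perm_trans : ∀ {n m p : ℕ} {k : SimplexCategory} (e : Fin n ≃ Fin m) (f : Fin m ≃ Fin p)
      (x : A n k), perm (e.trans f) x = perm f (perm e x))
    (perm_res : ∀ {n m : ℕ} {k l : SimplexCategory} (f : k ⟶ l) (e : Fin n ≃ Fin m) (x : A n l),
      perm e (res f x) = res f (perm e x)) : PtdSymSeq.{w} where
  obj a :=
    { obj := fun k => ⟨A a.card k.unop, pt _ _⟩
      map := fun f => ⟨res f.unop, res_pt _⟩
      map_id := fun _ => Pointed.Hom.ext (funext res_id)
      map_comp := fun f g => Pointed.Hom.ext (funext (res_res g.unop f.unop)) }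
  map e :=
    { app := fun _ => ⟨perm e, perm_pt _⟩
      naturality := fun _ _ f => Pointed.Hom.ext (funext (perm_res f.unop e)) }
  map_id _ := NatTrans.ext (funext fun _ => Pointed.Hom.ext (funext perm_refl))
  map_comp e f := NatTrans.ext (funext fun _ => Pointed.Hom.ext (funext (perm_trans e f)))

/-- A morphism of symmetric sequences from its values on elements. -/
def homMk (φ : ∀ {n : ℕ} {k : SimplexCategory}, X.el n k → Y.el n k)
    (map_pt : ∀ {n : ℕ} {k : SimplexCategory}, φ (X.pt n k) = Y.pt n k)
    (map_res : ∀ {n : ℕ} {k l : SimplexCategory} (f : k ⟶ l) (x : X.el n l),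
      φ (X.res f x) = Y.res f (φ x))
    (map_perm : ∀ {n m : ℕ} {k : SimplexCategory} (e : Fin n ≃ Fin m) (x : X.el n k),
      φ (X.perm e x) = Y.perm e (φ x)) : X ⟶ Y where
  app a :=
    { app := fun k => ⟨fun x => φ (n := a.card) (k := k.unop) x, map_pt⟩
      naturality := fun _ _ f => Pointed.Hom.ext (funext (map_res f.unop)) }
  naturality _ _ e := NatTrans.ext (funext fun _ => Pointed.Hom.ext (funext (map_perm e)))

end PtdSymSeq

/-! ### Elements of modules -/

namespace SymMod

variable {R : CommSymRing.{w}} {M N X Y Z W : SymMod R}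
variable {n n' m m' p q r : ℕ} {k l : SimplexCategory}

@[simp] theorem pt_act (s : R.seq.el m k) : M.act (M.seq.pt n k) s = M.seq.pt (n + m) k :=
  M.isModule.pt_act s

@[simp] theorem act_pt (x : M.seq.el n k) : M.act x (R.seq.pt m k) = M.seq.pt (n + m) k :=
  M.isModule.act_pt x

theorem res_act (f : k ⟶ l) (x : M.seq.el n l) (s : R.seq.el m l) :
    M.seq.res f (M.act x s) = M.act (M.seq.res f x) (R.seq.res f s) :=
  M.isModule.act_res f x s

theorem act_perm (e : Fin n ≃ Fin n') (f : Fin m ≃ Fin m') (x : M.seq.el n k)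
    (s : R.seq.el m k) :
    M.act (M.seq.perm e x) (R.seq.perm f s) = M.seq.perm (blockSum e f) (M.act x s) := by
  obtain rfl : n = n' := by simpa using Fintype.card_congr e
  obtain rfl : m = m' := by simpa using Fintype.card_congr f
  exact M.isModule.act_perm e f x s

theorem act_perm_left (e : Fin n ≃ Fin n') (x : M.seq.el n k) (s : R.seq.el m k) :
    M.act (M.seq.perm e x) s = M.seq.perm (blockSum e (Equiv.refl _)) (M.act x s) := by
  rw [← act_perm, PtdSymSeq.perm_refl]

theorem act_perm_right (f : Fin m ≃ Fin m') (x : M.seq.el n k) (s : R.seq.el m k) :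
    M.act x (R.seq.perm f s) = M.seq.perm (blockSum (Equiv.refl _) f) (M.act x s) := by
  rw [← act_perm, PtdSymSeq.perm_refl]

theorem act_act (x : M.seq.el n k) (s : R.seq.el m k) (t : R.seq.el p k) :
    M.act (M.act x s) t = M.seq.perm (finCongr (Nat.add_assoc n m p).symm)
      (M.act x (R.mul s t)) :=
  PtdSymSeq.eq_perm_symm (M.isModule.act_mul x s t)

@[simp] theorem act_one (x : M.seq.el n k) : M.act x (R.one₀ k) = x := M.isModule.act_one x

/-- The actions of two elements of a commutative ring spectrum commute up to the shuffle. -/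
theorem act_act_comm (x : M.seq.el n k) (s : R.seq.el m k) (t : R.seq.el p k) :
    M.act (M.act x s) t = M.seq.perm ((finCongr (Nat.add_assoc n p m)).trans
      ((blockSum (Equiv.refl _) (shuffle p m)).trans (finCongr (Nat.add_assoc n m p).symm)))
      (M.act (M.act x t) s) := by
  rw [act_act, act_act, ← R.isCommutative t s, act_perm_right]
  simp only [PtdSymSeq.perm_perm]
  rfl

@[simp] theorem ap_pt (f : M ⟶ N) : ap f (M.seq.pt n k) = N.seq.pt n k := PtdSymSeq.ap_pt _

theorem ap_res (φ : M ⟶ N) (f : k ⟶ l) (x : M.seq.el n l) :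
    ap φ (M.seq.res f x) = N.seq.res f (ap φ x) := PtdSymSeq.ap_res _ f x

theorem ap_perm (φ : M ⟶ N) (e : Fin n ≃ Fin m) (x : M.seq.el n k) :
    ap φ (M.seq.perm e x) = N.seq.perm e (ap φ x) := PtdSymSeq.ap_perm _ e x

theorem ap_act (φ : M ⟶ N) (x : M.seq.el n k) (s : R.seq.el m k) :
    ap φ (M.act x s) = N.act (ap φ x) s := φ.map_act x s

@[simp] theorem ap_id (x : M.seq.el n k) : ap (𝟙 M) x = x := rfl

@[simp] theorem ap_comp (f : M ⟶ N) (g : N ⟶ X) (x : M.seq.el n k) :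
    ap (f ≫ g) x = ap g (ap f x) := rfl

theorem hom_ext {φ ψ : M ⟶ N} (h : ∀ (n : ℕ) (k : SimplexCategory) (x : M.seq.el n k),
    ap φ x = ap ψ x) : φ = ψ :=
  Hom.ext (PtdSymSeq.hom_ext h)

/-- A morphism of modules from its values on elements. -/
def homMk (φ : ∀ {n : ℕ} {k : SimplexCategory}, M.seq.el n k → N.seq.el n k)
    (map_res : ∀ {n : ℕ} {k l : SimplexCategory} (f : k ⟶ l) (x : M.seq.el n l),
      φ (M.seq.res f x) = N.seq.res f (φ x))
    (map_perm : ∀ {n m : ℕ} {k : SimplexCategory} (e : Fin n ≃ Fin m) (x : M.seq.el n k),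
      φ (M.seq.perm e x) = N.seq.perm e (φ x))
    (map_act : ∀ {n m : ℕ} {k : SimplexCategory} (x : M.seq.el n k) (s : R.seq.el m k),
      φ (M.act x s) = N.act (φ x) s) : M ⟶ N :=
  -- The basepoint is `x · *`, where `*` is the basepoint of degree `0`.
  ⟨PtdSymSeq.homMk φ (fun {n k} => by
    have h := map_act (M.seq.pt n k) (R.seq.pt 0 k)
    rwa [act_pt, act_pt] at h) map_res map_perm, map_act⟩

namespace BiMor

variable (c : BiMor X Y Z)

theorem b_perm' {p p' q q' : ℕ} (e : Fin p ≃ Fin p') (f : Fin q ≃ Fin q') (x : X.seq.el p k)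
    (y : Y.seq.el q k) :
    c.b (X.seq.perm e x) (Y.seq.perm f y) = Z.seq.perm (blockSum e f) (c.b x y) := by
  obtain rfl : p = p' := by simpa using Fintype.card_congr e
  obtain rfl : q = q' := by simpa using Fintype.card_congr f
  exact c.b_perm e f x y

theorem b_perm_left {p p' q : ℕ} (e : Fin p ≃ Fin p') (x : X.seq.el p k) (y : Y.seq.el q k) :
    c.b (X.seq.perm e x) y = Z.seq.perm (blockSum e (Equiv.refl _)) (c.b x y) := by
  rw [← b_perm', PtdSymSeq.perm_refl]

theorem b_perm_right {p q q' : ℕ} (f : Fin q ≃ Fin q') (x : X.seq.el p k) (y : Y.seq.el q k) :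
    c.b x (Y.seq.perm f y) = Z.seq.perm (blockSum (Equiv.refl _) f) (c.b x y) := by
  rw [← b_perm', PtdSymSeq.perm_refl]

theorem act_b (x : X.seq.el p k) (y : Y.seq.el q k) (s : R.seq.el m k) :
    Z.act (c.b x y) s = Z.seq.perm (finCongr (Nat.add_assoc p q m).symm) (c.b x (Y.act y s)) :=
  PtdSymSeq.eq_perm_symm (c.b_act_right x y s).symm

theorem b_act (x : X.seq.el p k) (y : Y.seq.el q k) (s : R.seq.el m k) :
    c.b (X.act x s) y = Z.seq.perm ((blockSum (Equiv.refl _) (shuffle q m)).trans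
      (finCongr (Nat.add_assoc p m q).symm)) (c.b x (Y.act y s)) := by
  rw [c.b_act_left, PtdSymSeq.perm_perm, PtdSymSeq.perm_eq_self]
  simp [Fin.forall_fin_add]

/-- A bimorphism preceded by morphisms of modules in both variables. -/
@[simps]
def precomp {X' Y' : SymMod R} (f : X' ⟶ X) (g : Y' ⟶ Y) : BiMor X' Y' Z where
  b x y := c.b (ap f x) (ap g y)
  pt_b y := by rw [ap_pt, c.pt_b]
  b_pt x := by rw [ap_pt, c.b_pt]
  b_res h x y := by rw [c.b_res, ap_res, ap_res]
  b_perm e e' x y := by rw [ap_perm, ap_perm, c.b_perm]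
  b_act_right x y s := by rw [ap_act, c.b_act_right]
  b_act_left x y s := by rw [ap_act, c.b_act_left, ap_act]

/-- The bimorphism with its arguments exchanged. -/
@[simps]
def flip : BiMor Y X Z where
  b {p q _} y x := Z.seq.perm (shuffle q p) (c.b x y)
  pt_b y := by rw [c.b_pt, PtdSymSeq.perm_pt]
  b_pt x := by rw [c.pt_b, PtdSymSeq.perm_pt]
  b_res h x y := by rw [PtdSymSeq.res_perm, c.b_res]
  b_perm e e' x y := by
    rw [c.b_perm]
    simp only [PtdSymSeq.perm_perm]
    congr 1
    simp [Equiv.ext_iff, Fin.forall_fin_add]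
  b_act_right y x s := by
    rw [c.b_act, act_perm_left, act_b]
    simp only [PtdSymSeq.perm_perm]
    congr 1
    simp [Equiv.ext_iff, Fin.forall_fin_add]
  b_act_left y x s := by
    rw [c.b_act]
    simp only [PtdSymSeq.perm_perm]
    congr 1
    simp [Equiv.ext_iff, Fin.forall_fin_add]

end BiMor

end SymMod

/-! ### The smash product over a commutative symmetric ring spectrum -/

namespace SymMod

variable {R : CommSymRing.{w}} {M N X Y Z W : SymMod R}
variable {n n' m m' p q r : ℕ} {k l j : SimplexCategory}

/-- Representatives of the `k`-simplices of degree `n` of the smash product of `X` and `Y`: a pair of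
simplices `x`, `y` of degrees `p`, `q` and a bijection `e` of `p + q` letters with `n` letters.
The triple stands for `e · (x ∧ y)`. -/
structure SmashRep (X Y : SymMod R) (n : ℕ) (k : SimplexCategory) where
  {p : ℕ}
  {q : ℕ}
  e : Fin (p + q) ≃ Fin n
  x : X.seq.el p k
  y : Y.seq.el q k

/-- A representative of the basepoint. -/
def SmashRep.base (X Y : SymMod R) (n : ℕ) (k : SimplexCategory) : SmashRep X Y n k :=
  ⟨(Equiv.refl _ : Fin (n + 0) ≃ Fin n), X.seq.pt n k, Y.seq.pt 0 k⟩

/-- The relations that define the smash product over `R`: collapsing of basepoints, equivariance,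
and the balancing of the two actions of `R`. -/
inductive SmashRel (X Y : SymMod R) (n : ℕ) (k : SimplexCategory) :
    SmashRep X Y n k → SmashRep X Y n k → Prop
  | pt_left {p q : ℕ} (e : Fin (p + q) ≃ Fin n) (y : Y.seq.el q k) :
      SmashRel X Y n k ⟨e, X.seq.pt p k, y⟩ (SmashRep.base X Y n k)
  | pt_right {p q : ℕ} (e : Fin (p + q) ≃ Fin n) (x : X.seq.el p k) :
      SmashRel X Y n k ⟨e, x, Y.seq.pt q k⟩ (SmashRep.base X Y n k)
  | perm {p p' q q' : ℕ} (e : Fin (p' + q') ≃ Fin n) (a : Fin p ≃ Fin p') (b : Fin q ≃ Fin q')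
      (x : X.seq.el p k) (y : Y.seq.el q k) :
      SmashRel X Y n k ⟨e, X.seq.perm a x, Y.seq.perm b y⟩ ⟨(blockSum a b).trans e, x, y⟩
  | act {p q m : ℕ} (e : Fin (p + (q + m)) ≃ Fin n) (x : X.seq.el p k) (y : Y.seq.el q k)
      (s : R.seq.el m k) :
      SmashRel X Y n k ⟨e, x, Y.act y s⟩ ⟨((finCongr (Nat.add_assoc p m q)).trans
        (blockSum (Equiv.refl (Fin p)) (shuffle m q))).trans e, X.act x s, y⟩

/-- The `k`-simplices of degree `n` of the smash product. -/
def SmashEl (X Y : SymMod R) (n : ℕ) (k : SimplexCategory) : Type w := Quot (SmashRel X Y n k)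

namespace SmashEl

/-- The simplex `e · (x ∧ y)`. -/
def mk (e : Fin (p + q) ≃ Fin n) (x : X.seq.el p k) (y : Y.seq.el q k) : SmashEl X Y n k :=
  Quot.mk _ ⟨e, x, y⟩

/-- The basepoint. -/
def pt (X Y : SymMod R) (n : ℕ) (k : SimplexCategory) : SmashEl X Y n k :=
  Quot.mk _ (SmashRep.base X Y n k)

theorem mk_pt_left (e : Fin (p + q) ≃ Fin n) (y : Y.seq.el q k) :
    mk e (X.seq.pt p k) y = pt X Y n k := Quot.sound (.pt_left e y)

theorem mk_pt_right (e : Fin (p + q) ≃ Fin n) (x : X.seq.el p k) :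
    mk e x (Y.seq.pt q k) = pt X Y n k := Quot.sound (.pt_right e x)

theorem mk_perm {p' q' : ℕ} (e : Fin (p' + q') ≃ Fin n) (a : Fin p ≃ Fin p') (b : Fin q ≃ Fin q')
    (x : X.seq.el p k) (y : Y.seq.el q k) :
    mk e (X.seq.perm a x) (Y.seq.perm b y) = mk ((blockSum a b).trans e) x y :=
  Quot.sound (.perm e a b x y)

theorem mk_perm_right {q' : ℕ} (e : Fin (p + q') ≃ Fin n) (b : Fin q ≃ Fin q')
    (x : X.seq.el p k) (y : Y.seq.el q k) :
    mk e x (Y.seq.perm b y) = mk ((blockSum (Equiv.refl _) b).trans e) x y := by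
  rw [← mk_perm, PtdSymSeq.perm_refl]

theorem mk_act (e : Fin (p + (q + m)) ≃ Fin n) (x : X.seq.el p k) (y : Y.seq.el q k)
    (s : R.seq.el m k) :
    mk e x (Y.act y s) = mk (((finCongr (Nat.add_assoc p m q)).trans
        (blockSum (Equiv.refl (Fin p)) (shuffle m q))).trans e) (X.act x s) y :=
  Quot.sound (.act e x y s)

theorem mk_act_left (e : Fin (p + m + q) ≃ Fin n) (x : X.seq.el p k) (y : Y.seq.el q k)
    (s : R.seq.el m k) :
    mk e (X.act x s) y = mk (((blockSum (Equiv.refl (Fin p)) (shuffle q m)).trans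
      (finCongr (Nat.add_assoc p m q).symm)).trans e) x (Y.act y s) := by
  rw [mk_act]
  congr 1
  simp [Equiv.ext_iff, Fin.forall_fin_add]

/-- Functions on the smash product are given by functions on representatives that respect the
relations. -/
def lift {A : Sort*} (φ : ∀ {p q : ℕ}, (Fin (p + q) ≃ Fin n) → X.seq.el p k → Y.seq.el q k → A)
    (a₀ : A)
    (pt_left : ∀ {p q : ℕ} (e : Fin (p + q) ≃ Fin n) (y : Y.seq.el q k),
      φ e (X.seq.pt p k) y = a₀)
    (pt_right : ∀ {p q : ℕ} (e : Fin (p + q) ≃ Fin n) (x : X.seq.el p k),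
      φ e x (Y.seq.pt q k) = a₀)
    (perm : ∀ {p p' q q' : ℕ} (e : Fin (p' + q') ≃ Fin n) (a : Fin p ≃ Fin p')
      (b : Fin q ≃ Fin q') (x : X.seq.el p k) (y : Y.seq.el q k),
      φ e (X.seq.perm a x) (Y.seq.perm b y) = φ ((blockSum a b).trans e) x y)
    (act : ∀ {p q m : ℕ} (e : Fin (p + (q + m)) ≃ Fin n) (x : X.seq.el p k) (y : Y.seq.el q k)
      (s : R.seq.el m k), φ e x (Y.act y s) = φ (((finCongr (Nat.add_assoc p m q)).trans
        (blockSum (Equiv.refl (Fin p)) (shuffle m q))).trans e) (X.act x s) y)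
    (z : SmashEl X Y n k) : A :=
  Quot.lift (fun z => φ z.e z.x z.y) (fun z z' h => by
    cases h with
    | pt_left e y => exact (pt_left e y).trans (pt_left _ _).symm
    | pt_right e x => exact (pt_right e x).trans (pt_left _ _).symm
    | perm e a b x y => exact perm e a b x y
    | act e x y s => exact act e x y s) z

theorem ind {motive : SmashEl X Y n k → Prop}
    (h : ∀ {p q : ℕ} (e : Fin (p + q) ≃ Fin n) (x : X.seq.el p k) (y : Y.seq.el q k),
      motive (mk e x y)) (z : SmashEl X Y n k) : motive z :=
  Quot.ind (fun z => h z.e z.x z.y) z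

/-- The action of bijections on the smash product. -/
def perm (f : Fin n ≃ Fin m) : SmashEl X Y n k → SmashEl X Y m k :=
  lift (fun e x y => mk (e.trans f) x y) (pt X Y m k) (fun _ y => mk_pt_left _ y)
    (fun _ x => mk_pt_right _ x) (fun e a b x y => mk_perm (e.trans f) a b x y)
    (fun e x y s => mk_act (e.trans f) x y s)

/-- The simplicial structure of the smash product. -/
def res (f : k ⟶ l) : SmashEl X Y n l → SmashEl X Y n k :=
  lift (fun e x y => mk e (X.seq.res f x) (Y.seq.res f y)) (pt X Y n k)
    (fun e y => by rw [PtdSymSeq.res_pt, mk_pt_left])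
    (fun e x => by rw [PtdSymSeq.res_pt, mk_pt_right])
    (fun e a b x y => by rw [PtdSymSeq.res_perm, PtdSymSeq.res_perm, mk_perm])
    (fun e x y s => by rw [res_act, mk_act, res_act])

/-- The action of `R` on the smash product. -/
def act (z : SmashEl X Y n k) (s : R.seq.el m k) : SmashEl X Y (n + m) k :=
  lift (fun {p q} e x y => mk ((finCongr (Nat.add_assoc p q m).symm).trans
      (blockSum e (Equiv.refl (Fin m)))) x (Y.act y s)) (pt X Y (n + m) k)
    (fun e y => mk_pt_left _ _)
    (fun e x => by rw [SymMod.pt_act, mk_pt_right])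
    (fun e a b x y => by
      rw [act_perm_left, mk_perm]
      congr 1
      simp [Equiv.ext_iff, Fin.forall_fin_add])
    (fun e x y t => by
      rw [mk_act_left, act_act_comm, mk_perm_right]
      congr 1
      simp [Equiv.ext_iff, Fin.forall_fin_add, -Fin.cast_cast]) z

theorem pt_eq_mk : pt X Y n k = mk (Equiv.refl _ : Fin (n + 0) ≃ Fin n) (X.seq.pt n k)
    (Y.seq.pt 0 k) := rfl

theorem perm_mk (f : Fin n ≃ Fin m) (e : Fin (p + q) ≃ Fin n) (x : X.seq.el p k)
    (y : Y.seq.el q k) : perm f (mk e x y) = mk (e.trans f) x y := rfl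

theorem res_mk (f : k ⟶ l) (e : Fin (p + q) ≃ Fin n) (x : X.seq.el p l)
    (y : Y.seq.el q l) : res f (mk e x y) = mk e (X.seq.res f x) (Y.seq.res f y) := rfl

theorem act_mk (e : Fin (p + q) ≃ Fin n) (x : X.seq.el p k) (y : Y.seq.el q k)
    (s : R.seq.el m k) : act (mk e x y) s = mk ((finCongr (Nat.add_assoc p q m).symm).trans
      (blockSum e (Equiv.refl (Fin m)))) x (Y.act y s) := rfl

end SmashEl

open SmashEl in
/-- The symmetric sequence underlying the smash product. -/
def smashSeq (X Y : SymMod R) : PtdSymSeq.{w} :=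
  PtdSymSeq.ofEl (SmashEl X Y) (pt X Y) res perm
    (fun f => by rw [pt_eq_mk, res_mk, PtdSymSeq.res_pt, mk_pt_left])
    (fun x => by
      induction x using SmashEl.ind
      rw [res_mk, PtdSymSeq.res_id, PtdSymSeq.res_id])
    (fun f g x => by
      induction x using SmashEl.ind
      simp only [res_mk, PtdSymSeq.res_res])
    (fun e => mk_pt_left _ _)
    (fun x => by induction x using SmashEl.ind; rfl)
    (fun e f x => by induction x using SmashEl.ind; rfl)
    (fun f e x => by induction x using SmashEl.ind; rfl)

open SmashEl in
/-- The smash product `X ∧_R Y`. -/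
def smashObj (X Y : SymMod R) : SymMod R where
  seq := smashSeq X Y
  str x s := act x (R.one₁ s)
  act := act
  isModule :=
    { pt_act := fun s => mk_pt_left _ _
      act_pt := fun {n m k} x => by
        change act (x : SmashEl X Y n k) _ = pt X Y (n + m) k
        induction x using SmashEl.ind
        rw [act_mk, SymMod.act_pt, mk_pt_right]
      act_res := fun {n m k l} f x s => by
        change res f (act (x : SmashEl X Y n l) s) = act (res f x) (R.seq.res f s)
        induction x using SmashEl.ind
        simp only [act_mk, res_mk, res_act]
      act_perm := fun {n m k} e f x s => by
        change act (perm e (x : SmashEl X Y n k)) (R.seq.perm f s) = perm (blockSum e f) (act x s)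
        induction x using SmashEl.ind
        simp only [act_mk, perm_mk, act_perm_right, mk_perm_right]
        congr 1
        simp [Equiv.ext_iff, Fin.forall_fin_add]
      act_mul := fun {n m p k} x s t => by
        change perm (finCongr (Nat.add_assoc n m p)) (act (act (x : SmashEl X Y n k) s) t) =
          act x (R.mul s t)
        induction x using SmashEl.ind
        simp only [act_mk, perm_mk, act_act, mk_perm_right]
        congr 1
        simp [Equiv.ext_iff, Fin.forall_fin_add]
      act_one := fun {n k} x => by
        change act (x : SmashEl X Y n k) (R.one₀ k) = x
        induction x using SmashEl.ind
        rw [act_mk, SymMod.act_one]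
        congr 1
        rw [blockSum_refl_zero]
        rfl
      str_eq := fun _ _ => rfl }

/-- The universal bimorphism `(x, y) ↦ x ∧ y`. -/
def smashBi (X Y : SymMod R) : BiMor X Y (smashObj X Y) where
  b x y := SmashEl.mk (Equiv.refl _) x y
  pt_b y := SmashEl.mk_pt_left _ y
  b_pt x := SmashEl.mk_pt_right _ x
  b_res f x y := rfl
  b_perm e f x y := SmashEl.mk_perm _ e f x y
  b_act_right {p q m k} x y s := by
    change SmashEl.mk _ x _ = SmashEl.perm (finCongr (Nat.add_assoc p q m))
      (SmashEl.act (SmashEl.mk (Equiv.refl _) x y) s)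
    rw [SmashEl.act_mk, SmashEl.perm_mk]
    congr 1
    simp [Equiv.ext_iff]
  b_act_left x y s := SmashEl.mk_act _ x y s

/-- Every simplex of the smash product is a permutation of some `x ∧ y`. -/
theorem smash_ind {motive : (smashObj X Y).seq.el n k → Prop}
    (h : ∀ {p q : ℕ} (e : Fin (p + q) ≃ Fin n) (x : X.seq.el p k) (y : Y.seq.el q k),
      motive ((smashObj X Y).seq.perm e ((smashBi X Y).b x y))) (z : (smashObj X Y).seq.el n k) :
    motive z :=
  SmashEl.ind h z

theorem smash_hom_ext {f g : smashObj X Y ⟶ Z}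
    (h : ∀ {p q : ℕ} {k : SimplexCategory} (x : X.seq.el p k) (y : Y.seq.el q k),
      ap f ((smashBi X Y).b x y) = ap g ((smashBi X Y).b x y)) : f = g :=
  hom_ext fun n k z => by
    induction z using smash_ind with
    | h e x y => rw [ap_perm, ap_perm, h]

/-- The morphism out of the smash product that corresponds to a bimorphism. -/
def smashDesc (c : BiMor X Y Z) : smashObj X Y ⟶ Z :=
  have pt_left : ∀ {n p q : ℕ} {k : SimplexCategory} (e : Fin (p + q) ≃ Fin n) (y : Y.seq.el q k),
      Z.seq.perm e (c.b (X.seq.pt p k) y) = Z.seq.pt n k := fun e y => by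
    rw [c.pt_b, PtdSymSeq.perm_pt]
  homMk (fun {n k} z => SmashEl.lift (fun e x y => Z.seq.perm e (c.b x y)) (Z.seq.pt n k) pt_left
      (fun e x => by rw [c.b_pt, PtdSymSeq.perm_pt])
      (fun e a b x y => by rw [c.b_perm', PtdSymSeq.perm_perm])
      (fun e x y s => by rw [c.b_act_left, PtdSymSeq.perm_perm]) z)
    (fun f z => by
      induction z using SmashEl.ind with
      | h e x y =>
        change Z.seq.perm e (c.b (X.seq.res f x) (Y.seq.res f y)) =
          Z.seq.res f (Z.seq.perm e (c.b x y))
        rw [← c.b_res, PtdSymSeq.res_perm])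
    (fun f z => by
      induction z using SmashEl.ind with
      | h e x y =>
        change Z.seq.perm (e.trans f) (c.b x y) = Z.seq.perm f (Z.seq.perm e (c.b x y))
        rw [PtdSymSeq.perm_perm])
    (fun z s => by
      induction z using SmashEl.ind with
      | h e x y =>
        change Z.seq.perm _ (c.b x (Y.act y s)) = Z.act (Z.seq.perm e (c.b x y)) s
        rw [act_perm_left, c.act_b, PtdSymSeq.perm_perm])

@[simp] theorem smashDesc_b (c : BiMor X Y Z) (x : X.seq.el p k) (y : Y.seq.el q k) :
    ap (smashDesc c) ((smashBi X Y).b x y) = c.b x y :=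
  PtdSymSeq.perm_refl _

/-! ### The symmetric monoidal structure -/

/-- The smash product of two morphisms. -/
def smashHom {X' Y' : SymMod R} (f : X ⟶ X') (g : Y ⟶ Y') : smashObj X Y ⟶ smashObj X' Y' :=
  smashDesc ((smashBi X' Y').precomp f g)

@[simp] theorem smashHom_b {X' Y' : SymMod R} (f : X ⟶ X') (g : Y ⟶ Y') (x : X.seq.el p k)
    (y : Y.seq.el q k) :
    ap (smashHom f g) ((smashBi X Y).b x y) = (smashBi X' Y').b (ap f x) (ap g y) :=
  smashDesc_b _ _ _

/-- The symmetry of the smash product. -/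
def smashBraid (X Y : SymMod R) : smashObj X Y ⟶ smashObj Y X :=
  smashDesc (smashBi Y X).flip

@[simp] theorem smashBraid_b (x : X.seq.el p k) (y : Y.seq.el q k) :
    ap (smashBraid X Y) ((smashBi X Y).b x y) =
      (smashObj Y X).seq.perm (shuffle q p) ((smashBi Y X).b y x) :=
  smashDesc_b _ _ _

theorem smashBraid_braid (X Y : SymMod R) : smashBraid X Y ≫ smashBraid Y X = 𝟙 _ :=
  smash_hom_ext fun {p q k} x y => by
    simp only [ap_comp, smashBraid_b, ap_perm, PtdSymSeq.perm_perm, ap_id]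
    refine PtdSymSeq.perm_eq_self _ ?_ _
    simp [Fin.forall_fin_add]

/-- The elements of `R` as elements of the regular module. -/
def toReg (s : R.seq.el n k) : (regular R).seq.el n k := s

/-- The elements of the regular module as elements of `R`. -/
def ofReg (s : (regular R).seq.el n k) : R.seq.el n k := s

theorem ofReg_act (s : (regular R).seq.el n k) (t : R.seq.el m k) :
    ofReg ((regular R).act s t) = R.mul (ofReg s) t := rfl

/-- The unit of `R` as an element of the regular module. -/
def regOne (R : CommSymRing.{w}) (k : SimplexCategory) : (regular R).seq.el 0 k := R.one₀ k

theorem regOne_res (f : k ⟶ l) : (regular R).seq.res f (regOne R l) = regOne R k :=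
  R.isSymRing.one₀_res f

/-- The element `s` of `R` is `1 · s`, up to the identification of `n` with `0 + n`. -/
theorem regOne_act (s : R.seq.el n k) : (regular R).act (regOne R k) s =
    (regular R).seq.perm (finCongr (Nat.zero_add n).symm) (toReg s) :=
  R.isSymRing.one_mul s

/-- The action of `R` on `X` as a bimorphism. -/
@[simps]
def actBi (X : SymMod R) : BiMor X (regular R) X where
  b x s := X.act x (ofReg s)
  pt_b s := pt_act s
  b_pt x := act_pt x
  b_res f x s := res_act f x s
  b_perm e f x s := act_perm e f x s
  b_act_right x s t := (X.isModule.act_mul x s t).symm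
  b_act_left {p q m k} x s t := by
    rw [ofReg_act, ← R.isCommutative t (ofReg s), act_perm_right, act_act, PtdSymSeq.perm_perm]
    rfl

/-- The right unit isomorphism of the smash product. -/
def smashRight (X : SymMod R) : smashObj X (regular R) ≅ X where
  hom := smashDesc (actBi X)
  inv := homMk (fun {n k} x => (smashBi X (regular R)).b x (regOne R k))
    (fun f x => by rw [BiMor.b_res, regOne_res])
    (fun e x => by rw [BiMor.b_perm_left, blockSum_refl_zero])
    (fun {n m k} x s => by
      rw [BiMor.act_b, BiMor.b_act]
      congr 1
      simp [Equiv.ext_iff, Fin.forall_fin_add, Fin.ext_iff])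
  hom_inv_id := smash_hom_ext fun {p q k} x s => by
    rw [ap_comp, smashDesc_b]
    change (smashBi X (regular R)).b (X.act x (ofReg s)) (regOne R k) = (smashBi X (regular R)).b x s
    rw [BiMor.b_act, regOne_act, BiMor.b_perm_right, PtdSymSeq.perm_perm, PtdSymSeq.perm_eq_self]
    · rfl
    simp [Fin.forall_fin_add, Fin.ext_iff]
  inv_hom_id := hom_ext fun n k x => by
    rw [ap_comp]
    exact (smashDesc_b _ _ _).trans (act_one x)

end SymMod

namespace SymMod

variable {R : CommSymRing.{w}} {M N X Y Z W : SymMod R}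
variable {n n' m m' p q r : ℕ} {k l j : SimplexCategory}

/-- The bimorphism `(x ∧ y, z) ↦ x ∧ (y ∧ z)`. -/
def assocBi (X Y Z : SymMod R) : BiMor (smashObj X Y) Z (smashObj X (smashObj Y Z)) where
  b {n r k} u z := SmashEl.lift (fun {p q} e x y => (smashObj X (smashObj Y Z)).seq.perm
      ((finCongr (Nat.add_assoc p q r).symm).trans (blockSum e (Equiv.refl (Fin r))))
      ((smashBi X (smashObj Y Z)).b x ((smashBi Y Z).b y z)))
    ((smashObj X (smashObj Y Z)).seq.pt (n + r) k)
    (fun e y => by rw [BiMor.pt_b, PtdSymSeq.perm_pt])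
    (fun e x => by rw [BiMor.pt_b, BiMor.b_pt, PtdSymSeq.perm_pt])
    (fun e a b x y => by
      rw [BiMor.b_perm_left, BiMor.b_perm_left, BiMor.b_perm_right, PtdSymSeq.perm_perm,
        PtdSymSeq.perm_perm]
      congr 1
      simp [Equiv.ext_iff, Fin.forall_fin_add])
    (fun e x y s => by
      rw [BiMor.b_act, BiMor.b_act, BiMor.act_b, BiMor.b_perm_right, BiMor.b_perm_right,
        PtdSymSeq.perm_perm, PtdSymSeq.perm_perm, PtdSymSeq.perm_perm]
      congr 1
      simp [Equiv.ext_iff, Fin.forall_fin_add, -Fin.cast_cast]) u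
  pt_b z := (congrArg _ (BiMor.pt_b _ _)).trans (PtdSymSeq.perm_pt _)
  b_pt u := by
    induction u using smash_ind with
    | h e x y =>
      change (smashObj X (smashObj Y Z)).seq.perm _ ((smashBi X (smashObj Y Z)).b x
        ((smashBi Y Z).b y _)) = _
      rw [BiMor.b_pt, BiMor.b_pt, PtdSymSeq.perm_pt]
  b_res f u z := by
    induction u using smash_ind with
    | h e x y =>
      exact PtdSymSeq.res_perm _ _ _
  b_perm f g u z := by
    induction u using smash_ind with
    | h e x y =>
      change (smashObj X (smashObj Y Z)).seq.perm _ ((smashBi X (smashObj Y Z)).b x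
        ((smashBi Y Z).b y _)) = (smashObj X (smashObj Y Z)).seq.perm _
        ((smashObj X (smashObj Y Z)).seq.perm _ ((smashBi X (smashObj Y Z)).b x
        ((smashBi Y Z).b y z)))
      rw [BiMor.b_perm_right, BiMor.b_perm_right, PtdSymSeq.perm_perm, PtdSymSeq.perm_perm]
      congr 1
      simp only [Equiv.ext_iff, Fin.forall_fin_add, Equiv.trans_apply, Equiv.refl_apply,
        finCongr_apply, blockSum_castAdd, blockSum_natAdd, cast_assoc_symm_left,
        cast_assoc_symm_mid, cast_assoc_symm_right]
      exact ⟨fun _ => rfl, fun _ => rfl, fun _ => trivial⟩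
  b_act_right u z s := by
    induction u using smash_ind with
    | h e x y =>
      change (smashObj X (smashObj Y Z)).seq.perm _ ((smashBi X (smashObj Y Z)).b x
        ((smashBi Y Z).b y _)) = (smashObj X (smashObj Y Z)).seq.perm _
        ((smashObj X (smashObj Y Z)).act ((smashObj X (smashObj Y Z)).seq.perm _
        ((smashBi X (smashObj Y Z)).b x ((smashBi Y Z).b y z))) s)
      rw [act_perm_left, BiMor.act_b, BiMor.act_b, BiMor.b_perm_right]
      simp only [PtdSymSeq.perm_perm]
      congr 1
      simp [Equiv.ext_iff, Fin.forall_fin_add, -Fin.cast_cast]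
  b_act_left u z s := by
    induction u using smash_ind with
    | h e x y =>
      change (smashObj X (smashObj Y Z)).seq.perm _ ((smashBi X (smashObj Y Z)).b x
        ((smashBi Y Z).b y _)) = (smashObj X (smashObj Y Z)).seq.perm _
        ((smashObj X (smashObj Y Z)).seq.perm _
        ((smashBi X (smashObj Y Z)).b x ((smashBi Y Z).b (Y.act y s) z)))
      rw [BiMor.b_act, BiMor.b_perm_right]
      simp only [PtdSymSeq.perm_perm]
      congr 1
      simp [Equiv.ext_iff, Fin.forall_fin_add, -Fin.cast_cast]

theorem assocBi_b (x : X.seq.el p k) (y : Y.seq.el q k) (z : Z.seq.el r k) :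
    (assocBi X Y Z).b ((smashBi X Y).b x y) z = (smashObj X (smashObj Y Z)).seq.perm
      (finCongr (Nat.add_assoc p q r).symm)
      ((smashBi X (smashObj Y Z)).b x ((smashBi Y Z).b y z)) := by
  have h : (assocBi X Y Z).b ((smashBi X Y).b x y) z = (smashObj X (smashObj Y Z)).seq.perm
      ((finCongr (Nat.add_assoc p q r).symm).trans (blockSum (Equiv.refl _) (Equiv.refl _)))
      ((smashBi X (smashObj Y Z)).b x ((smashBi Y Z).b y z)) := rfl
  rw [h, blockSum_refl_refl]
  rfl

theorem smash_hom_ext₃ {f g : smashObj (smashObj X Y) Z ⟶ W}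
    (h : ∀ {p q r : ℕ} {k : SimplexCategory} (x : X.seq.el p k) (y : Y.seq.el q k)
      (z : Z.seq.el r k), ap f ((smashBi (smashObj X Y) Z).b ((smashBi X Y).b x y) z) =
        ap g ((smashBi (smashObj X Y) Z).b ((smashBi X Y).b x y) z)) : f = g :=
  smash_hom_ext fun {p q k} u z => by
    induction u using smash_ind with
    | h e x y => rw [BiMor.b_perm_left, ap_perm, ap_perm, h]

theorem smash_hom_ext₃' {f g : smashObj X (smashObj Y Z) ⟶ W}
    (h : ∀ {p q r : ℕ} {k : SimplexCategory} (x : X.seq.el p k) (y : Y.seq.el q k)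
      (z : Z.seq.el r k), ap f ((smashBi X (smashObj Y Z)).b x ((smashBi Y Z).b y z)) =
        ap g ((smashBi X (smashObj Y Z)).b x ((smashBi Y Z).b y z))) : f = g :=
  smash_hom_ext fun {p q k} x u => by
    induction u using smash_ind with
    | h e y z => rw [BiMor.b_perm_right, ap_perm, ap_perm, h]

/-- The associativity morphism of the smash product. -/
def smashAssoc (X Y Z : SymMod R) :
    smashObj (smashObj X Y) Z ⟶ smashObj X (smashObj Y Z) :=
  smashDesc (assocBi X Y Z)

@[simp] theorem smashAssoc_b (x : X.seq.el p k) (y : Y.seq.el q k) (z : Z.seq.el r k) :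
    ap (smashAssoc X Y Z) ((smashBi (smashObj X Y) Z).b ((smashBi X Y).b x y) z) =
      (smashObj X (smashObj Y Z)).seq.perm (finCongr (Nat.add_assoc p q r).symm)
        ((smashBi X (smashObj Y Z)).b x ((smashBi Y Z).b y z)) := by
  rw [smashAssoc, smashDesc_b, assocBi_b]

/-- The inverse of the associativity morphism, obtained from the associativity morphism and the
symmetry. -/
def smashAssocInv (X Y Z : SymMod R) :
    smashObj X (smashObj Y Z) ⟶ smashObj (smashObj X Y) Z :=
  smashBraid _ _ ≫ smashAssoc Y Z X ≫ smashBraid _ _ ≫ smashAssoc Z X Y ≫ smashBraid _ _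

@[simp] theorem smashAssocInv_b (x : X.seq.el p k) (y : Y.seq.el q k) (z : Z.seq.el r k) :
    ap (smashAssocInv X Y Z) ((smashBi X (smashObj Y Z)).b x ((smashBi Y Z).b y z)) =
      (smashObj (smashObj X Y) Z).seq.perm (finCongr (Nat.add_assoc p q r))
        ((smashBi (smashObj X Y) Z).b ((smashBi X Y).b x y) z) := by
  simp only [smashAssocInv, ap_comp, smashBraid_b, ap_perm, smashAssoc_b, PtdSymSeq.perm_perm]
  congr 1
  simp [Equiv.ext_iff, Fin.forall_fin_add]

/-- The associativity isomorphism of the smash product. -/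
@[simps]
def smashAssocIso (X Y Z : SymMod R) :
    smashObj (smashObj X Y) Z ≅ smashObj X (smashObj Y Z) where
  hom := smashAssoc X Y Z
  inv := smashAssocInv X Y Z
  hom_inv_id := smash_hom_ext₃ fun x y z => by
    simp only [ap_comp, smashAssoc_b, ap_perm, smashAssocInv_b, PtdSymSeq.perm_perm, ap_id]
    exact PtdSymSeq.perm_eq_self _ (fun _ => rfl) _
  inv_hom_id := smash_hom_ext₃' fun x y z => by
    simp only [ap_comp, smashAssoc_b, ap_perm, smashAssocInv_b, PtdSymSeq.perm_perm, ap_id]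
    exact PtdSymSeq.perm_eq_self _ (fun _ => rfl) _

@[simp] theorem smashRight_b (x : X.seq.el p k) (s : (regular R).seq.el q k) :
    ap (smashRight X).hom ((smashBi X (regular R)).b x s) = X.act x (ofReg s) :=
  smashDesc_b _ _ _

/-- The left unit isomorphism of the smash product. -/
def smashLeft (X : SymMod R) : smashObj (regular R) X ≅ X where
  hom := smashBraid _ _ ≫ (smashRight X).hom
  inv := (smashRight X).inv ≫ smashBraid _ _
  hom_inv_id := by simp [smashBraid_braid]
  inv_hom_id := by simp [reassoc_of% (smashBraid_braid X (regular R))]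

@[simp] theorem smashLeft_b (x : X.seq.el p k) (s : (regular R).seq.el q k) :
    ap (smashLeft X).hom ((smashBi (regular R) X).b s x) =
      X.seq.perm (shuffle p q) (X.act x (ofReg s)) := by
  simp [smashLeft, ap_perm]

/-- The smash product over `R`, with unit the regular module. -/
instance : MonoidalCategoryStruct (SymMod R) where
  tensorObj := smashObj
  whiskerLeft X _ _ f := smashHom (𝟙 X) f
  whiskerRight f Y := smashHom f (𝟙 Y)
  tensorHom := smashHom
  tensorUnit := regular R
  associator := smashAssocIso
  leftUnitor := smashLeft
  rightUnitor := smashRight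

/-- The universal bimorphism into the monoidal product. -/
def sm (X Y : SymMod R) : BiMor X Y (X ⊗ Y) := smashBi X Y

/-- The unit of `R` as an element of the monoidal unit. -/
def unitEl (R : CommSymRing.{w}) (k : SimplexCategory) : (𝟙_ (SymMod R)).seq.el 0 k := R.one₀ k

/-- The elements of the monoidal unit as elements of `R`. -/
def ofUnit (s : (𝟙_ (SymMod R)).seq.el n k) : R.seq.el n k := s

/-- The elements of `R` as elements of the monoidal unit. -/
def toUnit (s : R.seq.el n k) : (𝟙_ (SymMod R)).seq.el n k := s

theorem tensor_ind {motive : (X ⊗ Y).seq.el n k → Prop}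
    (h : ∀ {p q : ℕ} (e : Fin (p + q) ≃ Fin n) (x : X.seq.el p k) (y : Y.seq.el q k),
      motive ((X ⊗ Y).seq.perm e ((sm X Y).b x y))) (z : (X ⊗ Y).seq.el n k) :
    motive z :=
  SmashEl.ind h z

theorem tensor_hom_ext {f g : X ⊗ Y ⟶ Z}
    (h : ∀ {p q : ℕ} {k : SimplexCategory} (x : X.seq.el p k) (y : Y.seq.el q k),
      ap f ((sm X Y).b x y) = ap g ((sm X Y).b x y)) : f = g :=
  smash_hom_ext h

theorem tensor_hom_ext₃ {f g : (X ⊗ Y) ⊗ Z ⟶ W}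
    (h : ∀ {p q r : ℕ} {k : SimplexCategory} (x : X.seq.el p k) (y : Y.seq.el q k)
      (z : Z.seq.el r k), ap f ((sm (X ⊗ Y) Z).b ((sm X Y).b x y) z) =
        ap g ((sm (X ⊗ Y) Z).b ((sm X Y).b x y) z)) : f = g :=
  smash_hom_ext₃ h

theorem tensor_hom_ext₃' {f g : X ⊗ (Y ⊗ Z) ⟶ W}
    (h : ∀ {p q r : ℕ} {k : SimplexCategory} (x : X.seq.el p k) (y : Y.seq.el q k)
      (z : Z.seq.el r k), ap f ((sm X (Y ⊗ Z)).b x ((sm Y Z).b y z)) =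
        ap g ((sm X (Y ⊗ Z)).b x ((sm Y Z).b y z))) : f = g :=
  smash_hom_ext₃' h

theorem tensor_hom_ext₄ {V : SymMod R} {f g : (X ⊗ Y) ⊗ (Z ⊗ W) ⟶ V}
    (h : ∀ {p q r s : ℕ} {k : SimplexCategory} (x : X.seq.el p k) (y : Y.seq.el q k)
      (z : Z.seq.el r k) (t : W.seq.el s k),
      ap f ((sm (X ⊗ Y) (Z ⊗ W)).b ((sm X Y).b x y) ((sm Z W).b z t)) =
        ap g ((sm (X ⊗ Y) (Z ⊗ W)).b ((sm X Y).b x y) ((sm Z W).b z t))) : f = g :=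
  tensor_hom_ext₃ fun {p q n k} x y u => by
    induction u using tensor_ind with
    | h e z t => rw [BiMor.b_perm_right, ap_perm, ap_perm, h]

theorem tensor_hom_ext₄' {V : SymMod R} {f g : ((X ⊗ Y) ⊗ Z) ⊗ W ⟶ V}
    (h : ∀ {p q r s : ℕ} {k : SimplexCategory} (x : X.seq.el p k) (y : Y.seq.el q k)
      (z : Z.seq.el r k) (t : W.seq.el s k),
      ap f ((sm ((X ⊗ Y) ⊗ Z) W).b ((sm (X ⊗ Y) Z).b ((sm X Y).b x y) z) t) =
        ap g ((sm ((X ⊗ Y) ⊗ Z) W).b ((sm (X ⊗ Y) Z).b ((sm X Y).b x y) z) t)) : f = g :=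
  tensor_hom_ext₃ fun {n r s k} u z t => by
    induction u using tensor_ind with
    | h e x y => rw [BiMor.b_perm_left, BiMor.b_perm_left, ap_perm, ap_perm, h]

@[simp] theorem tensorHom_sm {X' Y' : SymMod R} (f : X ⟶ X') (g : Y ⟶ Y') (x : X.seq.el p k)
    (y : Y.seq.el q k) : ap (f ⊗ₘ g) ((sm X Y).b x y) = (sm X' Y').b (ap f x) (ap g y) :=
  smashHom_b f g x y

@[simp] theorem whiskerLeft_sm {Y' : SymMod R} (g : Y ⟶ Y') (x : X.seq.el p k)
    (y : Y.seq.el q k) : ap (X ◁ g) ((sm X Y).b x y) = (sm X Y').b x (ap g y) :=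
  smashHom_b _ g x y

@[simp] theorem whiskerRight_sm {X' : SymMod R} (f : X ⟶ X') (x : X.seq.el p k)
    (y : Y.seq.el q k) : ap (f ▷ Y) ((sm X Y).b x y) = (sm X' Y).b (ap f x) y :=
  smashHom_b f _ x y

@[simp] theorem associator_hom_sm (x : X.seq.el p k) (y : Y.seq.el q k) (z : Z.seq.el r k) :
    ap (α_ X Y Z).hom ((sm (X ⊗ Y) Z).b ((sm X Y).b x y) z) =
      (X ⊗ (Y ⊗ Z)).seq.perm (finCongr (Nat.add_assoc p q r).symm)
        ((sm X (Y ⊗ Z)).b x ((sm Y Z).b y z)) :=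
  smashAssoc_b x y z

@[simp] theorem associator_inv_sm (x : X.seq.el p k) (y : Y.seq.el q k) (z : Z.seq.el r k) :
    ap (α_ X Y Z).inv ((sm X (Y ⊗ Z)).b x ((sm Y Z).b y z)) =
      ((X ⊗ Y) ⊗ Z).seq.perm (finCongr (Nat.add_assoc p q r))
        ((sm (X ⊗ Y) Z).b ((sm X Y).b x y) z) :=
  smashAssocInv_b x y z

@[simp] theorem rightUnitor_hom_sm (x : X.seq.el p k) (s : (𝟙_ (SymMod R)).seq.el q k) :
    ap (ρ_ X).hom ((sm X (𝟙_ (SymMod R))).b x s) = X.act x (ofUnit s) :=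
  smashRight_b x s

@[simp] theorem leftUnitor_hom_sm (x : X.seq.el p k) (s : (𝟙_ (SymMod R)).seq.el q k) :
    ap (λ_ X).hom ((sm (𝟙_ (SymMod R)) X).b s x) = X.seq.perm (shuffle p q) (X.act x (ofUnit s)) :=
  smashLeft_b x s

@[simp] theorem rightUnitor_inv_ap (x : X.seq.el p k) :
    ap (ρ_ X).inv x = (sm X (𝟙_ (SymMod R))).b x (unitEl R k) := rfl

@[simp] theorem leftUnitor_inv_ap (x : X.seq.el p k) :
    ap (λ_ X).inv x = (𝟙_ (SymMod R) ⊗ X).seq.perm (finCongr (Nat.zero_add p))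
      ((sm (𝟙_ (SymMod R)) X).b (unitEl R k) x) := by
  change ap (smashBraid X (regular R)) ((smashBi X (regular R)).b x (regOne R k)) = _
  rw [smashBraid_b, shuffle_zero_left]
  rfl

instance : MonoidalCategory (SymMod R) :=
  MonoidalCategory.ofTensorHom
    (id_tensorHom_id := fun X Y => tensor_hom_ext fun x y => by simp)
    (tensorHom_comp_tensorHom := fun f g h i => tensor_hom_ext fun x y => by simp)
    (associator_naturality := fun f g h => tensor_hom_ext₃ fun x y z => by simp [ap_perm])
    (leftUnitor_naturality := fun {X Y} f => tensor_hom_ext fun s x => by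
      simp only [ap_comp, tensorHom_sm, leftUnitor_hom_sm, ap_perm, ap_act, ap_id])
    (rightUnitor_naturality := fun {X Y} f => tensor_hom_ext fun x s => by
      simp only [ap_comp, tensorHom_sm, rightUnitor_hom_sm, ap_act, ap_id])
    (pentagon := fun W X Y Z => tensor_hom_ext₄' fun x y z t => by
      simp only [ap_comp, tensorHom_sm, associator_hom_sm, ap_perm, ap_id, BiMor.b_perm_left,
        BiMor.b_perm_right, PtdSymSeq.perm_perm]
      congr 1
      simp [Equiv.ext_iff, Fin.forall_fin_add, -Fin.cast_cast])
    (triangle := fun X Y => tensor_hom_ext₃ fun x s y => by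
      simp only [ap_comp, tensorHom_sm, associator_hom_sm, leftUnitor_hom_sm, rightUnitor_hom_sm,
        ap_perm, ap_id, BiMor.b_perm_right, PtdSymSeq.perm_perm, BiMor.b_act])

/-- The symmetry of the monoidal product. -/
def tensorBraid (X Y : SymMod R) : X ⊗ Y ≅ Y ⊗ X :=
  ⟨smashBraid X Y, smashBraid Y X, smashBraid_braid X Y, smashBraid_braid Y X⟩

theorem tensorBraid_sm (x : X.seq.el p k) (y : Y.seq.el q k) :
    ap (tensorBraid X Y).hom ((sm X Y).b x y) = (Y ⊗ X).seq.perm (shuffle q p) ((sm Y X).b y x) :=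
  smashBraid_b x y

instance : BraidedCategory (SymMod R) where
  braiding := tensorBraid
  braiding_naturality_right X Y Z f := tensor_hom_ext fun x y => by
    rw [ap_comp, ap_comp, whiskerLeft_sm, tensorBraid_sm, tensorBraid_sm, ap_perm, whiskerRight_sm]
  braiding_naturality_left f Z := tensor_hom_ext fun x y => by
    rw [ap_comp, ap_comp, whiskerRight_sm, tensorBraid_sm, tensorBraid_sm, ap_perm, whiskerLeft_sm]
  hexagon_forward X Y Z := tensor_hom_ext₃ fun x y z => by
    simp only [ap_comp, associator_hom_sm, ap_perm, tensorBraid_sm, whiskerRight_sm, whiskerLeft_sm,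
      BiMor.b_perm_left, BiMor.b_perm_right, PtdSymSeq.perm_perm]
    congr 1
    simp [Equiv.ext_iff, Fin.forall_fin_add]
  hexagon_reverse X Y Z := tensor_hom_ext₃' fun x y z => by
    simp only [ap_comp, associator_inv_sm, ap_perm, tensorBraid_sm, whiskerRight_sm, whiskerLeft_sm,
      BiMor.b_perm_left, BiMor.b_perm_right, PtdSymSeq.perm_perm]
    congr 1
    simp [Equiv.ext_iff, Fin.forall_fin_add]

/-- The symmetry squares to the identity because the shuffles `χ_{n,m}` and `χ_{m,n}` are
inverse to each other. -/
instance : SymmetricCategory (SymMod R) where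
  symmetry X Y := smashBraid_braid X Y

@[simp] theorem braiding_hom_sm (x : X.seq.el p k) (y : Y.seq.el q k) :
    ap (β_ X Y).hom ((sm X Y).b x y) = (Y ⊗ X).seq.perm (shuffle q p) ((sm Y X).b y x) :=
  smashBraid_b x y

/-- The monoidal structure on modules is the smash product over `R`. -/
def smashStructure (R : CommSymRing.{w}) : SmashStructure R where
  unitIso := Iso.refl _
  smash := sm
  universal c := ⟨smashDesc c, fun x y => smashDesc_b c x y, fun _ hf =>
    tensor_hom_ext fun x y => (hf x y).trans (smashDesc_b c x y).symm⟩
  tensorHom_smash f g _ _ _ x y := tensorHom_sm f g x y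
  associator_smash x y z := associator_hom_sm x y z
  rightUnitor_smash x s := rightUnitor_hom_sm x (toUnit s)
  leftUnitor_smash x s := leftUnitor_hom_sm x (toUnit s)
  braiding_smash x y := braiding_hom_sm x y

end SymMod

/-! ### Internal homs of modules -/

namespace SymMod

variable {R : CommSymRing.{w}} {M N X Y Z W : SymMod R}
variable {n n' m m' p q r : ℕ} {k l j : SimplexCategory}

/-- The bijection exchanging the last two of three blocks of letters. -/
def swapBlocks (q n m : ℕ) : Fin (q + n + m) ≃ Fin (q + m + n) :=
  (finCongr (Nat.add_assoc q n m)).trans ((blockSum (Equiv.refl (Fin q)) (shuffle n m)).trans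
    (finCongr (Nat.add_assoc q m n).symm))

/-- The `k`-simplices of degree `n` of the internal hom: families of maps that raise the degree by
`n`, natural over the simplices of `Δ[k]`, pointed, equivariant and `R`-linear. -/
@[ext]
structure HomEl (X Z : SymMod R) (n : ℕ) (k : SimplexCategory) where
  φ : ∀ {l : SimplexCategory} (_ : l ⟶ k) {q : ℕ}, X.seq.el q l → Z.seq.el (q + n) l
  φ_pt : ∀ {l : SimplexCategory} (g : l ⟶ k) {q : ℕ}, φ g (X.seq.pt q l) = Z.seq.pt (q + n) l
  φ_res : ∀ {j l : SimplexCategory} (h : j ⟶ l) (g : l ⟶ k) {q : ℕ} (x : X.seq.el q l),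
    Z.seq.res h (φ g x) = φ (h ≫ g) (X.seq.res h x)
  φ_perm : ∀ {l : SimplexCategory} (g : l ⟶ k) {q q' : ℕ} (e : Fin q ≃ Fin q') (x : X.seq.el q l),
    φ g (X.seq.perm e x) = Z.seq.perm (blockSum e (Equiv.refl _)) (φ g x)
  φ_act : ∀ {l : SimplexCategory} (g : l ⟶ k) {q m : ℕ} (x : X.seq.el q l) (s : R.seq.el m l),
    φ g (X.act x s) = Z.seq.perm (swapBlocks q n m) (Z.act (φ g x) s)

namespace HomEl

/-- The basepoint of the internal hom. -/
@[simps]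
def pt (X Z : SymMod R) (n : ℕ) (k : SimplexCategory) : HomEl X Z n k where
  φ _ _ _ := Z.seq.pt _ _
  φ_pt _ _ := rfl
  φ_res _ _ _ _ := PtdSymSeq.res_pt _
  φ_perm _ _ _ _ _ := (PtdSymSeq.perm_pt _).symm
  φ_act _ _ _ _ _ := by rw [pt_act, PtdSymSeq.perm_pt]

/-- The simplicial structure of the internal hom. -/
@[simps]
def res (f : k ⟶ l) (a : HomEl X Z n l) : HomEl X Z n k where
  φ g _ x := a.φ (g ≫ f) x
  φ_pt g _ := a.φ_pt _
  φ_res h g _ x := by rw [a.φ_res, Category.assoc]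
  φ_perm g _ _ e x := a.φ_perm _ e x
  φ_act g _ _ x s := a.φ_act _ x s

/-- The action of bijections on the internal hom. -/
@[simps]
def perm (e : Fin n ≃ Fin m) (a : HomEl X Z n k) : HomEl X Z m k where
  φ g _ x := Z.seq.perm (blockSum (Equiv.refl _) e) (a.φ g x)
  φ_pt g _ := by rw [a.φ_pt, PtdSymSeq.perm_pt]
  φ_res h g _ x := by rw [PtdSymSeq.res_perm, a.φ_res]
  φ_perm g _ _ e x := by
    rw [a.φ_perm, PtdSymSeq.perm_perm, PtdSymSeq.perm_perm]
    congr 1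
    simp [Equiv.ext_iff, Fin.forall_fin_add]
  φ_act g _ _ x s := by
    rw [a.φ_act, act_perm_left, PtdSymSeq.perm_perm, PtdSymSeq.perm_perm]
    congr 1
    simp [Equiv.ext_iff, Fin.forall_fin_add, swapBlocks]

/-- The action of `R` on the internal hom. -/
@[simps]
def act (a : HomEl X Z n k) (s : R.seq.el m k) : HomEl X Z (n + m) k where
  φ {l} g {q} x := Z.seq.perm (finCongr (Nat.add_assoc q n m)) (Z.act (a.φ g x) (R.seq.res g s))
  φ_pt g _ := by rw [a.φ_pt, pt_act, PtdSymSeq.perm_pt]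
  φ_res h g _ x := by rw [PtdSymSeq.res_perm, res_act, a.φ_res, PtdSymSeq.res_res]
  φ_perm g _ _ e x := by
    rw [a.φ_perm, act_perm_left, PtdSymSeq.perm_perm, PtdSymSeq.perm_perm]
    congr 1
    simp [Equiv.ext_iff, Fin.forall_fin_add]
  φ_act g _ _ x t := by
    rw [a.φ_act, act_perm_left, act_act_comm, act_perm_left, PtdSymSeq.perm_perm,
      PtdSymSeq.perm_perm, PtdSymSeq.perm_perm]
    congr 1
    simp [Equiv.ext_iff, Fin.forall_fin_add, swapBlocks, -Fin.cast_cast]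

theorem ext' {a b : HomEl X Z n k} (h : ∀ {l : SimplexCategory} (g : l ⟶ k) {q : ℕ}
    (x : X.seq.el q l), a.φ g x = b.φ g x) : a = b :=
  HomEl.ext (by funext l g q x; exact h g x)

end HomEl

/-- The symmetric sequence underlying the internal hom. -/
def ihomSeq (X Z : SymMod R) : PtdSymSeq.{w} :=
  PtdSymSeq.ofEl (HomEl X Z) (HomEl.pt X Z) HomEl.res HomEl.perm
    (fun _ => rfl)
    (fun a => HomEl.ext' fun g q x => by rw [HomEl.res_φ, Category.comp_id])
    (fun f g a => HomEl.ext' fun h q x => by simp only [HomEl.res_φ, Category.assoc])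
    (fun e => HomEl.ext' fun g q x => PtdSymSeq.perm_pt _)
    (fun a => HomEl.ext' fun g q x => by
      rw [HomEl.perm_φ, blockSum_refl_refl, PtdSymSeq.perm_refl])
    (fun e f a => HomEl.ext' fun g q x => by
      simp only [HomEl.perm_φ, PtdSymSeq.perm_perm]
      congr 1
      simp [Equiv.ext_iff, Fin.forall_fin_add])
    (fun _ _ _ => rfl)

/-- The internal hom of modules. -/
def ihomObj (X Z : SymMod R) : SymMod R where
  seq := ihomSeq X Z
  str a s := HomEl.act a (R.one₁ s)
  act := HomEl.act
  isModule :=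
    { pt_act := fun s => HomEl.ext' fun g q x => by
        change Z.seq.perm _ (Z.act (Z.seq.pt _ _) (R.seq.res g s)) = Z.seq.pt _ _
        rw [SymMod.pt_act, PtdSymSeq.perm_pt]
      act_pt := fun {n m k} a => HomEl.ext' fun {l} g q x => by
        change Z.seq.perm _ (Z.act (HomEl.φ a g x) (R.seq.res g (R.seq.pt m k))) = Z.seq.pt _ _
        rw [PtdSymSeq.res_pt, SymMod.act_pt, PtdSymSeq.perm_pt]
      act_res := fun f a s => HomEl.ext' fun g q x => by
        change Z.seq.perm _ (Z.act (HomEl.φ a (g ≫ f) x) (R.seq.res (g ≫ f) s)) =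
          Z.seq.perm _ (Z.act (HomEl.φ a (g ≫ f) x) (R.seq.res g (R.seq.res f s)))
        rw [PtdSymSeq.res_res]
      act_perm := fun {n m k} e f a s => HomEl.ext' fun g q x => by
        change Z.seq.perm (finCongr (Nat.add_assoc q n m))
          (Z.act (Z.seq.perm (blockSum (Equiv.refl _) e) (HomEl.φ a g x))
            (R.seq.res g (R.seq.perm f s))) =
          Z.seq.perm (blockSum (Equiv.refl _) (blockSum e f)) (Z.seq.perm
            (finCongr (Nat.add_assoc q n m)) (Z.act (HomEl.φ a g x) (R.seq.res g s)))
        rw [PtdSymSeq.res_perm, SymMod.act_perm, PtdSymSeq.perm_perm, PtdSymSeq.perm_perm]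
        congr 1
        simp [Equiv.ext_iff, Fin.forall_fin_add]
      act_mul := fun {n m p k} a s t => HomEl.ext' fun g q x => by
        change Z.seq.perm (blockSum (Equiv.refl _) (finCongr (Nat.add_assoc n m p)))
          (Z.seq.perm (finCongr (Nat.add_assoc q (n + m) p)) (Z.act (Z.seq.perm
            (finCongr (Nat.add_assoc q n m)) (Z.act (HomEl.φ a g x) (R.seq.res g s)))
            (R.seq.res g t))) =
          Z.seq.perm (finCongr (Nat.add_assoc q n (m + p))) (Z.act (HomEl.φ a g x)
            (R.seq.res g (R.mul s t)))
        rw [R.isSymRing.mul_res, act_perm_left, act_act]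
        simp only [PtdSymSeq.perm_perm]
        congr 1
        simp [Equiv.ext_iff, Fin.forall_fin_add, -Fin.cast_cast]
      act_one := fun {n k} a => HomEl.ext' fun {l} g q x => by
        change Z.seq.perm (Equiv.refl _) (Z.act (HomEl.φ a g x) (R.seq.res g (R.one₀ k))) = _
        rw [R.isSymRing.one₀_res, SymMod.act_one, PtdSymSeq.perm_refl]
      str_eq := fun _ _ => rfl }

/-- The elements of the internal hom as families of maps. -/
def toHomEl (a : (ihomObj X Z).seq.el n k) : HomEl X Z n k := a

theorem toHomEl_pt : toHomEl ((ihomObj X Z).seq.pt n k) = HomEl.pt X Z n k := rfl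

theorem toHomEl_res (f : k ⟶ l) (a : (ihomObj X Z).seq.el n l) :
    toHomEl ((ihomObj X Z).seq.res f a) = HomEl.res f (toHomEl a) := rfl

theorem toHomEl_perm (e : Fin n ≃ Fin m) (a : (ihomObj X Z).seq.el n k) :
    toHomEl ((ihomObj X Z).seq.perm e a) = HomEl.perm e (toHomEl a) := rfl

theorem toHomEl_act (a : (ihomObj X Z).seq.el n k) (s : R.seq.el m k) :
    toHomEl ((ihomObj X Z).act a s) = HomEl.act (toHomEl a) s := rfl

/-- The adjunction between the smash product and the internal hom. -/
def ihomEquiv (X Y Z : SymMod R) : (X ⊗ Y ⟶ Z) ≃ (Y ⟶ ihomObj X Z) where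
  toFun f := homMk
    (fun {n k} y =>
      ({ φ := fun g _ x => ap f ((sm X Y).b x (Y.seq.res g y))
         φ_pt := fun g _ => by rw [BiMor.pt_b, ap_pt]
         φ_res := fun h g _ x => by rw [← ap_res, BiMor.b_res, PtdSymSeq.res_res]
         φ_perm := fun g _ _ e x => by rw [BiMor.b_perm_left, ap_perm]
         φ_act := fun g _ _ x s => by
          rw [BiMor.b_act, ap_perm, ← ap_act, BiMor.act_b, ap_perm, PtdSymSeq.perm_perm]
          rfl } : HomEl X Z n k))
    (fun f y => HomEl.ext' fun g q x => by
      change ap _ _ = ap _ ((sm X Y).b x (Y.seq.res (g ≫ f) y))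
      rw [PtdSymSeq.res_res])
    (fun {n m k} e y => HomEl.ext' fun g q x => by
      change ap f ((sm X Y).b x (Y.seq.res g (Y.seq.perm e y))) = Z.seq.perm
        (blockSum (Equiv.refl _) e) (ap f ((sm X Y).b x (Y.seq.res g y)))
      rw [PtdSymSeq.res_perm, BiMor.b_perm_right, ap_perm])
    (fun {n m k} y s => HomEl.ext' fun g q x => by
      change ap f ((sm X Y).b x (Y.seq.res g (Y.act y s))) = Z.seq.perm
        (finCongr (Nat.add_assoc q n m)) (Z.act (ap f ((sm X Y).b x (Y.seq.res g y)))
          (R.seq.res g s))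
      rw [res_act, BiMor.b_act_right, ap_perm, ap_act])
  invFun h := smashDesc
    { b := fun {p q k} x y => (toHomEl (ap h y)).φ (𝟙 k) x
      pt_b := fun y => HomEl.φ_pt _ _
      b_pt := fun x => by rw [ap_pt, toHomEl_pt, HomEl.pt_φ]
      b_res := fun {p q k l} f x y => by
        rw [ap_res, toHomEl_res, HomEl.res_φ, HomEl.φ_res, Category.comp_id, Category.id_comp]
      b_perm := fun e f x y => by
        rw [ap_perm, toHomEl_perm, HomEl.perm_φ, HomEl.φ_perm, PtdSymSeq.perm_perm]
        congr 1
        simp [Equiv.ext_iff, Fin.forall_fin_add]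
      b_act_right := fun {p q m k} x y s => by
        rw [ap_act, toHomEl_act, HomEl.act_φ, PtdSymSeq.res_id]
      b_act_left := fun {p q m k} x y s => by
        rw [ap_act, toHomEl_act, HomEl.act_φ, PtdSymSeq.res_id, HomEl.φ_act, PtdSymSeq.perm_perm]
        congr 1
        simp [Equiv.ext_iff, Fin.forall_fin_add, swapBlocks] }
  left_inv f := tensor_hom_ext fun {p q k} x y => by
    refine (smashDesc_b _ _ _).trans ?_
    change ap f ((sm X Y).b x (Y.seq.res (𝟙 k) y)) = _
    rw [PtdSymSeq.res_id]
  right_inv h := hom_ext fun n k y => HomEl.ext' fun {l} g q x => by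
    refine (smashDesc_b _ x (Y.seq.res g y)).trans ?_
    change (toHomEl (ap h (Y.seq.res g y))).φ (𝟙 l) x = (toHomEl (ap h y)).φ g x
    rw [ap_res, toHomEl_res, HomEl.res_φ, Category.id_comp]

instance : MonoidalClosed (SymMod R) where
  closed X :=
    { rightAdj := Adjunction.rightAdjointOfEquiv (F := tensorLeft X) (ihomEquiv X)
        (fun _ _ _ f g => hom_ext fun _ _ y => HomEl.ext' fun h _ x => by
          change ap g (ap (X ◁ f) ((sm X _).b x _)) = ap g ((sm X _).b x _)
          rw [whiskerLeft_sm, ap_res]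
          rfl)
      adj := Adjunction.adjunctionOfEquivRight _ _ }

end SymMod

/-! ### Parametrised morphisms in a symmetric monoidal category -/

section Param

variable {C : Type u} [Category.{v} C] [MonoidalCategory C] [SymmetricCategory C]

theorem tensorμ_tensorμ (A B X Y : C) : tensorμ A B X Y ≫ tensorμ A X B Y = 𝟙 _ := by
  have h : tensorμ A X B Y = tensorδ A B X Y := by
    simp only [tensorμ, tensorδ, SymmetricCategory.braiding_swap_eq_inv_braiding B X]
  rw [h, tensorμ_tensorδ]

/-- The isomorphism exchanging the middle factors. -/
@[simps]
def tensorμIso (A B X Y : C) : (A ⊗ B) ⊗ (X ⊗ Y) ≅ (A ⊗ X) ⊗ (B ⊗ Y) where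
  hom := tensorμ A B X Y
  inv := tensorμ A X B Y
  hom_inv_id := tensorμ_tensorμ _ _ _ _
  inv_hom_id := tensorμ_tensorμ _ _ _ _

instance (A B X Y : C) : IsIso (tensorμ A B X Y) := (tensorμIso A B X Y).isIso_hom

theorem tensorμ_braiding (A B X Y : C) :
    tensorμ A B X Y ≫ ((β_ A X).hom ⊗ₘ (β_ B Y).hom) = (β_ (A ⊗ B) (X ⊗ Y)).hom ≫
      tensorμ X Y A B := by
  simp [tensorμ, SymmetricCategory.braiding_swap_eq_inv_braiding X B, MonoidalCategory.tensorHom_def,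
    SymmetricCategory.braiding_swap_eq_inv_braiding A Y]

theorem tensorμ_comp_braiding (A B X Y : C) :
    tensorμ A B X Y ≫ (β_ (A ⊗ X) (B ⊗ Y)).hom = ((β_ A B).hom ⊗ₘ (β_ X Y).hom) ≫
      tensorμ B A Y X := by
  simp [tensorμ, SymmetricCategory.braiding_swap_eq_inv_braiding X B, MonoidalCategory.tensorHom_def]

/-- The isomorphism `(Y ∧ F) ∧ G ≅ (Y ∧ G) ∧ F`. -/
def swapRight (Y F G : C) : (Y ⊗ F) ⊗ G ⟶ (Y ⊗ G) ⊗ F :=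
  (α_ Y F G).hom ≫ Y ◁ (β_ F G).hom ≫ (α_ Y G F).inv

theorem swapRight_naturality_left {Y Y' : C} (f : Y ⟶ Y') (F G : C) :
    f ▷ F ▷ G ≫ swapRight Y' F G = swapRight Y F G ≫ f ▷ G ▷ F := by
  simp only [swapRight, Category.assoc]
  rw [associator_naturality_left_assoc, ← whisker_exchange_assoc, associator_inv_naturality_left]

theorem swapRight_naturality_mid (Y : C) {F F' : C} (f : F ⟶ F') (G : C) :
    (Y ◁ f) ▷ G ≫ swapRight Y F' G = swapRight Y F G ≫ (Y ⊗ G) ◁ f := by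
  simp only [swapRight, Category.assoc]
  rw [associator_naturality_middle_assoc, ← whiskerLeft_comp_assoc,
    BraidedCategory.braiding_naturality_left, whiskerLeft_comp_assoc,
    ← associator_inv_naturality_right]

theorem swapRight_naturality_right (Y F : C) {G G' : C} (f : G ⟶ G') :
    (Y ⊗ F) ◁ f ≫ swapRight Y F G' = swapRight Y F G ≫ (Y ◁ f) ▷ F := by
  simp only [swapRight, Category.assoc]
  rw [associator_naturality_right_assoc, ← whiskerLeft_comp_assoc,
    BraidedCategory.braiding_naturality_right, whiskerLeft_comp_assoc,
    ← associator_inv_naturality_middle]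

theorem swapRight_tensor_right (Y F G G' : C) :
    swapRight Y F (G ⊗ G') = (α_ (Y ⊗ F) G G').inv ≫ swapRight Y F G ▷ G' ≫
      swapRight (Y ⊗ G) F G' ≫ (α_ Y G G').hom ▷ F := by
  simp only [swapRight, BraidedCategory.braiding_tensor_right_hom]
  monoidal

theorem swapRight_tensor_mid (Y F F' G : C) :
    (α_ Y F F').hom ▷ G ≫ swapRight Y (F ⊗ F') G = swapRight (Y ⊗ F) F' G ≫
      swapRight Y F G ▷ F' ≫ (α_ (Y ⊗ G) F F').hom := by
  simp only [swapRight, BraidedCategory.braiding_tensor_left_hom]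
  monoidal

theorem swapRight_braid (Z A B D : C) :
    swapRight Z A B ▷ D ≫ swapRight (Z ⊗ B) A D ≫ swapRight Z B D ▷ A =
      swapRight (Z ⊗ A) B D ≫ swapRight Z A D ▷ B ≫ swapRight (Z ⊗ D) A B := by
  calc _ = 𝟙 _ ⊗≫ Z ◁ ((α_ A B D).inv ≫ (β_ A B).hom ▷ D ≫ (α_ B A D).hom ≫
              B ◁ (β_ A D).hom ≫ (α_ B D A).inv ≫ (β_ B D).hom ▷ A ≫ (α_ D B A).hom) ⊗≫ 𝟙 _ := by
            simp only [swapRight]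
            monoidal
      _ = _ := by
            rw [BraidedCategory.yang_baxter]
            simp only [swapRight]
            monoidal

/-- The composition of parametrised morphisms `f : X ∧ G ⟶ Y ∧ F` and `g : Y ∧ G' ⟶ Z ∧ F'`. -/
def paramComp {X Y Z G G' F F' : C} (f : X ⊗ G ⟶ Y ⊗ F) (g : Y ⊗ G' ⟶ Z ⊗ F') :
    X ⊗ (G ⊗ G') ⟶ Z ⊗ (F ⊗ F') :=
  (α_ X G G').inv ≫ f ▷ G' ≫ swapRight Y F G' ≫ g ▷ F ≫ swapRight Z F' F ≫ (α_ Z F F').hom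

/-- The monoidal product of parametrised morphisms. -/
def paramTensor {X X' Y Y' G G' F F' : C} (f : X ⊗ G ⟶ X' ⊗ F) (g : Y ⊗ G' ⟶ Y' ⊗ F') :
    (X ⊗ Y) ⊗ (G ⊗ G') ⟶ (X' ⊗ Y') ⊗ (F ⊗ F') :=
  tensorμ X Y G G' ≫ (f ⊗ₘ g) ≫ tensorμ X' F Y' F'

section
variable {X Y Z W G G' G'' F F' F'' : C}

theorem paramComp_naturality {H H' K K' : C} (f : X ⊗ G ⟶ Y ⊗ F) (g : Y ⊗ G' ⟶ Z ⊗ F')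
    (a : H ⟶ G) (a' : H' ⟶ G') (b : F ⟶ K) (b' : F' ⟶ K') :
    paramComp (X ◁ a ≫ f ≫ Y ◁ b) (Y ◁ a' ≫ g ≫ Z ◁ b') =
      X ◁ (a ⊗ₘ a') ≫ paramComp f g ≫ Z ◁ (b ⊗ₘ b') := by
  simp only [paramComp, comp_whiskerRight, Category.assoc]
  rw [reassoc_of% (swapRight_naturality_mid Y b H'), whisker_exchange_assoc,
    whisker_exchange_assoc, whisker_exchange_assoc, ← reassoc_of% (swapRight_naturality_right),
    ← whisker_exchange_assoc, reassoc_of% (swapRight_naturality_right),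
    reassoc_of% (swapRight_naturality_mid Z b' F), associator_naturality_middle,
    associator_naturality_right_assoc, ← associator_inv_naturality_middle_assoc,
    ← associator_inv_naturality_right_assoc, ← whiskerLeft_comp_assoc,
    MonoidalCategory.tensorHom_def, MonoidalCategory.tensorHom_def']
  simp only [MonoidalCategory.whiskerLeft_comp, Category.assoc]

theorem paramComp_assoc (f : X ⊗ G ⟶ Y ⊗ F) (g : Y ⊗ G' ⟶ Z ⊗ F') (h : Z ⊗ G'' ⟶ W ⊗ F'') :
    paramComp (paramComp f g) h =
      X ◁ (α_ G G' G'').hom ≫ paramComp f (paramComp g h) ≫ W ◁ (α_ F F' F'').inv := by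
  simp only [paramComp, comp_whiskerRight, Category.assoc]
  have h1 : (α_ (Z ⊗ G'') F F').hom ≫ h ▷ (F ⊗ F') = h ▷ F ▷ F' ≫ (α_ (W ⊗ F'') F F').hom :=
    (associator_naturality_left h F F').symm
  rw [reassoc_of% (swapRight_tensor_mid Z F F' G''), reassoc_of% h1,
    swapRight_tensor_right W F'' F F', Category.assoc, Category.assoc, Category.assoc,
    Iso.hom_inv_id_assoc, swapRight_tensor_right Y F G' G'', Category.assoc, Category.assoc,
    Category.assoc, hom_inv_whiskerRight_assoc, reassoc_of% (swapRight_tensor_mid W F' F'' F),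
    associator_inv_naturality_left_assoc,
    ← reassoc_of% (swapRight_naturality_left g F G''), reassoc_of% (swapRight_braid Z F' F G''),
    ← reassoc_of% (swapRight_naturality_left h F' F), reassoc_of% (swapRight_braid W F'' F' F)]
  have h2 : (α_ X (G ⊗ G') G'').inv ≫ (α_ X G G').inv ▷ G'' =
      X ◁ (α_ G G' G'').hom ≫ (α_ X G (G' ⊗ G'')).inv ≫ (α_ (X ⊗ G) G' G'').inv := by monoidal
  have h3 : (α_ W F F').hom ▷ F'' ≫ (α_ W (F ⊗ F') F'').hom =
      (α_ (W ⊗ F) F' F'').hom ≫ (α_ W F (F' ⊗ F'')).hom ≫ W ◁ (α_ F F' F'').inv := by monoidal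
  rw [reassoc_of% h2, h3]

end

theorem paramTensor_naturality {X X' Y Y' G G' F F' H H' K K' : C} (f : X ⊗ G ⟶ X' ⊗ F)
    (g : Y ⊗ G' ⟶ Y' ⊗ F') (a : H ⟶ G) (a' : H' ⟶ G') (b : F ⟶ K) (b' : F' ⟶ K') :
    paramTensor (X ◁ a ≫ f ≫ X' ◁ b) (Y ◁ a' ≫ g ≫ Y' ◁ b') =
      (X ⊗ Y) ◁ (a ⊗ₘ a') ≫ paramTensor f g ≫ (X' ⊗ Y') ◁ (b ⊗ₘ b') := by
  simp only [paramTensor, ← tensorHom_comp_tensorHom, Category.assoc]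
  rw [← reassoc_of% (tensorμ_natural_right X Y a a')]
  have h := tensorμ_natural (𝟙 X') b (𝟙 Y') b'
  rw [id_tensorHom, id_tensorHom, id_tensorHom_id, id_tensorHom] at h
  rw [h]

theorem paramTensor_assoc {X X' Y Y' Z Z' G H K F L Q : C} (f : X ⊗ G ⟶ X' ⊗ F)
    (g : Y ⊗ H ⟶ Y' ⊗ L) (h : Z ⊗ K ⟶ Z' ⊗ Q) :
    paramTensor (paramTensor f g) h ≫ ((α_ X' Y' Z').hom ⊗ₘ (α_ F L Q).hom) =
      ((α_ X Y Z).hom ⊗ₘ (α_ G H K).hom) ≫ paramTensor f (paramTensor g h) := by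
  have e1 : (paramTensor f g ⊗ₘ h) = tensorμ X Y G H ▷ (Z ⊗ K) ≫ ((f ⊗ₘ g) ⊗ₘ h) ≫
      tensorμ X' F Y' L ▷ (Z' ⊗ Q) := by
    simp only [paramTensor, ← tensorHom_id, tensorHom_comp_tensorHom, Category.id_comp,
      Category.comp_id]
  have e2 : (f ⊗ₘ paramTensor g h) = (X ⊗ G) ◁ tensorμ Y Z H K ≫ (f ⊗ₘ (g ⊗ₘ h)) ≫
      (X' ⊗ F) ◁ tensorμ Y' L Z' Q := by
    simp only [paramTensor, ← id_tensorHom, tensorHom_comp_tensorHom, Category.id_comp,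
      Category.comp_id]
  have e3 := associator_naturality f g h
  rw [paramTensor.eq_1 (paramTensor f g) h, paramTensor.eq_1 f (paramTensor g h), e1, e2]
  simp only [Category.assoc]
  rw [tensor_associativity, reassoc_of% e3, ← reassoc_of% (associator_monoidal X Y Z G H K)]

theorem paramTensor_braiding {X X' Y Y' G G' F F' : C} (f : X ⊗ G ⟶ X' ⊗ F)
    (g : Y ⊗ G' ⟶ Y' ⊗ F') :
    paramTensor f g ≫ ((β_ X' Y').hom ⊗ₘ (β_ F F').hom) =
      ((β_ X Y).hom ⊗ₘ (β_ G G').hom) ≫ paramTensor g f := by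
  simp only [paramTensor, Category.assoc]
  rw [tensorμ_braiding, BraidedCategory.braiding_naturality_assoc,
    reassoc_of% (tensorμ_comp_braiding X Y G G')]

/-- The isomorphism `((A₁ ∧ A₂) ∧ (B₁ ∧ B₂)) ∧ (D₁ ∧ D₂) ≅ ((A₁ ∧ B₁) ∧ D₁) ∧ ((A₂ ∧ B₂) ∧ D₂)` is
compatible with `swapRight`. -/
theorem tensorμ_swapRight (A₁ A₂ B₁ B₂ D₁ D₂ : C) :
    tensorμ A₁ A₂ B₁ B₂ ▷ (D₁ ⊗ D₂) ≫ tensorμ (A₁ ⊗ B₁) (A₂ ⊗ B₂) D₁ D₂ ≫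
        (swapRight A₁ B₁ D₁ ⊗ₘ swapRight A₂ B₂ D₂) =
      swapRight (A₁ ⊗ A₂) (B₁ ⊗ B₂) (D₁ ⊗ D₂) ≫ tensorμ A₁ A₂ D₁ D₂ ▷ (B₁ ⊗ B₂) ≫
        tensorμ (A₁ ⊗ D₁) (A₂ ⊗ D₂) B₁ B₂ := by
  have e := tensor_associativity A₁ A₂ D₁ D₂ B₁ B₂
  rw [← cancel_mono ((α_ A₁ D₁ B₁).hom ⊗ₘ (α_ A₂ D₂ B₂).hom)]
  simp only [Category.assoc, e, swapRight, Iso.inv_hom_id_assoc, tensorHom_comp_tensorHom,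
    Iso.inv_hom_id, Category.comp_id]
  rw [← tensorHom_comp_tensorHom, tensor_associativity_assoc, ← tensorμ_natural_right,
    ← whiskerLeft_comp_assoc, tensorμ_braiding, whiskerLeft_comp_assoc]

/-- Interchange of composition and monoidal product. -/
theorem paramComp_paramTensor {X X' X'' Y Y' Y'' G G' F F' K K' L L' : C}
    (f : X ⊗ G ⟶ X' ⊗ F) (f' : X' ⊗ G' ⟶ X'' ⊗ F') (g : Y ⊗ K ⟶ Y' ⊗ L)
    (g' : Y' ⊗ K' ⟶ Y'' ⊗ L') :
    paramComp (paramTensor f g) (paramTensor f' g') = (X ⊗ Y) ◁ tensorμ G K G' K' ≫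
      paramTensor (paramComp f f') (paramComp g g') ≫ (X'' ⊗ Y'') ◁ tensorμ F F' L L' := by
  have h1 : ∀ {X X' Y Y' G K F L : C} (f : X ⊗ G ⟶ X' ⊗ F) (g : Y ⊗ K ⟶ Y' ⊗ L) (D D' : C),
      paramTensor f g ▷ (D ⊗ D') ≫ tensorμ X' Y' F L ▷ (D ⊗ D') ≫
        tensorμ (X' ⊗ F) (Y' ⊗ L) D D' = tensorμ X Y G K ▷ (D ⊗ D') ≫
        tensorμ (X ⊗ G) (Y ⊗ K) D D' ≫ (f ▷ D ⊗ₘ g ▷ D') := by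
    intros
    simp only [paramTensor, comp_whiskerRight, Category.assoc]
    rw [← comp_whiskerRight_assoc (tensorμ _ _ _ _) (tensorμ _ _ _ _), tensorμ_tensorμ,
      id_whiskerRight, Category.id_comp,
      tensorμ_natural_left]
  rw [← cancel_mono ((X'' ⊗ Y'') ◁ tensorμ F L F' L' ≫ tensorμ X'' Y'' (F ⊗ F') (L ⊗ L'))]
  simp only [Category.assoc, ← whiskerLeft_comp_assoc]
  rw [tensorμ_tensorμ, MonoidalCategory.whiskerLeft_id, Category.id_comp]
  rw [paramTensor.eq_1 (paramComp f f'), Category.assoc, Category.assoc, tensorμ_tensorμ,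
    Category.comp_id]
  simp only [paramComp, Category.assoc]
  rw [← tensor_associativity, ← reassoc_of% (tensorμ_swapRight X'' Y'' F' L' F L),
    reassoc_of% (h1 f' g' F L), ← reassoc_of% (tensorμ_swapRight X' Y' F L G' K'),
    reassoc_of% (h1 f g G' K')]
  have e : (X ⊗ Y) ◁ tensorμ G K G' K' ≫ tensorμ X Y (G ⊗ G') (K ⊗ K') ≫
      ((α_ X G G').inv ⊗ₘ (α_ Y K K').inv) = (α_ (X ⊗ Y) (G ⊗ K) (G' ⊗ K')).inv ≫
        tensorμ X Y G K ▷ (G' ⊗ K') ≫ tensorμ (X ⊗ G) (Y ⊗ K) G' K' := by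
    rw [Iso.eq_inv_comp, ← reassoc_of% (tensor_associativity X Y G K G' K'),
      tensorHom_comp_tensorHom, Iso.hom_inv_id, Iso.hom_inv_id, id_tensorHom_id, Category.comp_id]
  simp only [← tensorHom_comp_tensorHom]
  rw [reassoc_of% e]

theorem swapRight_swapRight (Y F G : C) : swapRight Y F G ≫ swapRight Y G F = 𝟙 _ := by
  simp [swapRight, ← whiskerLeft_comp_assoc]

theorem swapRight_unit_mid (Y G : C) :
    swapRight Y (𝟙_ C) G = (ρ_ Y).hom ▷ G ≫ (ρ_ (Y ⊗ G)).inv := by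
  rw [swapRight, braiding_tensorUnit_left]
  monoidal

theorem swapRight_unit_right (Y F : C) :
    swapRight Y F (𝟙_ C) = (ρ_ (Y ⊗ F)).hom ≫ (ρ_ Y).inv ▷ F := by
  rw [swapRight, braiding_tensorUnit_right]
  monoidal

section
variable {X Y Z G G' F F' : C}

theorem paramComp_whiskerRight (f : X ⊗ G ⟶ Y ⊗ F) (h : Y ⟶ Z) :
    paramComp f (h ▷ 𝟙_ C) = X ◁ (ρ_ G).hom ≫ f ≫ h ▷ F ≫ Z ◁ (ρ_ F).inv := by
  rw [paramComp, ← reassoc_of% (swapRight_naturality_left h F (𝟙_ C)), reassoc_of% swapRight_swapRight]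
  monoidal

theorem whiskerRight_paramComp (h : X ⟶ Y) (f : Y ⊗ G ⟶ Z ⊗ F) :
    paramComp (h ▷ 𝟙_ C) f = X ◁ (λ_ G).hom ≫ h ▷ G ≫ f ≫ Z ◁ (λ_ F).inv := by
  rw [paramComp, swapRight_unit_mid, swapRight_unit_right]
  monoidal

theorem paramComp_whiskerLeft (f : X ⊗ G ⟶ Y ⊗ F) (r : G' ⟶ F') :
    paramComp f (Y ◁ r) = (α_ X G G').inv ≫ (f ⊗ₘ r) ≫ (α_ Y F F').hom := by
  rw [paramComp, ← reassoc_of% (swapRight_naturality_right Y F r), reassoc_of% swapRight_swapRight,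
    MonoidalCategory.tensorHom_def, Category.assoc]

theorem whiskerLeft_paramComp (r : G ⟶ F) (f : X ⊗ G' ⟶ Y ⊗ F') :
    paramComp (X ◁ r) f = X ◁ (β_ G G').hom ≫ paramComp f (Y ◁ r) ≫ Y ◁ (β_ F' F).hom := by
  have h1 : (α_ X G G').inv ≫ swapRight X G G' = X ◁ (β_ G G').hom ≫ (α_ X G' G).inv := by
    simp [swapRight]
  have h2 : swapRight Y F' F ≫ (α_ Y F F').hom = (α_ Y F' F).hom ≫ Y ◁ (β_ F' F).hom := by
    simp [swapRight]
  rw [paramComp_whiskerLeft, paramComp, reassoc_of% (swapRight_naturality_mid X r G'), h2,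
    reassoc_of% h1, whisker_exchange_assoc, MonoidalCategory.tensorHom_def]
  simp only [Category.assoc]

theorem paramTensor_whiskerLeft (X Y : C) (r : G ⟶ F) (s : G' ⟶ F') :
    paramTensor (X ◁ r) (Y ◁ s) = (X ⊗ Y) ◁ (r ⊗ₘ s) := by
  rw [paramTensor, ← reassoc_of% (tensorμ_natural_right X Y r s), tensorμ_tensorμ, Category.comp_id]

theorem paramTensor_whiskerRight {X X' Y Y' : C} (f : X ⟶ X') (g : Y ⟶ Y') (G G' : C) :
    paramTensor (f ▷ G) (g ▷ G') = (f ⊗ₘ g) ▷ (G ⊗ G') := by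
  rw [paramTensor, ← reassoc_of% (tensorμ_natural_left f g G G'), tensorμ_tensorμ, Category.comp_id]

theorem unit_paramTensor (f : X ⊗ G ⟶ Y ⊗ F) :
    paramTensor (𝟙 (𝟙_ C ⊗ 𝟙_ C)) f ≫ ((λ_ Y).hom ⊗ₘ (λ_ F).hom) =
      ((λ_ X).hom ⊗ₘ (λ_ G).hom) ≫ f := by
  rw [leftUnitor_monoidal X G, leftUnitor_monoidal Y F, paramTensor, Category.assoc, Category.assoc,
    reassoc_of% (tensorμ_tensorμ (𝟙_ C) (𝟙_ C) Y F), id_tensorHom, Category.assoc, Category.assoc,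
    whisker_exchange_assoc, leftUnitor_naturality]

theorem paramTensor_unit (f : X ⊗ G ⟶ Y ⊗ F) :
    paramTensor f (𝟙 (𝟙_ C ⊗ 𝟙_ C)) ≫ ((ρ_ Y).hom ⊗ₘ (ρ_ F).hom) =
      ((ρ_ X).hom ⊗ₘ (ρ_ G).hom) ≫ f := by
  rw [rightUnitor_monoidal X G, rightUnitor_monoidal Y F, paramTensor, Category.assoc,
    Category.assoc, reassoc_of% (tensorμ_tensorμ Y F (𝟙_ C) (𝟙_ C)), tensorHom_id, Category.assoc,
    Category.assoc, ← whisker_exchange_assoc, rightUnitor_naturality]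

end

end Param

/-! ### Tensor powers as a cocommutative graded comonoid -/

section PowSplit

variable {C : Type u} [Category.{v} C] [MonoidalCategory C] [SymmetricCategory C] (P : C)

theorem powPerm_finCongr_succ {n m : ℕ} (h : n = m) (h' : n + 1 = m + 1) :
    powPerm P (finCongr h') = wk P (powPerm P (finCongr h)) := by
  subst h
  exact (powPerm_refl P _).trans ((wk_id P n).symm.trans (congrArg (wk P) (powPerm_refl P n).symm))

theorem powSplit_zero (n : ℕ) : powSplit P n 0 = (ρ_ (powObj P n)).inv := rfl

theorem powSplit_succ (n m : ℕ) : powSplit P n (m + 1) =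
    (powSplit P n m ▷ P) ≫ (α_ (powObj P n) (powObj P m) P).hom := rfl

instance powSplit_isIso (n m : ℕ) : IsIso (powSplit P n m) := by
  induction m with
  | zero => exact inferInstanceAs (IsIso (ρ_ (powObj P n)).inv)
  | succ m ih => exact inferInstanceAs
      (IsIso ((powSplit P n m ▷ P) ≫ (α_ (powObj P n) (powObj P m) P).hom))

theorem powSplit_zero_left (n : ℕ) :
    powSplit P 0 n = powPerm P (finCongr (Nat.zero_add n)) ≫ (λ_ (powObj P n)).inv := by
  induction n with
  | zero =>
    have h : powPerm P (finCongr (Nat.zero_add 0)) = 𝟙 _ := powPerm_refl P 0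
    rw [powSplit_zero, h, Category.id_comp]
    exact unitors_inv_equal.symm
  | succ n ih =>
    have h : ∀ {A B : C} (f : A ⟶ B), (f ≫ (λ_ B).inv) ▷ P ≫ (α_ (𝟙_ C) B P).hom =
        f ▷ P ≫ (λ_ (B ⊗ P)).inv := by
      intro A B f
      simp
    rw [powSplit_succ, ih, powPerm_finCongr_succ P (Nat.zero_add n)]
    exact h _

theorem powSplit_assoc (n m p : ℕ) :
    powSplit P (n + m) p ≫ powSplit P n m ▷ powObj P p ≫ (α_ _ _ _).hom =
      powPerm P (finCongr (Nat.add_assoc n m p)) ≫ powSplit P n (m + p) ≫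
        powObj P n ◁ powSplit P m p := by
  induction p with
  | zero =>
    have h : powPerm P (finCongr (Nat.add_assoc n m 0)) = 𝟙 _ := powPerm_refl P _
    have h' : ∀ {A X Y : C} (f : A ⟶ X ⊗ Y), (ρ_ A).inv ≫ f ▷ 𝟙_ C ≫ (α_ X Y (𝟙_ C)).hom =
        f ≫ X ◁ (ρ_ Y).inv := by
      intro A X Y f
      rw [← rightUnitor_inv_naturality_assoc, rightUnitor_tensor_inv]
      simp
    rw [h, Category.id_comp]
    exact h' _
  | succ p ih =>
    have h : ∀ {A A' D X Y Z : C} (s : A ⟶ D ⊗ Z) (t : D ⟶ X ⊗ Y) (q : A ⟶ A') {W : C}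
        (r : A' ⟶ X ⊗ W) (w : W ⟶ Y ⊗ Z) (_ : s ≫ t ▷ Z ≫ (α_ X Y Z).hom = q ≫ r ≫ X ◁ w),
        (s ▷ P ≫ (α_ D Z P).hom) ≫ t ▷ (Z ⊗ P) ≫ (α_ X Y (Z ⊗ P)).hom =
        q ▷ P ≫ (r ▷ P ≫ (α_ X W P).hom) ≫ X ◁ (w ▷ P ≫ (α_ Y Z P).hom) := by
      intro A A' D X Y Z s t q W r w e
      have e' := congrArg (fun z => z ▷ P ≫ (α_ _ _ _).hom ≫ X ◁ (α_ _ _ _).hom) e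
      simp only [comp_whiskerRight, Category.assoc] at e'
      rw [pentagon] at e'
      simp only [Category.assoc, MonoidalCategory.whiskerLeft_comp]
      rw [← associator_naturality_middle_assoc, ← e', associator_naturality_left_assoc]
    rw [powPerm_finCongr_succ P (Nat.add_assoc n m p)]
    exact h _ _ _ _ _ ih

/-- A form of the recursion for `powPerm` in which the two constituents are given. -/
theorem powPerm_eq_of {n m : ℕ} (e : Fin (n + 1) ≃ Fin (m + 1)) (a : Fin (n + 1)) (e' : Fin n ≃ Fin m)
    (h : e a = Fin.last m) (h' : ∀ i, (e' i).castSucc = e (a.succAbove i)) :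
    powPerm P e = toLast P n a ≫ wk P (powPerm P e') := by
  rw [powPerm_succ, delEquiv_unique e a _ h e' (by simpa only [Fin.succAbove_last] using h'), ← h,
    Equiv.symm_apply_apply]

theorem powPerm_blockSum_left {n n' : ℕ} (e : Fin n ≃ Fin n') (m : ℕ) :
    powPerm P (blockSum e (Equiv.refl (Fin m))) ≫ powSplit P n' m =
      powSplit P n m ≫ powPerm P e ▷ powObj P m := by
  induction m with
  | zero =>
    rw [blockSum_refl_zero]
    exact rightUnitor_inv_naturality _
  | succ m ih =>
    have h : ∀ {A A' X X' Z : C} (q : A ⟶ A') (s' : A' ⟶ X' ⊗ Z) (s : A ⟶ X ⊗ Z) (f : X ⟶ X')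
        (_ : q ≫ s' = s ≫ f ▷ Z), q ▷ P ≫ s' ▷ P ≫ (α_ X' Z P).hom =
          (s ▷ P ≫ (α_ X Z P).hom) ≫ f ▷ (Z ⊗ P) := by
      intro A A' X X' Z q s' s f e
      rw [← comp_whiskerRight_assoc, e]
      simp
    have e1 : powPerm P (blockSum e (Equiv.refl (Fin (m + 1)))) =
        wk P (powPerm P (blockSum e (Equiv.refl (Fin m)))) := by
      refine (powPerm_eq_of P (n := n + m) (m := n' + m)
        (@blockSum n n' (m + 1) (m + 1) e (Equiv.refl _)) (Fin.last _)
        (blockSum e (Equiv.refl (Fin m))) (blockSum_natAdd e (Equiv.refl _) (Fin.last m)) ?_).trans ?_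
      · simp only [Fin.succAbove_last, Fin.forall_fin_add]
        constructor
        · intro i
          rw [blockSum_castAdd]
          exact (blockSum_castAdd e (Equiv.refl (Fin (m + 1))) i).symm
        · intro i
          rw [blockSum_natAdd]
          exact (blockSum_natAdd e (Equiv.refl (Fin (m + 1))) i.castSucc).symm
      · rw [toLast_last, Category.id_comp]
    rw [e1]
    exact h _ _ _ _ ih

/-- Moving an entry of the last block to the end only affects the last block. -/
theorem toLast_natAdd (n m : ℕ) (a : Fin (m + 1)) :
    toLast P (n + m) (Fin.natAdd n a) ≫ powSplit P n (m + 1) =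
      powSplit P n (m + 1) ≫ powObj P n ◁ toLast P m a := by
  induction m with
  | zero =>
    obtain rfl : a = Fin.last 0 := Subsingleton.elim (α := Fin 1) _ _
    rw [show Fin.natAdd n (Fin.last 0) = Fin.last (n + 0) from rfl, toLast_last, toLast_last]
    simp
  | succ m ih =>
    induction a using Fin.lastCases with
    | last =>
      rw [show Fin.natAdd n (Fin.last (m + 1)) = Fin.last (n + (m + 1)) from rfl, toLast_last,
        toLast_last]
      simp
    | cast b =>
      have h : ∀ {A X Y : C} (t : A ⊗ P ⟶ A ⊗ P) (s : A ⟶ X ⊗ Y) (t' : Y ⊗ P ⟶ Y ⊗ P)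
          (_ : t ≫ s ▷ P ≫ (α_ X Y P).hom = (s ▷ P ≫ (α_ X Y P).hom) ≫ X ◁ t'),
          (t ▷ P ≫ (α_ A P P).hom ≫ A ◁ (β_ P P).hom ≫ (α_ A P P).inv) ≫
            (s ▷ P ≫ (α_ X Y P).hom) ▷ P ≫ (α_ X (Y ⊗ P) P).hom =
          ((s ▷ P ≫ (α_ X Y P).hom) ▷ P ≫ (α_ X (Y ⊗ P) P).hom) ≫
            X ◁ (t' ▷ P ≫ (α_ Y P P).hom ≫ Y ◁ (β_ P P).hom ≫ (α_ Y P P).inv) := by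
        intro A X Y t s t' e
        have e' := congrArg (fun z => z ▷ P ≫ (α_ _ _ _).hom ≫
          X ◁ ((α_ Y P P).hom ≫ Y ◁ (β_ P P).hom ≫ (α_ Y P P).inv)) e
        have k1 : ((α_ A P P).hom ≫ A ◁ (β_ P P).hom ≫ (α_ A P P).inv) ≫ (s ▷ P) ▷ P =
            (s ▷ P) ▷ P ≫ (α_ (X ⊗ Y) P P).hom ≫ (X ⊗ Y) ◁ (β_ P P).hom ≫
              (α_ (X ⊗ Y) P P).inv := by
          rw [associator_naturality_left_assoc, ← whisker_exchange_assoc]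
          simp
        have k2 : ((α_ (X ⊗ Y) P P).hom ≫ (X ⊗ Y) ◁ (β_ P P).hom ≫ (α_ (X ⊗ Y) P P).inv) ≫
            (α_ X Y P).hom ▷ P ≫ (α_ X (Y ⊗ P) P).hom =
            (α_ X Y P).hom ▷ P ≫ (α_ X (Y ⊗ P) P).hom ≫
              X ◁ ((α_ Y P P).hom ≫ Y ◁ (β_ P P).hom ≫ (α_ Y P P).inv) := by
          monoidal
        simp only [Category.assoc, comp_whiskerRight, MonoidalCategory.whiskerLeft_comp] at *
        rw [reassoc_of% k1, k2, e', associator_naturality_middle_assoc]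
      have e1 := toLast_castSucc P (n + m) (Fin.natAdd n b)
      have e2 := toLast_castSucc P m b
      rw [e2]
      exact (congrArg (fun z => z ≫ powSplit P n (m + 2)) e1).trans (h _ _ _ (ih b))

theorem powPerm_blockSum_right (n : ℕ) {m m' : ℕ} (f : Fin m ≃ Fin m') :
    powPerm P (blockSum (Equiv.refl (Fin n)) f) ≫ powSplit P n m' =
      powSplit P n m ≫ powObj P n ◁ powPerm P f := by
  induction m generalizing m' with
  | zero =>
    obtain rfl : m' = 0 := by simpa using (Fintype.card_congr f).symm
    obtain rfl : f = Equiv.refl _ := Subsingleton.elim _ _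
    rw [blockSum_refl_refl, powPerm_refl, powPerm_refl]
    simp
  | succ m ih =>
    obtain rfl : m' = m + 1 := by simpa using (Fintype.card_congr f).symm
    have h : ∀ {A X Y : C} (q : A ⟶ A) (t : A ⊗ P ⟶ A ⊗ P) (s : A ⟶ X ⊗ Y) (t' : Y ⊗ P ⟶ Y ⊗ P)
        (q' : Y ⟶ Y) (_ : q ≫ s = s ≫ X ◁ q')
        (_ : t ≫ s ▷ P ≫ (α_ X Y P).hom = (s ▷ P ≫ (α_ X Y P).hom) ≫ X ◁ t'),
        (t ≫ q ▷ P) ≫ s ▷ P ≫ (α_ X Y P).hom =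
        (s ▷ P ≫ (α_ X Y P).hom) ≫ X ◁ (t' ≫ q' ▷ P) := by
      intro A X Y q t s t' q' e1 e2
      simp only [Category.assoc] at *
      rw [← comp_whiskerRight_assoc, e1, comp_whiskerRight_assoc, associator_naturality_middle,
        reassoc_of% e2, MonoidalCategory.whiskerLeft_comp]
    have e1 := powPerm_eq_of P (n := n + m) (m := n + m)
      (@blockSum n n (m + 1) (m + 1) (Equiv.refl _) f)
      (Fin.natAdd n (f.symm (Fin.last m))) (blockSum (Equiv.refl _) (delEquiv f (Fin.last m)))
      ((blockSum_natAdd (Equiv.refl _) f _).trans (by rw [Equiv.apply_symm_apply]; rfl)) (by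
        simp only [Fin.forall_fin_add]
        constructor
        · intro i
          rw [blockSum_castAdd]
          rw [Fin.succAbove_of_castSucc_lt]
          · exact (blockSum_castAdd _ f i).symm
          · simp only [Fin.lt_def, Fin.val_castSucc, Fin.val_castAdd, Fin.val_natAdd]
            omega
        · intro i
          have e := delEquiv_spec f (Fin.last m) i
          have k : (Fin.natAdd n (f.symm (Fin.last m))).succAbove (Fin.natAdd n i) =
              Fin.natAdd n ((f.symm (Fin.last m)).succAbove i) := by
            ext
            simp only [Fin.succAbove, Fin.lt_def, Fin.val_castSucc, Fin.val_natAdd,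
              Nat.add_lt_add_iff_left]
            split_ifs <;> simp [Nat.add_assoc]
          rw [blockSum_natAdd]
          rw [Fin.succAbove_last] at e
          refine Eq.trans ?_ (congrArg _ k.symm)
          refine Eq.trans ?_ (blockSum_natAdd _ f _).symm
          rw [← e]
          rfl)
    rw [powPerm_succ P f]
    exact (congrArg (fun z => z ≫ powSplit P n (m + 1)) e1).trans
      (h _ _ _ _ _ (ih _) (toLast_natAdd P n m _))

theorem powPerm_blockSum {n n' m m' : ℕ} (e : Fin n ≃ Fin n') (f : Fin m ≃ Fin m') :
    powPerm P (blockSum e f) ≫ powSplit P n' m' =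
      powSplit P n m ≫ (powPerm P e ⊗ₘ powPerm P f) := by
  have h : blockSum e f = (blockSum e (Equiv.refl _)).trans (blockSum (Equiv.refl _) f) := by
    simp [Equiv.ext_iff, Fin.forall_fin_add]
  rw [h, powPerm_trans, Category.assoc, powPerm_blockSum_right,
    reassoc_of% (powPerm_blockSum_left P e m), MonoidalCategory.tensorHom_def]

/-- The statement that the shuffle `χ_{n,m}` acts on tensor powers as the symmetry. -/
def ShuffleBraids (n m : ℕ) : Prop :=
  powPerm P (shuffle n m) ≫ powSplit P m n = powSplit P n m ≫ (β_ _ _).hom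

variable {P}

theorem ShuffleBraids.symm {n m : ℕ} (h : ShuffleBraids P n m) : ShuffleBraids P m n := by
  unfold ShuffleBraids at *
  have e : powPerm P (shuffle m n) ≫ powPerm P (shuffle n m) = 𝟙 _ := by
    rw [← powPerm_trans, ← powPerm_refl]
    congr 1
    simp [Equiv.ext_iff, Fin.forall_fin_add]
  rw [← cancel_mono (β_ (powObj P n) (powObj P m)).hom, Category.assoc, Category.assoc, ← h,
    reassoc_of% e, SymmetricCategory.symmetry, Category.comp_id]

/-- The inductive step: the block of length `m + p` is moved past the block of length `n` in two
stages, which the hexagon identity matches with the symmetry. -/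
theorem ShuffleBraids.add {n m p : ℕ} (h : ShuffleBraids P n m) (h' : ShuffleBraids P n p) :
    ShuffleBraids P n (m + p) := by
  unfold ShuffleBraids at *
  have e : shuffle n (m + p) = (finCongr (Nat.add_assoc n m p).symm).trans
      ((blockSum (shuffle n m) (Equiv.refl _)).trans ((finCongr (Nat.add_assoc m n p)).trans
      ((blockSum (Equiv.refl _) (shuffle n p)).trans (finCongr (Nat.add_assoc m p n).symm)))) := by
    simp [Equiv.ext_iff, Fin.forall_fin_add]
  have e1 : powPerm P (finCongr (Nat.add_assoc n m p).symm) ≫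
      powPerm P (finCongr (Nat.add_assoc n m p)) = 𝟙 _ := by
    rw [← powPerm_trans]
    exact powPerm_refl P _
  have e2 : powPerm P (finCongr (Nat.add_assoc m p n).symm) ≫
      powPerm P (finCongr (Nat.add_assoc m p n)) = 𝟙 _ := by
    rw [← powPerm_trans]
    exact powPerm_refl P _
  have e3 : powPerm P (finCongr (Nat.add_assoc n m p).symm) ≫ powSplit P (n + m) p ≫
      powSplit P n m ▷ powObj P p = powSplit P n (m + p) ≫ powObj P n ◁ powSplit P m p ≫
        (α_ _ _ _).inv := by
    rw [← cancel_mono (α_ (powObj P n) (powObj P m) (powObj P p)).hom]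
    simp only [Category.assoc, Iso.inv_hom_id, Category.comp_id]
    rw [powSplit_assoc, reassoc_of% e1]
  rw [← cancel_mono (powSplit P m p ▷ powObj P n ≫ (α_ _ _ _).hom)]
  simp only [Category.assoc]
  rw [powSplit_assoc, e]
  simp only [powPerm_trans, Category.assoc]
  rw [reassoc_of% e2, reassoc_of% (powPerm_blockSum_right P m (shuffle n p)),
    ← whiskerLeft_comp, h', whiskerLeft_comp, ← reassoc_of% (powSplit_assoc P m n p),
    reassoc_of% (powPerm_blockSum_left P (shuffle n m) p), ← comp_whiskerRight_assoc, h,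
    comp_whiskerRight_assoc, reassoc_of% e3, ← BraidedCategory.braiding_naturality_right_assoc,
    ← BraidedCategory.hexagon_forward]
  simp

theorem shuffleBraids_zero (n : ℕ) : ShuffleBraids P n 0 := by
  have e : powPerm P (finCongr (Nat.zero_add n).symm) ≫ powPerm P (finCongr (Nat.zero_add n)) =
      𝟙 _ := by
    rw [← powPerm_trans]
    exact powPerm_refl P _
  rw [ShuffleBraids, shuffle_zero_right, powSplit_zero_left]
  refine ((Category.assoc _ _ _).symm.trans
    ((congrArg (· ≫ (λ_ (powObj P n)).inv) e).trans (Category.id_comp _))).trans ?_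
  rw [powSplit_zero]
  exact (rightUnitor_inv_braiding _).symm

theorem shuffleBraids_one_one : ShuffleBraids P 1 1 := by
  have h : ((α_ (𝟙_ C) P P).hom ≫ 𝟙_ C ◁ (β_ P P).hom ≫ (α_ (𝟙_ C) P P).inv) ≫
      (ρ_ (𝟙_ C ⊗ P)).inv ▷ P ≫ (α_ (𝟙_ C ⊗ P) (𝟙_ C) P).hom =
      ((ρ_ (𝟙_ C ⊗ P)).inv ▷ P ≫ (α_ (𝟙_ C ⊗ P) (𝟙_ C) P).hom) ≫
        (β_ (𝟙_ C ⊗ P) (𝟙_ C ⊗ P)).hom := by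
    have k := BraidedCategory.braiding_naturality (λ_ P).hom (λ_ P).hom
    rw [← cancel_mono ((λ_ P).hom ⊗ₘ (λ_ P).hom)]
    simp only [Category.assoc]
    rw [← k]
    have k1 : (ρ_ (𝟙_ C ⊗ P)).inv ▷ P ≫ (α_ (𝟙_ C ⊗ P) (𝟙_ C) P).hom ≫
        ((λ_ P).hom ⊗ₘ (λ_ P).hom) = (λ_ P).hom ▷ P := by monoidal
    have k2 : (λ_ P).hom ▷ P = (α_ (𝟙_ C) P P).hom ≫ (λ_ (P ⊗ P)).hom := by monoidal
    rw [k1, reassoc_of% k1, k2]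
    simp
  have e1 := powPerm_eq_of P (shuffle 1 1) (Fin.castSucc (Fin.last 0)) (Equiv.refl _)
    (by decide) (by decide)
  rw [toLast_castSucc, toLast_last, powPerm_refl, wk_id, Category.id_comp, Category.comp_id] at e1
  rw [ShuffleBraids, e1]
  exact h

variable (P)

/-- The decomposition of tensor powers is cocommutative. -/
theorem powPerm_shuffle (n m : ℕ) :
    powPerm P (shuffle n m) ≫ powSplit P m n = powSplit P n m ≫ (β_ _ _).hom := by
  -- Additivity in the second argument and symmetry reduce the claim to single transpositions.
  have h1 : ∀ m, ShuffleBraids P 1 m := fun m => by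
    induction m with
    | zero => exact shuffleBraids_zero 1
    | succ m ih => exact ih.add shuffleBraids_one_one
  have h : ∀ m, ShuffleBraids P n m := fun m => by
    induction m with
    | zero => exact shuffleBraids_zero n
    | succ m ih => exact ih.add (h1 n).symm
  exact h m

end PowSplit

/-! ### Graded parametrised morphisms -/

/-- Commutative monoids in symmetric sequences in `C`, the multiplication being given by its
components. -/
structure CommGrMon (C : Type u) [Category.{v} C] [MonoidalCategory C] [SymmetricCategory C] where
  seq : FinBij ⥤ C
  mul : ∀ n m : ℕ, seq.obj ⟨n⟩ ⊗ seq.obj ⟨m⟩ ⟶ seq.obj ⟨n + m⟩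
  one : 𝟙_ C ⟶ seq.obj ⟨0⟩
  mul_perm : ∀ {n n' m m' : ℕ} (e : Fin n ≃ Fin n') (f : Fin m ≃ Fin m'),
    (seq.map (FinBij.of e) ⊗ₘ seq.map (FinBij.of f)) ≫ mul n' m' =
      mul n m ≫ seq.map (FinBij.of (blockSum e f))
  mul_assoc : ∀ n m p : ℕ,
    mul n m ▷ seq.obj ⟨p⟩ ≫ mul (n + m) p ≫ seq.map (FinBij.of (finCongr (Nat.add_assoc n m p))) =
      (α_ (seq.obj ⟨n⟩) (seq.obj ⟨m⟩) (seq.obj ⟨p⟩)).hom ≫ seq.obj ⟨n⟩ ◁ mul m p ≫ mul n (m + p)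
  mul_one : ∀ n : ℕ,
    (ρ_ (seq.obj ⟨n⟩)).inv ≫ seq.obj ⟨n⟩ ◁ one ≫ mul n 0 = 𝟙 (seq.obj ⟨n⟩)
  one_mul : ∀ n : ℕ, (λ_ (seq.obj ⟨n⟩)).inv ≫ one ▷ seq.obj ⟨n⟩ ≫ mul 0 n =
    seq.map (FinBij.of (finCongr (Nat.zero_add n).symm))
  mul_comm : ∀ n m : ℕ, mul n m ≫ seq.map (FinBij.of (shuffle n m)) =
    (β_ (seq.obj ⟨n⟩) (seq.obj ⟨m⟩)).hom ≫ mul m n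

section GrHom

variable {C : Type u} [Category.{v} C] [MonoidalCategory C] [SymmetricCategory C]

theorem FinBij.map_refl (F : FinBij ⥤ C) (n : ℕ) :
    F.map (FinBij.of (Equiv.refl (Fin n))) = 𝟙 (F.obj ⟨n⟩) := F.map_id _

theorem FinBij.map_map (F : FinBij ⥤ C) {n m p : ℕ} (e : Fin n ≃ Fin m) (f : Fin m ≃ Fin p) :
    F.map (FinBij.of e) ≫ F.map (FinBij.of f) = F.map (FinBij.of (e.trans f)) :=
  (F.map_comp (FinBij.of e) (FinBij.of f)).symm

theorem powPerm_powPerm (P : C) {n m k : ℕ} (e : Fin n ≃ Fin m) (f : Fin m ≃ Fin k) :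
    powPerm P e ≫ powPerm P f = powPerm P (e.trans f) := (powPerm_trans P e f).symm

/-- Morphisms `X ∧ P^{∧n} ⟶ Y ∧ F n`. -/
abbrev GrHom (P : C) (F : CommGrMon C) (X Y : C) (n : ℕ) : Type v :=
  X ⊗ powObj P n ⟶ Y ⊗ F.seq.obj ⟨n⟩

variable {P : C} {F : CommGrMon C}

namespace GrHom

/-- The action of bijections by conjugation. -/
def perm {X Y : C} {n m : ℕ} (e : Fin n ≃ Fin m) (f : GrHom P F X Y n) : GrHom P F X Y m :=
  X ◁ powPerm P e.symm ≫ f ≫ Y ◁ F.seq.map (FinBij.of e)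

/-- The composition of graded parametrised morphisms. -/
def comp {X Y Z : C} {n m : ℕ} (f : GrHom P F X Y n) (g : GrHom P F Y Z m) :
    GrHom P F X Z (n + m) :=
  X ◁ powSplit P n m ≫ paramComp f g ≫ Z ◁ F.mul n m

/-- The monoidal product of graded parametrised morphisms. -/
def tensor {X X' Y Y' : C} {n m : ℕ} (f : GrHom P F X X' n) (g : GrHom P F Y Y' m) :
    GrHom P F (X ⊗ Y) (X' ⊗ Y') (n + m) :=
  (X ⊗ Y) ◁ powSplit P n m ≫ paramTensor f g ≫ (X' ⊗ Y') ◁ F.mul n m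

/-- A morphism of `C` as a morphism of degree `0`. -/
def ofHom (P : C) (F : CommGrMon C) {X Y : C} (h : X ⟶ Y) : GrHom P F X Y 0 :=
  h ▷ 𝟙_ C ≫ Y ◁ F.one

/-- An endomorphism of `Y` of degree `n` which does not depend on `Y`. -/
def scalar (Y : C) {n : ℕ} (r : powObj P n ⟶ F.seq.obj ⟨n⟩) : GrHom P F Y Y n := Y ◁ r

/-- The product of scalars. -/
def smul {n m : ℕ} (r : powObj P n ⟶ F.seq.obj ⟨n⟩) (s : powObj P m ⟶ F.seq.obj ⟨m⟩) :
    powObj P (n + m) ⟶ F.seq.obj ⟨n + m⟩ :=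
  powSplit P n m ≫ (r ⊗ₘ s) ≫ F.mul n m

variable {X X' X'' Y Y' Y'' Z Z' W : C} {n n' m m' p q : ℕ}

theorem perm_refl (f : GrHom P F X Y n) : perm (Equiv.refl _) f = f := by
  rw [perm, Equiv.refl_symm, powPerm_refl, FinBij.map_refl]
  simp

theorem perm_perm (e : Fin n ≃ Fin m) (e' : Fin m ≃ Fin p) (f : GrHom P F X Y n) :
    perm e' (perm e f) = perm (e.trans e') f := by
  simp only [perm, Category.assoc]
  rw [← whiskerLeft_comp_assoc, powPerm_powPerm, ← MonoidalCategory.whiskerLeft_comp,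
    FinBij.map_map]
  rfl

theorem powSplit_blockSum_symm (e : Fin n ≃ Fin n') (e' : Fin m ≃ Fin m') :
    powPerm P (blockSum e e').symm ≫ powSplit P n m =
      powSplit P n' m' ≫ (powPerm P e.symm ⊗ₘ powPerm P e'.symm) := by
  rw [← powPerm_blockSum]
  rfl

theorem comp_perm (e : Fin n ≃ Fin n') (e' : Fin m ≃ Fin m') (f : GrHom P F X Y n)
    (g : GrHom P F Y Z m) :
    comp (perm e f) (perm e' g) = perm (blockSum e e') (comp f g) := by
  simp only [comp, perm, paramComp_naturality, Category.assoc]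
  rw [← whiskerLeft_comp_assoc, ← powSplit_blockSum_symm, ← MonoidalCategory.whiskerLeft_comp,
    F.mul_perm]
  simp only [MonoidalCategory.whiskerLeft_comp, Category.assoc]

theorem tensor_perm (e : Fin n ≃ Fin n') (e' : Fin m ≃ Fin m') (f : GrHom P F X X' n)
    (g : GrHom P F Y Y' m) :
    tensor (perm e f) (perm e' g) = perm (blockSum e e') (tensor f g) := by
  simp only [tensor, perm, paramTensor_naturality, Category.assoc]
  rw [← whiskerLeft_comp_assoc, ← powSplit_blockSum_symm, ← MonoidalCategory.whiskerLeft_comp,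
    F.mul_perm]
  simp only [MonoidalCategory.whiskerLeft_comp, Category.assoc]

theorem paramComp_left_naturality {G G' A B H K : C} (f : X ⊗ G ⟶ Y ⊗ A) (g : Y ⊗ G' ⟶ Z ⊗ B)
    (a : H ⟶ G) (b : A ⟶ K) :
    paramComp (X ◁ a ≫ f ≫ Y ◁ b) g = X ◁ (a ▷ G') ≫ paramComp f g ≫ Z ◁ (b ▷ B) := by
  simpa using paramComp_naturality f g a (𝟙 G') b (𝟙 B)

theorem paramComp_right_naturality {G G' A B H K : C} (f : X ⊗ G ⟶ Y ⊗ A) (g : Y ⊗ G' ⟶ Z ⊗ B)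
    (a : H ⟶ G') (b : B ⟶ K) :
    paramComp f (Y ◁ a ≫ g ≫ Z ◁ b) = X ◁ (G ◁ a) ≫ paramComp f g ≫ Z ◁ (A ◁ b) := by
  simpa using paramComp_naturality f g (𝟙 G) a (𝟙 A) b

theorem paramTensor_left_naturality {G G' A B H K : C} (f : X ⊗ G ⟶ X' ⊗ A) (g : Y ⊗ G' ⟶ Y' ⊗ B)
    (a : H ⟶ G) (b : A ⟶ K) :
    paramTensor (X ◁ a ≫ f ≫ X' ◁ b) g =
      (X ⊗ Y) ◁ (a ▷ G') ≫ paramTensor f g ≫ (X' ⊗ Y') ◁ (b ▷ B) := by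
  simpa using paramTensor_naturality f g a (𝟙 G') b (𝟙 B)

theorem paramTensor_right_naturality {G G' A B H K : C} (f : X ⊗ G ⟶ X' ⊗ A) (g : Y ⊗ G' ⟶ Y' ⊗ B)
    (a : H ⟶ G') (b : B ⟶ K) :
    paramTensor f (Y ◁ a ≫ g ≫ Y' ◁ b) =
      (X ⊗ Y) ◁ (G ◁ a) ≫ paramTensor f g ≫ (X' ⊗ Y') ◁ (A ◁ b) := by
  simpa using paramTensor_naturality f g (𝟙 G) a (𝟙 A) b

theorem powSplit_assoc_symm (n m p : ℕ) :
    powPerm P (finCongr (Nat.add_assoc n m p)).symm ≫ powSplit P (n + m) p ≫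
      powSplit P n m ▷ powObj P p ≫ (α_ _ _ _).hom =
      powSplit P n (m + p) ≫ powObj P n ◁ powSplit P m p := by
  rw [powSplit_assoc, reassoc_of% powPerm_powPerm P, Equiv.symm_trans_self, powPerm_refl,
    Category.id_comp]

theorem comp_assoc (f : GrHom P F X Y n) (g : GrHom P F Y Z m) (h : GrHom P F Z W p) :
    perm (finCongr (Nat.add_assoc n m p)) (comp (comp f g) h) = comp f (comp g h) := by
  have e := F.mul_assoc n m p
  rw [← cancel_epi (α_ _ _ _).inv, Iso.inv_hom_id_assoc] at e
  rw [comp, comp, comp, comp, paramComp_left_naturality, paramComp_right_naturality,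
    paramComp_assoc]
  simp only [perm, Category.assoc]
  simp only [← whiskerLeft_comp_assoc, ← MonoidalCategory.whiskerLeft_comp]
  rw [← e, powSplit_assoc_symm]

end GrHom

section Mid

/-- The bijection exchanging the two middle blocks. -/
def midSwap (n m p q : ℕ) : Fin ((n + m) + (p + q)) ≃ Fin ((n + p) + (m + q)) :=
  (finCongr (Nat.add_assoc n m (p + q))).trans ((blockSum (Equiv.refl (Fin n))
    ((finCongr (Nat.add_assoc m p q)).symm.trans ((blockSum (shuffle m p) (Equiv.refl (Fin q))).trans
      (finCongr (Nat.add_assoc p m q))))).trans (finCongr (Nat.add_assoc n p (m + q))).symm)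

theorem CommGrMon.mul_assoc_symm (F : CommGrMon C) (n m p : ℕ) :
    F.seq.obj ⟨n⟩ ◁ F.mul m p ≫ F.mul n (m + p) ≫
        F.seq.map (FinBij.of (finCongr (Nat.add_assoc n m p)).symm) =
      (α_ _ _ _).inv ≫ F.mul n m ▷ F.seq.obj ⟨p⟩ ≫ F.mul (n + m) p := by
  have e := F.mul_assoc n m p
  rw [← cancel_epi (α_ _ _ _).inv, Iso.inv_hom_id_assoc] at e
  rw [← reassoc_of% e, FinBij.map_map, Equiv.self_trans_symm, FinBij.map_refl, Category.comp_id]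

theorem CommGrMon.mul_perm_left (F : CommGrMon C) {n n' : ℕ} (e : Fin n ≃ Fin n') (m : ℕ) :
    F.mul n m ≫ F.seq.map (FinBij.of (blockSum e (Equiv.refl (Fin m)))) =
      F.seq.map (FinBij.of e) ▷ F.seq.obj ⟨m⟩ ≫ F.mul n' m := by
  rw [← F.mul_perm, FinBij.map_refl, tensorHom_id]

theorem CommGrMon.mul_perm_right (F : CommGrMon C) (n : ℕ) {m m' : ℕ} (e : Fin m ≃ Fin m') :
    F.mul n m ≫ F.seq.map (FinBij.of (blockSum (Equiv.refl (Fin n)) e)) =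
      F.seq.obj ⟨n⟩ ◁ F.seq.map (FinBij.of e) ≫ F.mul n m' := by
  rw [← F.mul_perm, FinBij.map_refl, id_tensorHom]

/-- The multiplication of a commutative graded monoid is a morphism of graded monoids. -/
theorem CommGrMon.mul_midSwap (F : CommGrMon C) (n m p q : ℕ) :
    (F.mul n m ⊗ₘ F.mul p q) ≫ F.mul (n + m) (p + q) ≫ F.seq.map (FinBij.of (midSwap n m p q)) =
      tensorμ _ _ _ _ ≫ (F.mul n p ⊗ₘ F.mul m q) ≫ F.mul (n + p) (m + q) := by
  have inner : F.seq.obj ⟨m⟩ ◁ F.mul p q ≫ F.mul m (p + q) ≫ F.seq.map (FinBij.of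
      ((finCongr (Nat.add_assoc m p q)).symm.trans
        ((blockSum (shuffle m p) (Equiv.refl (Fin q))).trans (finCongr (Nat.add_assoc p m q))))) =
      (α_ _ _ _).inv ≫ (β_ _ _).hom ▷ _ ≫ (α_ _ _ _).hom ≫ F.seq.obj ⟨p⟩ ◁ F.mul m q ≫
        F.mul p (m + q) := by
    rw [← FinBij.map_map, ← FinBij.map_map, reassoc_of% F.mul_assoc_symm,
      reassoc_of% F.mul_perm_left, ← comp_whiskerRight_assoc, F.mul_comm,
      comp_whiskerRight_assoc, F.mul_assoc]
  rw [midSwap, ← FinBij.map_map, ← FinBij.map_map, MonoidalCategory.tensorHom_def', Category.assoc,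
    reassoc_of% F.mul_assoc, reassoc_of% F.mul_perm_right]
  rw [associator_naturality_right_assoc]
  simp only [← whiskerLeft_comp_assoc]
  rw [inner]
  simp only [MonoidalCategory.whiskerLeft_comp, Category.assoc]
  rw [F.mul_assoc_symm, associator_inv_naturality_right_assoc,
    MonoidalCategory.tensorHom_def', tensorμ]
  simp

/-- Tensor powers form a graded monoid, with the inverses of `powSplit` as multiplication. -/
def powMon (P : C) : CommGrMon C where
  seq := powFunctor P
  mul n m := (inv (powSplit P n m) : powObj P n ⊗ powObj P m ⟶ powObj P (n + m))
  one := 𝟙 (𝟙_ C)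
  mul_perm e f := by
    change (powPerm P e ⊗ₘ powPerm P f) ≫ inv (powSplit P _ _) =
      inv (powSplit P _ _) ≫ powPerm P (blockSum e f)
    rw [IsIso.comp_inv_eq, Category.assoc, IsIso.eq_inv_comp]
    exact (powPerm_blockSum P e f).symm
  mul_assoc n m p := by
    have h := powSplit_assoc P n m p
    have h2 : powPerm P (finCongr (Nat.add_assoc n m p)) ≫ powSplit P n (m + p) =
        powSplit P (n + m) p ≫ powSplit P n m ▷ powObj P p ≫ (α_ _ _ _).hom ≫
          inv (powObj P n ◁ powSplit P m p) := by
      rw [reassoc_of% h, IsIso.hom_inv_id, Category.comp_id]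
    change inv (powSplit P n m) ▷ powObj P p ≫ inv (powSplit P (n + m) p) ≫
      powPerm P (finCongr (Nat.add_assoc n m p)) = (α_ _ _ _).hom ≫
        powObj P n ◁ inv (powSplit P m p) ≫ inv (powSplit P n (m + p))
    rw [← cancel_mono (powSplit P n (m + p))]
    simp only [Category.assoc, IsIso.inv_hom_id, Category.comp_id]
    rw [h2, IsIso.inv_hom_id_assoc, ← comp_whiskerRight_assoc, IsIso.inv_hom_id]
    simp
  mul_one n := by
    have h : inv (powSplit P n 0) = (ρ_ (powObj P n)).hom :=
      IsIso.inv_eq_of_hom_inv_id (ρ_ (powObj P n)).inv_hom_id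
    have : ∀ {A : C} (f : A ⊗ 𝟙_ C ⟶ A) (_ : f = (ρ_ A).hom),
        (ρ_ A).inv ≫ A ◁ 𝟙 (𝟙_ C) ≫ f = 𝟙 A := by
      intro A f h; simp [h]
    exact this _ h
  one_mul n := by
    have h : inv (powSplit P 0 n) = (λ_ (powObj P n)).hom ≫
        powPerm P (finCongr (Nat.zero_add n).symm) := by
      apply IsIso.inv_eq_of_hom_inv_id
      rw [powSplit_zero_left]
      have e : powPerm P (finCongr (Nat.zero_add n)) ≫ powPerm P (finCongr (Nat.zero_add n).symm) =
          𝟙 _ := by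
        rw [← powPerm_trans]
        exact powPerm_refl P _
      have : ∀ {A B : C} (f : A ⟶ B) (g : B ⟶ A) (_ : f ≫ g = 𝟙 _),
          (f ≫ (λ_ B).inv) ≫ (λ_ B).hom ≫ g = 𝟙 _ := by
        intro A B f g h; simp [h]
      exact this _ _ e
    have : ∀ {A B : C} (f : 𝟙_ C ⊗ B ⟶ A) (g : B ⟶ A) (_ : f = (λ_ B).hom ≫ g),
        (λ_ B).inv ≫ 𝟙 (𝟙_ C) ▷ B ≫ f = g := by
      intro A B f g h; simp [h]
    exact this _ _ h
  mul_comm n m := by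
    have h := powPerm_shuffle P n m
    change inv (powSplit P n m) ≫ powPerm P (shuffle n m) = (β_ _ _).hom ≫ inv (powSplit P m n)
    rw [← cancel_mono (powSplit P m n)]
    simp [h]

/-- The dual of `CommGrMon.mul_midSwap` for tensor powers, by passing to the graded monoid
`powMon`. -/
theorem powSplit_midSwap (P : C) (n m p q : ℕ) :
    powPerm P (midSwap n m p q) ≫ powSplit P (n + p) (m + q) ≫
        (powSplit P n p ⊗ₘ powSplit P m q) =
      powSplit P (n + m) (p + q) ≫ (powSplit P n m ⊗ₘ powSplit P p q) ≫ tensorμ _ _ _ _ := by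
  have h := (powMon P).mul_midSwap n m p q
  change (inv (powSplit P n m) ⊗ₘ inv (powSplit P p q)) ≫ inv (powSplit P (n + m) (p + q)) ≫
    powPerm P (midSwap n m p q) = tensorμ _ _ _ _ ≫
      (inv (powSplit P n p) ⊗ₘ inv (powSplit P m q)) ≫ inv (powSplit P (n + p) (m + q)) at h
  have h' := congrArg (fun z => powSplit P (n + m) (p + q) ≫
    (powSplit P n m ⊗ₘ powSplit P p q) ≫ z ≫ powSplit P (n + p) (m + q) ≫
        (powSplit P n p ⊗ₘ powSplit P m q)) h
  simp only [Category.assoc, IsIso.inv_hom_id_assoc, tensorHom_comp_tensorHom_assoc,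
    tensorHom_comp_tensorHom, IsIso.hom_inv_id, IsIso.inv_hom_id, id_tensorHom_id, Category.id_comp,
    Category.comp_id, IsIso.hom_inv_id_assoc] at h'
  exact h'

end Mid

namespace GrHom

variable {X X' X'' Y Y' Y'' Z Z' W : C} {n n' m m' p q : ℕ}

theorem midSwap_symm (n m p q : ℕ) : (midSwap n m p q).symm = midSwap n p m q := by
  have : ∀ i, midSwap n m p q (midSwap n p m q i) = i := by
    simp [midSwap, Fin.forall_fin_add, -Fin.cast_cast]
  exact Equiv.ext fun i => (Equiv.symm_apply_eq _).2 (this i).symm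

/-- The interchange law. -/
theorem comp_tensor (f : GrHom P F X X' n) (f' : GrHom P F X' X'' m) (g : GrHom P F Y Y' p)
    (g' : GrHom P F Y' Y'' q) :
    comp (tensor f g) (tensor f' g') = perm (midSwap n m p q) (tensor (comp f f') (comp g g')) := by
  have e := powSplit_midSwap P n p m q
  rw [comp, comp, comp, tensor, tensor, tensor, paramComp_naturality, paramTensor_naturality,
    paramComp_paramTensor]
  simp only [perm, Category.assoc, midSwap_symm]
  simp only [← whiskerLeft_comp_assoc, ← MonoidalCategory.whiskerLeft_comp]
  rw [e, F.mul_midSwap]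

theorem comp_ofHom (f : GrHom P F X Y n) (h : Y ⟶ Z) :
    comp f (ofHom P F h) = f ≫ h ▷ F.seq.obj ⟨n⟩ := by
  -- The statement for arbitrary parameter objects, since `powObj P n` and `powObj P (n + 0)` are
  -- equal only by unfolding and would block rewriting.
  have key : ∀ {G K K₀ : C} (f : X ⊗ G ⟶ Y ⊗ K) (u : 𝟙_ C ⟶ K₀) (m : K ⊗ K₀ ⟶ K)
      (_ : (ρ_ K).inv ≫ K ◁ u ≫ m = 𝟙 K),
      X ◁ (ρ_ G).inv ≫ paramComp f (h ▷ 𝟙_ C ≫ Z ◁ u) ≫ Z ◁ m = f ≫ h ▷ K := by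
    intro G K K₀ f u m e
    have e' := paramComp_right_naturality f (h ▷ 𝟙_ C) (𝟙 _) u
    rw [MonoidalCategory.whiskerLeft_id, Category.id_comp] at e'
    rw [e', paramComp_whiskerRight]
    simp only [Category.assoc]
    rw [← MonoidalCategory.whiskerLeft_comp, ← MonoidalCategory.whiskerLeft_comp, e]
    simp
  exact key f F.one (F.mul n 0) (F.mul_one n)

theorem ofHom_comp (h : X ⟶ Y) (f : GrHom P F Y Z n) :
    comp (ofHom P F h) f = perm (finCongr (Nat.zero_add n).symm) (h ▷ powObj P n ≫ f) := by
  have key : ∀ {G G' K K₀ K' : C} (f : Y ⊗ G ⟶ Z ⊗ K) (u : 𝟙_ C ⟶ K₀) (m : K₀ ⊗ K ⟶ K')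
      (a : G' ⟶ G) (b : K ⟶ K') (_ : (λ_ K).inv ≫ u ▷ K ≫ m = b),
      X ◁ (a ≫ (λ_ G).inv) ≫ paramComp (h ▷ 𝟙_ C ≫ Y ◁ u) f ≫ Z ◁ m =
        X ◁ a ≫ (h ▷ G ≫ f) ≫ Z ◁ b := by
    intro G G' K K₀ K' f u m a b e
    have e' := paramComp_left_naturality (h ▷ 𝟙_ C) f (𝟙 _) u
    rw [MonoidalCategory.whiskerLeft_id, Category.id_comp] at e'
    rw [e', whiskerRight_paramComp, ← e]
    simp
  have e := key f F.one (F.mul 0 n) (powPerm P (finCongr (Nat.zero_add n))) _ (F.one_mul n)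
  have e' := powSplit_zero_left P n
  refine Eq.trans ?_ e
  exact congrArg (fun z => X ◁ z ≫ paramComp (ofHom P F h) f ≫ Z ◁ F.mul 0 n) e'

theorem tensor_assoc (f : GrHom P F X X' n) (g : GrHom P F Y Y' m) (h : GrHom P F Z Z' p) :
    perm (finCongr (Nat.add_assoc n m p))
        (tensor (tensor f g) h ≫ (α_ X' Y' Z').hom ▷ F.seq.obj ⟨n + m + p⟩) =
      (α_ X Y Z).hom ▷ powObj P (n + (m + p)) ≫ tensor f (tensor g h) := by
  have e := F.mul_assoc n m p
  rw [← cancel_epi (α_ _ _ _).inv, Iso.inv_hom_id_assoc] at e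
  have key := paramTensor_assoc f g h
  rw [← cancel_mono ((X' ⊗ Y' ⊗ Z') ◁ (α_ (F.seq.obj ⟨n⟩) (F.seq.obj ⟨m⟩) (F.seq.obj ⟨p⟩)).inv),
    Category.assoc, MonoidalCategory.tensorHom_def, Category.assoc,
    ← MonoidalCategory.whiskerLeft_comp, Iso.hom_inv_id, MonoidalCategory.whiskerLeft_id,
    Category.comp_id, MonoidalCategory.tensorHom_def', Category.assoc] at key
  rw [tensor, tensor, tensor, tensor, paramTensor_left_naturality, paramTensor_right_naturality]
  simp only [perm, Category.assoc, whisker_exchange_assoc]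
  rw [reassoc_of% key]
  simp only [whisker_exchange_assoc]
  simp only [← whiskerLeft_comp_assoc, ← MonoidalCategory.whiskerLeft_comp]
  rw [powSplit_assoc_symm, e]

theorem tensor_braiding (f : GrHom P F X X' n) (g : GrHom P F Y Y' m) :
    perm (shuffle n m) (tensor f g ≫ (β_ X' Y').hom ▷ F.seq.obj ⟨n + m⟩) =
      (β_ X Y).hom ▷ powObj P (m + n) ≫ tensor g f := by
  have key := paramTensor_braiding f g
  rw [← cancel_mono ((Y' ⊗ X') ◁ (β_ (F.seq.obj ⟨m⟩) (F.seq.obj ⟨n⟩)).hom),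
    Category.assoc, MonoidalCategory.tensorHom_def, Category.assoc,
    ← MonoidalCategory.whiskerLeft_comp, SymmetricCategory.symmetry,
    MonoidalCategory.whiskerLeft_id, Category.comp_id, MonoidalCategory.tensorHom_def',
    Category.assoc] at key
  have e : powPerm P (shuffle n m).symm ≫ powSplit P n m ≫ (β_ _ _).hom = powSplit P m n := by
    rw [← powPerm_shuffle, reassoc_of% powPerm_powPerm P, Equiv.symm_trans_self, powPerm_refl,
      Category.id_comp]
  have e' : (β_ (F.seq.obj ⟨m⟩) (F.seq.obj ⟨n⟩)).hom ≫ F.mul n m ≫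
      F.seq.map (FinBij.of (shuffle n m)) = F.mul m n := by
    rw [F.mul_comm, SymmetricCategory.symmetry_assoc]
  rw [tensor, tensor]
  simp only [perm, Category.assoc, whisker_exchange_assoc]
  rw [reassoc_of% key]
  simp only [whisker_exchange_assoc]
  simp only [← whiskerLeft_comp_assoc, ← MonoidalCategory.whiskerLeft_comp]
  rw [e, e']

theorem tensor_ofHom_ofHom (f : X ⟶ X') (g : Y ⟶ Y') :
    tensor (ofHom P F f) (ofHom P F g) = ofHom P F (f ⊗ₘ g) := by
  have key : ∀ {K₀ : C} (u : 𝟙_ C ⟶ K₀) (m : K₀ ⊗ K₀ ⟶ K₀) (_ : (ρ_ K₀).inv ≫ K₀ ◁ u ≫ m = 𝟙 _),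
      (X ⊗ Y) ◁ (ρ_ (𝟙_ C)).inv ≫ paramTensor (f ▷ 𝟙_ C ≫ X' ◁ u) (g ▷ 𝟙_ C ≫ Y' ◁ u) ≫
        (X' ⊗ Y') ◁ m = (f ⊗ₘ g) ▷ 𝟙_ C ≫ (X' ⊗ Y') ◁ u := by
    intro K₀ u m e
    have e' := paramTensor_naturality (f ▷ 𝟙_ C) (g ▷ 𝟙_ C) (𝟙 _) (𝟙 _) u u
    simp only [MonoidalCategory.whiskerLeft_id, Category.id_comp, id_tensorHom_id] at e'
    have e2 : (ρ_ (𝟙_ C)).inv ≫ (u ⊗ₘ u) ≫ m = u := by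
      rw [MonoidalCategory.tensorHom_def, Category.assoc, ← rightUnitor_inv_naturality_assoc, e,
        Category.comp_id]
    rw [e', paramTensor_whiskerRight, Category.assoc, whisker_exchange_assoc,
      ← MonoidalCategory.whiskerLeft_comp, ← MonoidalCategory.whiskerLeft_comp, e2]
  exact key F.one (F.mul 0 0) (F.mul_one 0)

theorem unit_tensor (f : GrHom P F X Y n) :
    tensor (ofHom P F (𝟙 (𝟙_ C))) f ≫ (λ_ Y).hom ▷ F.seq.obj ⟨0 + n⟩ =
      perm (finCongr (Nat.zero_add n).symm) ((λ_ X).hom ▷ powObj P n ≫ f) := by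
  have key : ∀ {G G' K K₀ K' : C} (f : X ⊗ G ⟶ Y ⊗ K) (u : 𝟙_ C ⟶ K₀) (m : K₀ ⊗ K ⟶ K')
      (a : G' ⟶ G) (b : K ⟶ K') (_ : (λ_ K).inv ≫ u ▷ K ≫ m = b),
      ((𝟙_ C ⊗ X) ◁ (a ≫ (λ_ G).inv) ≫ paramTensor (𝟙 (𝟙_ C) ▷ 𝟙_ C ≫ 𝟙_ C ◁ u) f ≫
        (𝟙_ C ⊗ Y) ◁ m) ≫ (λ_ Y).hom ▷ K' =
        (𝟙_ C ⊗ X) ◁ a ≫ ((λ_ X).hom ▷ G ≫ f) ≫ Y ◁ b := by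
    intro G G' K K₀ K' f u m a b e
    have e' := paramTensor_left_naturality (𝟙 (𝟙_ C ⊗ 𝟙_ C)) f (𝟙 _) u
    simp only [MonoidalCategory.whiskerLeft_id, Category.id_comp] at e'
    have e2 := unit_paramTensor f
    rw [← cancel_mono (Y ◁ (λ_ K).inv), Category.assoc, MonoidalCategory.tensorHom_def,
      Category.assoc, ← MonoidalCategory.whiskerLeft_comp, Iso.hom_inv_id,
      MonoidalCategory.whiskerLeft_id, Category.comp_id, MonoidalCategory.tensorHom_def',
      Category.assoc] at e2
    rw [id_whiskerRight, Category.id_comp, e', id_whiskerRight, MonoidalCategory.whiskerLeft_id,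
      Category.id_comp, Category.assoc, Category.assoc, Category.assoc,
      whisker_exchange, whisker_exchange_assoc, reassoc_of% e2]
    simp only [← MonoidalCategory.whiskerLeft_comp]
    rw [e, ← whiskerLeft_comp_assoc, Category.assoc, Iso.inv_hom_id,
      Category.comp_id, Category.assoc]
  have e := key f F.one (F.mul 0 n) (powPerm P (finCongr (Nat.zero_add n))) _ (F.one_mul n)
  refine Eq.trans ?_ e
  exact congrArg (fun z => ((𝟙_ C ⊗ X) ◁ z ≫ paramTensor (ofHom P F (𝟙 (𝟙_ C))) f ≫
    (𝟙_ C ⊗ Y) ◁ F.mul 0 n) ≫ (λ_ Y).hom ▷ F.seq.obj ⟨0 + n⟩) (powSplit_zero_left P n)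

theorem tensor_unit (f : GrHom P F X Y n) :
    tensor f (ofHom P F (𝟙 (𝟙_ C))) ≫ (ρ_ Y).hom ▷ F.seq.obj ⟨n⟩ =
      (ρ_ X).hom ▷ powObj P n ≫ f := by
  have key : ∀ {G K K₀ : C} (f : X ⊗ G ⟶ Y ⊗ K) (u : 𝟙_ C ⟶ K₀) (m : K ⊗ K₀ ⟶ K)
      (_ : (ρ_ K).inv ≫ K ◁ u ≫ m = 𝟙 K),
      ((X ⊗ 𝟙_ C) ◁ (ρ_ G).inv ≫ paramTensor f (𝟙 (𝟙_ C) ▷ 𝟙_ C ≫ 𝟙_ C ◁ u) ≫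
        (Y ⊗ 𝟙_ C) ◁ m) ≫ (ρ_ Y).hom ▷ K = (ρ_ X).hom ▷ G ≫ f := by
    intro G K K₀ f u m e
    have e' := paramTensor_right_naturality f (𝟙 (𝟙_ C ⊗ 𝟙_ C)) (𝟙 _) u
    simp only [MonoidalCategory.whiskerLeft_id, Category.id_comp] at e'
    have e2 := paramTensor_unit f
    rw [← cancel_mono (Y ◁ (ρ_ K).inv), Category.assoc, MonoidalCategory.tensorHom_def,
      Category.assoc, ← MonoidalCategory.whiskerLeft_comp, Iso.hom_inv_id,
      MonoidalCategory.whiskerLeft_id, Category.comp_id, MonoidalCategory.tensorHom_def',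
      Category.assoc] at e2
    rw [id_whiskerRight, Category.id_comp, e', Category.assoc, Category.assoc, Category.assoc,
      whisker_exchange, whisker_exchange_assoc, reassoc_of% e2]
    simp only [← whiskerLeft_comp_assoc, ← MonoidalCategory.whiskerLeft_comp]
    rw [e]
    simp
  exact key f F.one (F.mul n 0) (F.mul_one n)

theorem scalar_smul (r : powObj P n ⟶ F.seq.obj ⟨n⟩) (s : powObj P m ⟶ F.seq.obj ⟨m⟩) :
    scalar X (smul r s) = comp (scalar X r) (scalar X s) := by
  have e := associator_naturality (𝟙 X) r s
  rw [id_tensorHom, id_tensorHom] at e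
  rw [scalar, scalar, comp, scalar, paramComp_whiskerLeft, smul, e]
  simp only [MonoidalCategory.whiskerLeft_comp, Iso.inv_hom_id_assoc]

/-- Scalars are central, because `P^{∧n}` is cocommutative and `F` is commutative. -/
theorem scalar_comp (r : powObj P n ⟶ F.seq.obj ⟨n⟩) (f : GrHom P F X Y m) :
    comp (scalar X r) f = perm (shuffle m n) (comp f (scalar Y r)) := by
  have e : powPerm P (shuffle m n).symm ≫ powSplit P m n = powSplit P n m ≫ (β_ _ _).hom := by
    rw [← powPerm_shuffle]
    rfl
  rw [comp, scalar, whiskerLeft_paramComp]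
  simp only [comp, perm, scalar, Category.assoc]
  simp only [← whiskerLeft_comp_assoc, ← MonoidalCategory.whiskerLeft_comp]
  rw [e, F.mul_comm]

theorem tensor_scalar_scalar (r : powObj P n ⟶ F.seq.obj ⟨n⟩) (s : powObj P m ⟶ F.seq.obj ⟨m⟩) :
    tensor (scalar X r) (scalar Y s) = scalar (X ⊗ Y) (smul r s) := by
  rw [scalar, scalar, tensor, paramTensor_whiskerLeft, scalar, smul]
  simp only [MonoidalCategory.whiskerLeft_comp]

/-- The unit scalar. -/
def one (P : C) (F : CommGrMon C) : powObj P 0 ⟶ F.seq.obj ⟨0⟩ := F.one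

theorem ofHom_id (X : C) : ofHom P F (𝟙 X) = scalar X (one P F) := by
  rw [ofHom, id_whiskerRight]
  exact Category.id_comp _

theorem smul_one (r : powObj P n ⟶ F.seq.obj ⟨n⟩) : smul r (one P F) = r := by
  have key : ∀ {G K K₀ : C} (r : G ⟶ K) (u : 𝟙_ C ⟶ K₀) (m : K ⊗ K₀ ⟶ K)
      (_ : (ρ_ K).inv ≫ K ◁ u ≫ m = 𝟙 K), (ρ_ G).inv ≫ (r ⊗ₘ u) ≫ m = r := by
    intro G K K₀ r u m e
    rw [MonoidalCategory.tensorHom_def, Category.assoc, ← rightUnitor_inv_naturality_assoc, e,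
      Category.comp_id]
  exact key r F.one (F.mul n 0) (F.mul_one n)

theorem one_smul (r : powObj P n ⟶ F.seq.obj ⟨n⟩) : smul (one P F) r =
    powPerm P (finCongr (Nat.zero_add n)) ≫ r ≫
      F.seq.map (FinBij.of (finCongr (Nat.zero_add n).symm)) := by
  have key : ∀ {G G' K K₀ K' : C} (r : G ⟶ K) (u : 𝟙_ C ⟶ K₀) (m : K₀ ⊗ K ⟶ K')
      (a : G' ⟶ G) (b : K ⟶ K') (_ : (λ_ K).inv ≫ u ▷ K ≫ m = b),
      (a ≫ (λ_ G).inv) ≫ (u ⊗ₘ r) ≫ m = a ≫ r ≫ b := by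
    intro G G' K K₀ K' r u m a b e
    rw [MonoidalCategory.tensorHom_def', Category.assoc, Category.assoc,
      ← leftUnitor_inv_naturality_assoc, e]
  refine Eq.trans ?_ (key r F.one (F.mul 0 n) _ _ (F.one_mul n))
  exact congrArg (fun z => z ≫ (F.one ⊗ₘ r) ≫ F.mul 0 n) (powSplit_zero_left P n)

theorem smul_perm (e : Fin n ≃ Fin n') (e' : Fin m ≃ Fin m') (r : powObj P n ⟶ F.seq.obj ⟨n⟩)
    (s : powObj P m ⟶ F.seq.obj ⟨m⟩) :
    smul (powPerm P e.symm ≫ r ≫ F.seq.map (FinBij.of e))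
        (powPerm P e'.symm ≫ s ≫ F.seq.map (FinBij.of e')) =
      powPerm P (blockSum e e').symm ≫ smul r s ≫ F.seq.map (FinBij.of (blockSum e e')) := by
  simp only [smul, ← tensorHom_comp_tensorHom, Category.assoc, F.mul_perm]
  rw [← reassoc_of% powSplit_blockSum_symm]

theorem smul_assoc (r : powObj P n ⟶ F.seq.obj ⟨n⟩) (s : powObj P m ⟶ F.seq.obj ⟨m⟩)
    (t : powObj P p ⟶ F.seq.obj ⟨p⟩) :
    powPerm P (finCongr (Nat.add_assoc n m p)).symm ≫ smul (smul r s) t ≫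
        F.seq.map (FinBij.of (finCongr (Nat.add_assoc n m p))) = smul r (smul s t) := by
  have e1 : (smul r s ⊗ₘ t) = powSplit P n m ▷ powObj P p ≫ ((r ⊗ₘ s) ⊗ₘ t) ≫
      F.mul n m ▷ F.seq.obj ⟨p⟩ := by
    simp only [smul, ← tensorHom_id, tensorHom_comp_tensorHom, Category.id_comp, Category.comp_id]
  have e2 : (r ⊗ₘ smul s t) = powObj P n ◁ powSplit P m p ≫ (r ⊗ₘ (s ⊗ₘ t)) ≫
      F.seq.obj ⟨n⟩ ◁ F.mul m p := by
    simp only [smul, ← id_tensorHom, tensorHom_comp_tensorHom, Category.id_comp, Category.comp_id]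
  rw [smul, smul.eq_1 r (smul s t), e1, e2]
  simp only [Category.assoc]
  rw [F.mul_assoc, associator_naturality_assoc, reassoc_of% powSplit_assoc_symm]

theorem smul_comm (r : powObj P n ⟶ F.seq.obj ⟨n⟩) (s : powObj P m ⟶ F.seq.obj ⟨m⟩) :
    powPerm P (shuffle n m).symm ≫ smul r s ≫ F.seq.map (FinBij.of (shuffle n m)) =
      smul s r := by
  have e : powPerm P (shuffle n m).symm ≫ powSplit P n m = powSplit P m n ≫ (β_ _ _).hom := by
    rw [← powPerm_shuffle]
    rfl
  simp only [smul, Category.assoc]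
  rw [F.mul_comm, reassoc_of% e, BraidedCategory.braiding_naturality_assoc,
    SymmetricCategory.symmetry_assoc]

end GrHom
end GrHom

/-! ### The commutative graded monoid of the objects `E n ∧ S^n` -/

section Wedge

variable {C : Type u} [Category.{v} C] [MonoidalCategory C] [SymmetricCategory C]
  [HasFiniteCoproducts C]

@[simp]
theorem wedgeι_map {A B : C} (f : A ⟶ B) {n : ℕ} {k : SimplexCategory} (s : Fin n → Circ k) :
    wedgeι A s ≫ wedgeMap f n k = f ≫ wedgeι B s := wedgeι_desc _ _

@[simp]
theorem wedgeι_map_assoc {A B Z : C} (f : A ⟶ B) {n : ℕ} {k : SimplexCategory}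
    (s : Fin n → Circ k) (h : wedge B n k ⟶ Z) :
    wedgeι A s ≫ wedgeMap f n k ≫ h = f ≫ wedgeι B s ≫ h := by
  rw [← Category.assoc, wedgeι_map, Category.assoc]

@[simp]
theorem wedgeι_perm (A : C) {n m : ℕ} (e : Fin n ≃ Fin m) {k : SimplexCategory}
    (s : Fin n → Circ k) : wedgeι A s ≫ wedgePerm A e k = wedgeι A (s ∘ e.symm) := wedgeι_desc _ _

variable [∀ B : C, PreservesFiniteCoproducts (tensorRight B)]

@[simp]
theorem wedgeι_tensorRight (A B : C) {n : ℕ} {k : SimplexCategory} (s : Fin n → Circ k) :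
    wedgeι A s ▷ B ≫ wedgeTensorRight A B n k = wedgeι (A ⊗ B) s := by
  have h := ι_comp_sigmaComparison (tensorRight B) (fun _ : Fin n → Circ k => A) s
  rw [← PreservesCoproduct.inv_hom] at h
  exact ((Iso.eq_comp_inv _).1 h.symm)

@[simp]
theorem wedgeι_tensorRight_assoc (A B : C) {n : ℕ} {k : SimplexCategory} {Z : C}
    (s : Fin n → Circ k) (h : wedge (A ⊗ B) n k ⟶ Z) :
    wedgeι A s ▷ B ≫ wedgeTensorRight A B n k ≫ h = wedgeι (A ⊗ B) s ≫ h := by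
  rw [← Category.assoc, wedgeι_tensorRight]

theorem wedgeTensorRight_isIso (A B : C) (n : ℕ) (k : SimplexCategory) :
    IsIso (wedgeTensorRight A B n k) :=
  (PreservesCoproduct.iso (tensorRight B) fun _ : Fin n → Circ k => A).isIso_hom

@[simp]
theorem wedgeι_tensorLeft (A B : C) {n : ℕ} {k : SimplexCategory} (s : Fin n → Circ k) :
    A ◁ wedgeι B s ≫ wedgeTensorLeft A B n k = wedgeι (A ⊗ B) s := by
  simp [wedgeTensorLeft]

@[simp]
theorem wedgeι_tensorLeft_assoc (A B : C) {n : ℕ} {k : SimplexCategory} {Z : C}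
    (s : Fin n → Circ k) (h : wedge (A ⊗ B) n k ⟶ Z) :
    A ◁ wedgeι B s ≫ wedgeTensorLeft A B n k ≫ h = wedgeι (A ⊗ B) s ≫ h := by
  rw [← Category.assoc, wedgeι_tensorLeft]

/-- Smashing with `A` on the left distributes over `S^n`: by symmetry this follows from
distributivity on the right. -/
instance wedgeTensorLeft_isIso (A B : C) (n : ℕ) (k : SimplexCategory) :
    IsIso (wedgeTensorLeft A B n k) := by
  have := wedgeTensorRight_isIso B A n k
  have : IsIso (wedgeMap (β_ B A).hom n k) :=
    ⟨wedgeMap (β_ A B).hom n k, by simp [← wedgeMap_comp, wedgeMap_id],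
      by simp [← wedgeMap_comp, wedgeMap_id]⟩
  unfold wedgeTensorLeft
  infer_instance

theorem wedge_whiskerRight_ext {A B Z : C} {n : ℕ} {k : SimplexCategory} {f g : wedge A n k ⊗ B ⟶ Z}
    (h : ∀ s, wedgeι A s ▷ B ≫ f = wedgeι A s ▷ B ≫ g) : f = g := by
  have := wedgeTensorRight_isIso A B n k
  rw [← cancel_epi (inv (wedgeTensorRight A B n k))]
  refine wedge_ext fun s => ?_
  have e : wedgeι (A ⊗ B) s ≫ inv (wedgeTensorRight A B n k) = wedgeι A s ▷ B := by
    rw [IsIso.comp_inv_eq, wedgeι_tensorRight]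
  rw [reassoc_of% e, reassoc_of% e, h]

theorem wedge_whiskerLeft_ext {A B Z : C} {n : ℕ} {k : SimplexCategory} {f g : B ⊗ wedge A n k ⟶ Z}
    (h : ∀ s, B ◁ wedgeι A s ≫ f = B ◁ wedgeι A s ≫ g) : f = g := by
  rw [← cancel_epi (β_ _ _).hom]
  refine wedge_whiskerRight_ext fun s => ?_
  rw [BraidedCategory.braiding_naturality_left_assoc, h,
    ← BraidedCategory.braiding_naturality_left_assoc]

theorem wedge_tensor_ext {A B Z : C} {n m : ℕ} {k : SimplexCategory}
    {f g : wedge A n k ⊗ wedge B m k ⟶ Z}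
    (h : ∀ s t, (wedgeι A s ⊗ₘ wedgeι B t) ≫ f = (wedgeι A s ⊗ₘ wedgeι B t) ≫ g) : f = g := by
  refine wedge_whiskerRight_ext fun s => wedge_whiskerLeft_ext fun t => ?_
  simpa [MonoidalCategory.tensorHom_def'] using h s t

theorem wedge_whiskerLeft_whiskerRight_ext {A B D Z : C} {m : ℕ} {k : SimplexCategory}
    {f g : (A ⊗ wedge B m k) ⊗ D ⟶ Z}
    (h : ∀ s, (A ◁ wedgeι B s) ▷ D ≫ f = (A ◁ wedgeι B s) ▷ D ≫ g) : f = g := by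
  rw [← cancel_epi ((β_ _ _).hom ▷ D), ← cancel_epi (α_ _ _ _).inv]
  refine wedge_whiskerRight_ext fun s => ?_
  rw [associator_inv_naturality_left_assoc, associator_inv_naturality_left_assoc,
    ← comp_whiskerRight_assoc, ← comp_whiskerRight_assoc,
    BraidedCategory.braiding_naturality_left, comp_whiskerRight_assoc, comp_whiskerRight_assoc, h]

theorem wedge_tensor_tensor_ext {A B D Z : C} {n m p : ℕ} {k : SimplexCategory}
    {f g : (wedge A n k ⊗ wedge B m k) ⊗ wedge D p k ⟶ Z}
    (h : ∀ s t r, ((wedgeι A s ⊗ₘ wedgeι B t) ⊗ₘ wedgeι D r) ≫ f =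
      ((wedgeι A s ⊗ₘ wedgeι B t) ⊗ₘ wedgeι D r) ≫ g) : f = g := by
  have left : ∀ {B D : C} {f g : (wedge A n k ⊗ B) ⊗ D ⟶ Z},
      (∀ s, (wedgeι A s ▷ B) ▷ D ≫ f = (wedgeι A s ▷ B) ▷ D ≫ g) → f = g := by
    intro B D f g h
    rw [← cancel_epi (α_ _ _ _).inv]
    refine wedge_whiskerRight_ext fun s => ?_
    rw [associator_inv_naturality_left_assoc, associator_inv_naturality_left_assoc, h]
  refine wedge_whiskerLeft_ext fun r => left fun s =>
    wedge_whiskerLeft_whiskerRight_ext fun t => ?_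
  have e : ((wedgeι A s ⊗ₘ wedgeι B t) ⊗ₘ wedgeι D r) = (A ◁ wedgeι B t) ▷ D ≫
      (wedgeι A s ▷ wedge B m k) ▷ D ≫ (wedge A n k ⊗ wedge B m k) ◁ wedgeι D r := by
    rw [MonoidalCategory.tensorHom_def, MonoidalCategory.tensorHom_def', comp_whiskerRight_assoc]
  have e' := h s t r
  rw [e] at e'
  simpa only [Category.assoc] using e'

/-- The canonical isomorphism `(X ∧ S^n) ∧ (Y ∧ S^m) ≅ (X ∧ Y) ∧ S^{n+m}`. -/
def wedgeMul (X Y : C) (n m : ℕ) (k : SimplexCategory) :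
    wedge X n k ⊗ wedge Y m k ⟶ wedge (X ⊗ Y) (n + m) k :=
  wedgeTensorRight X (wedge Y m k) n k ≫ wedgeMap (wedgeTensorLeft X Y m k) n k ≫
    wedgeFlatten (X ⊗ Y) n m k

theorem smashMaps_eq {A B X Y : C} {n m : ℕ} {k : SimplexCategory} (f : A ⟶ wedge X n k)
    (g : B ⟶ wedge Y m k) : smashMaps f g = (f ⊗ₘ g) ≫ wedgeMul X Y n m k := rfl

@[simp]
theorem wedgeι_mul (X Y : C) {n m : ℕ} {k : SimplexCategory} (s : Fin n → Circ k)
    (t : Fin m → Circ k) :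
    (wedgeι X s ⊗ₘ wedgeι Y t) ≫ wedgeMul X Y n m k = wedgeι (X ⊗ Y) (Fin.append s t) := by
  simp [wedgeMul, MonoidalCategory.tensorHom_def', wedgeFlatten]

@[simp]
theorem wedgeι_mul_assoc (X Y : C) {n m : ℕ} {k : SimplexCategory} {Z : C} (s : Fin n → Circ k)
    (t : Fin m → Circ k) (h : wedge (X ⊗ Y) (n + m) k ⟶ Z) :
    (wedgeι X s ⊗ₘ wedgeι Y t) ≫ wedgeMul X Y n m k ≫ h =
      wedgeι (X ⊗ Y) (Fin.append s t) ≫ h := by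
  rw [← Category.assoc, wedgeι_mul]

theorem append_comp_blockSum_symm {n n' m m' : ℕ} {T : Type w} (e : Fin n ≃ Fin n')
    (f : Fin m ≃ Fin m') (s : Fin n → T) (t : Fin m → T) :
    Fin.append s t ∘ (blockSum e f).symm = Fin.append (s ∘ e.symm) (t ∘ f.symm) := by
  rw [Equiv.comp_symm_eq]
  funext i
  refine Fin.addCases (fun i => ?_) (fun i => ?_) i <;> simp

theorem append_comp_shuffle_symm {n m : ℕ} {T : Type w} (s : Fin n → T) (t : Fin m → T) :
    Fin.append s t ∘ (shuffle n m).symm = Fin.append t s := by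
  rw [Equiv.comp_symm_eq]
  funext i
  refine Fin.addCases (fun i => ?_) (fun i => ?_) i <;> simp

theorem append_append_comp_assoc_symm {n m p : ℕ} {T : Type w} (s : Fin n → T) (t : Fin m → T)
    (r : Fin p → T) : Fin.append (Fin.append s t) r ∘ (finCongr (Nat.add_assoc n m p)).symm =
      Fin.append s (Fin.append t r) := by
  rw [Equiv.comp_symm_eq]
  funext i
  refine Fin.addCases (fun i => Fin.addCases (fun i => ?_) (fun i => ?_) i) (fun i => ?_) i <;> simp

theorem append_zero_left {n : ℕ} {T : Type w} (t : Fin 0 → T) (s : Fin n → T) :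
    Fin.append t s = s ∘ (finCongr (Nat.zero_add n).symm).symm := by
  funext i
  refine Fin.addCases (fun i => i.elim0) (fun i => ?_) i
  rw [Fin.append_right]
  exact congrArg s (Fin.ext (Nat.zero_add _).symm)

theorem append_zero_right {n : ℕ} {T : Type w} (t : Fin 0 → T) (s : Fin n → T) :
    Fin.append s t = s := by
  funext i
  refine Fin.addCases (fun i => ?_) (fun i => i.elim0) i
  rw [Fin.append_left]
  rfl

variable {T : C} (E : SymRingTSpectrum T)

/-- General bijections of block sums are compatible with the multiplication. -/
theorem SymRingTSpectrum.mul_perm' {n n' m m' : ℕ} (e : Fin n ≃ Fin n') (f : Fin m ≃ Fin m') :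
    (E.seq.map (FinBij.of e) ⊗ₘ E.seq.map (FinBij.of f)) ≫ E.mul n' m' =
      E.mul n m ≫ E.seq.map (FinBij.of (blockSum e f)) := by
  obtain rfl : n = n' := by simpa using (Fintype.card_congr e)
  obtain rfl : m = m' := by simpa using (Fintype.card_congr f)
  exact E.mul_perm e f

/-- The symmetric sequence `n ↦ E n ∧ S^n`, in simplicial degree `k`. -/
def wedgeSeq (k : SimplexCategory) : FinBij ⥤ C where
  obj a := wedge (E.seq.obj a) a.card k
  map {a b} e := wedgeMap (E.seq.map e) a.card k ≫ wedgePerm (E.seq.obj b) e k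
  map_id a := by
    rw [E.seq.map_id, wedgeMap_id, Category.id_comp]
    exact wedgePerm_refl _ _ _
  map_comp {a b c} e f := by
    have h : wedgePerm (E.seq.obj c) (e ≫ f) k =
      wedgePerm (E.seq.obj c) e k ≫ wedgePerm (E.seq.obj c) f k := wedgePerm_trans _ _ _ _
    rw [E.seq.map_comp, wedgeMap_comp, h]
    simp only [Category.assoc]
    rw [← reassoc_of% (wedgeMap_perm (E.seq.map f) e k)]

/-- The action of bijections on `E n ∧ S^n`, through both factors. -/
def wedgeAct {n m : ℕ} (e : Fin n ≃ Fin m) (k : SimplexCategory) :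
    wedge (E.seq.obj ⟨n⟩) n k ⟶ wedge (E.seq.obj ⟨m⟩) m k :=
  wedgeMap (E.seq.map (FinBij.of e)) n k ≫ wedgePerm (E.seq.obj ⟨m⟩) e k

@[simp]
theorem wedgeι_act {n m : ℕ} (e : Fin n ≃ Fin m) {k : SimplexCategory} (s : Fin n → Circ k) :
    wedgeι (E.seq.obj ⟨n⟩) s ≫ wedgeAct E e k =
      E.seq.map (FinBij.of e) ≫ wedgeι (E.seq.obj ⟨m⟩) (s ∘ e.symm) := by
  simp [wedgeAct]

/-- The multiplication of the graded monoid `n ↦ E n ∧ S^n`. -/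
def wedgeRingMul (n m : ℕ) (k : SimplexCategory) :
    wedge (E.seq.obj ⟨n⟩) n k ⊗ wedge (E.seq.obj ⟨m⟩) m k ⟶ wedge (E.seq.obj ⟨n + m⟩) (n + m) k :=
  wedgeMul _ _ n m k ≫ wedgeMap (E.mul n m) (n + m) k

theorem wedgeι_ringMul {n m : ℕ} {k : SimplexCategory} (s : Fin n → Circ k) (t : Fin m → Circ k) :
    (wedgeι _ s ⊗ₘ wedgeι _ t) ≫ wedgeRingMul E n m k =
      E.mul n m ≫ wedgeι _ (Fin.append s t) := by
  simp [wedgeRingMul]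

theorem wedgeRingMul_perm {n n' m m' : ℕ} (e : Fin n ≃ Fin n') (f : Fin m ≃ Fin m')
    (k : SimplexCategory) : (wedgeAct E e k ⊗ₘ wedgeAct E f k) ≫ wedgeRingMul E n' m' k =
      wedgeRingMul E n m k ≫ wedgeAct E (blockSum e f) k := by
  refine wedge_tensor_ext fun s t => ?_
  rw [tensorHom_comp_tensorHom_assoc, wedgeι_act, wedgeι_act, ← tensorHom_comp_tensorHom_assoc,
    wedgeι_ringMul, reassoc_of% wedgeι_ringMul E s t, reassoc_of% E.mul_perm' e f, wedgeι_act,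
    append_comp_blockSum_symm]

theorem wedgeRingMul_assoc (n m p : ℕ) (k : SimplexCategory) :
    wedgeRingMul E n m k ▷ wedge (E.seq.obj ⟨p⟩) p k ≫ wedgeRingMul E (n + m) p k ≫
        wedgeAct E (finCongr (Nat.add_assoc n m p)) k =
      (α_ _ _ _).hom ≫ wedge (E.seq.obj ⟨n⟩) n k ◁ wedgeRingMul E m p k ≫
        wedgeRingMul E n (m + p) k := by
  have e1 : ∀ {A A' B B' Z Z' W : C} (a : A ⟶ A') (b : B ⟶ B') (f : Z ⟶ Z') (g : A' ⊗ B' ⟶ W),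
      ((a ⊗ₘ b) ⊗ₘ f) ≫ g ▷ Z' = ((a ⊗ₘ b) ≫ g) ⊗ₘ f := by
    intros
    rw [← tensorHom_id, tensorHom_comp_tensorHom, Category.comp_id]
  have e2 : ∀ {A A' B B' Z Z' W : C} (a : A ⟶ A') (b : B ⟶ B') (f : Z ⟶ Z') (g : A' ⊗ B' ⟶ W),
      (f ⊗ₘ (a ⊗ₘ b)) ≫ Z' ◁ g = f ⊗ₘ ((a ⊗ₘ b) ≫ g) := by
    intros
    rw [← id_tensorHom, tensorHom_comp_tensorHom, Category.comp_id]
  have h : ∀ (s : Fin n → Circ k) (t : Fin m → Circ k) (r : Fin p → Circ k),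
      ((wedgeι (E.seq.obj ⟨n⟩) s ⊗ₘ wedgeι (E.seq.obj ⟨m⟩) t) ⊗ₘ wedgeι (E.seq.obj ⟨p⟩) r) ≫
        wedgeRingMul E n m k ▷ wedge (E.seq.obj ⟨p⟩) p k ≫ wedgeRingMul E (n + m) p k ≫
          wedgeAct E (finCongr (Nat.add_assoc n m p)) k =
      ((wedgeι (E.seq.obj ⟨n⟩) s ⊗ₘ wedgeι (E.seq.obj ⟨m⟩) t) ⊗ₘ wedgeι (E.seq.obj ⟨p⟩) r) ≫
        (α_ _ _ _).hom ≫ wedge (E.seq.obj ⟨n⟩) n k ◁ wedgeRingMul E m p k ≫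
          wedgeRingMul E n (m + p) k := by
    intro s t r
    have e3 : ((wedgeι _ s ⊗ₘ wedgeι _ t) ≫ wedgeRingMul E n m k) ⊗ₘ wedgeι (E.seq.obj ⟨p⟩) r =
        E.mul n m ▷ _ ≫ (wedgeι _ (Fin.append s t) ⊗ₘ wedgeι _ r) := by
      rw [wedgeι_ringMul, ← tensorHom_id, tensorHom_comp_tensorHom, Category.id_comp]
    have e4 : wedgeι (E.seq.obj ⟨n⟩) s ⊗ₘ ((wedgeι _ t ⊗ₘ wedgeι _ r) ≫ wedgeRingMul E m p k) =
        _ ◁ E.mul m p ≫ (wedgeι _ s ⊗ₘ wedgeι _ (Fin.append t r)) := by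
      rw [wedgeι_ringMul, ← id_tensorHom, tensorHom_comp_tensorHom, Category.id_comp]
    rw [reassoc_of% e1, e3, associator_naturality_assoc, reassoc_of% e2, e4]
    simp only [Category.assoc]
    rw [reassoc_of% wedgeι_ringMul E (Fin.append s t) r, wedgeι_ringMul, wedgeι_act,
      reassoc_of% E.mul_assoc n m p, append_append_comp_assoc_symm]
  exact wedge_tensor_tensor_ext h

theorem wedgeRingMul_one (n : ℕ) (k : SimplexCategory) :
    (ρ_ (wedge (E.seq.obj ⟨n⟩) n k)).inv ≫ wedge (E.seq.obj ⟨n⟩) n k ◁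
      (E.one₀ ≫ wedgeι (E.seq.obj ⟨0⟩) (fun i => i.elim0)) ≫ wedgeRingMul E n 0 k = 𝟙 _ := by
  refine wedge_ext fun s => ?_
  have h := congrArg (· ≫ wedgeι (E.seq.obj ⟨n⟩) s) (E.mul_one n)
  simp only [Category.assoc, Category.id_comp] at h
  rw [rightUnitor_inv_naturality_assoc, ← whisker_exchange_assoc,
    MonoidalCategory.whiskerLeft_comp, Category.assoc, ← MonoidalCategory.tensorHom_def'_assoc,
    wedgeι_ringMul, append_zero_right]
  exact h.trans (Category.comp_id _).symm

theorem one_wedgeRingMul (n : ℕ) (k : SimplexCategory) :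
    (λ_ (wedge (E.seq.obj ⟨n⟩) n k)).inv ≫
      (E.one₀ ≫ wedgeι (E.seq.obj ⟨0⟩) (fun i => i.elim0)) ▷ wedge (E.seq.obj ⟨n⟩) n k ≫
        wedgeRingMul E 0 n k = wedgeAct E (finCongr (Nat.zero_add n).symm) k := by
  refine wedge_ext fun s => ?_
  rw [leftUnitor_inv_naturality_assoc, whisker_exchange_assoc,
    comp_whiskerRight, Category.assoc, ← MonoidalCategory.tensorHom_def_assoc,
    wedgeι_ringMul, append_zero_left, reassoc_of% E.one_mul n, wedgeι_act]

/-- On the summand indexed by `(s, t)` the shuffle turns `Fin.append s t` into `Fin.append t s`, so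
commutativity reduces to that of `E`. -/
theorem wedgeRingMul_comm (hE : E.IsCommutative) (n m : ℕ) (k : SimplexCategory) :
    wedgeRingMul E n m k ≫ wedgeAct E (shuffle n m) k = (β_ _ _).hom ≫ wedgeRingMul E m n k := by
  refine wedge_tensor_ext fun s t => ?_
  rw [BraidedCategory.braiding_naturality_assoc, wedgeι_ringMul, reassoc_of% wedgeι_ringMul E s t,
    wedgeι_act, append_comp_shuffle_symm, reassoc_of% hE n m]

/-- The commutative graded monoid `n ↦ E n ∧ S^n`, in simplicial degree `k`. -/
def wedgeMon (hE : E.IsCommutative) (k : SimplexCategory) : CommGrMon C where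
  seq := wedgeSeq E k
  mul n m := wedgeRingMul E n m k
  one := E.one₀ ≫ wedgeι (E.seq.obj ⟨0⟩) (fun i => i.elim0)
  mul_perm e f := wedgeRingMul_perm E e f k
  mul_assoc n m p := wedgeRingMul_assoc E n m p k
  mul_one n := wedgeRingMul_one E n k
  one_mul n := one_wedgeRingMul E n k
  mul_comm n m := wedgeRingMul_comm E hE n m k

end Wedge

/-! ### Correspondences as graded parametrised morphisms -/

section CorrGr

variable {C : Type u} [Category.{v} C] [MonoidalCategory C] [SymmetricCategory C]
  [HasFiniteCoproducts C] [∀ B : C, PreservesFiniteCoproducts (tensorRight B)]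

section Zero

variable [HasZeroObject C] [HasZeroMorphisms C]

/-- Zero morphisms factor through the initial object, which the functor `- ∧ Z` preserves. -/
theorem zero_whiskerRight' (X Y Z : C) : (0 : X ⟶ Y) ▷ Z = 0 := by
  have h : IsInitial ((tensorRight Z).obj (⊥_ C)) :=
    IsInitial.isInitialObj (tensorRight Z) _ initialIsInitial
  have e : (0 : X ⟶ Y) = (0 : X ⟶ ⊥_ C) ≫ (0 : ⊥_ C ⟶ Y) := by simp
  rw [e, comp_whiskerRight, h.hom_ext ((0 : ⊥_ C ⟶ Y) ▷ Z) 0, comp_zero]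

theorem whiskerLeft_zero' (X Y Z : C) : Z ◁ (0 : X ⟶ Y) = 0 := by
  rw [← cancel_mono (β_ _ _).hom, BraidedCategory.braiding_naturality_right, zero_whiskerRight',
    comp_zero, zero_comp]

theorem zero_tensorHom' {X Y Z W : C} (f : Z ⟶ W) : (0 : X ⟶ Y) ⊗ₘ f = 0 := by
  rw [MonoidalCategory.tensorHom_def, zero_whiskerRight', zero_comp]

theorem tensorHom_zero' {X Y Z W : C} (f : Z ⟶ W) : f ⊗ₘ (0 : X ⟶ Y) = 0 := by
  rw [MonoidalCategory.tensorHom_def, whiskerLeft_zero', comp_zero]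

open Classical in
theorem wedgeι_res (A : C) {n : ℕ} {k l : SimplexCategory} (f : k ⟶ l) (s : Fin n → Circ l) :
    wedgeι A s ≫ wedgeRes A n f =
      if h : ∀ i, Function.Surjective (f ≫ (s i).1).toOrderHom then
        wedgeι A fun i => ⟨f ≫ (s i).1, h i⟩
      else 0 := wedgeι_desc _ _

theorem wedgeTensorLeft_res (Y A : C) (n : ℕ) {k l : SimplexCategory} (f : k ⟶ l) :
    wedgeTensorLeft Y A n l ≫ wedgeRes (Y ⊗ A) n f =
      Y ◁ wedgeRes A n f ≫ wedgeTensorLeft Y A n k := by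
  refine wedge_whiskerLeft_ext fun s => ?_
  rw [wedgeι_tensorLeft_assoc, ← whiskerLeft_comp_assoc, wedgeι_res, wedgeι_res]
  split_ifs
  · rw [wedgeι_tensorLeft]
  · rw [whiskerLeft_zero', zero_comp]

theorem wedgeMul_res (X Y : C) (n m : ℕ) {k l : SimplexCategory} (f : k ⟶ l) :
    wedgeMul X Y n m l ≫ wedgeRes (X ⊗ Y) (n + m) f =
      (wedgeRes X n f ⊗ₘ wedgeRes Y m f) ≫ wedgeMul X Y n m k := by
  refine wedge_tensor_ext fun s t => ?_
  rw [wedgeι_mul_assoc, tensorHom_comp_tensorHom_assoc, wedgeι_res, wedgeι_res, wedgeι_res]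
  by_cases hs : ∀ i, Function.Surjective (f ≫ (s i).1).toOrderHom
  · by_cases ht : ∀ i, Function.Surjective (f ≫ (t i).1).toOrderHom
    · have hst : ∀ i, Function.Surjective (f ≫ (Fin.append s t i).1).toOrderHom := by
        rw [Fin.forall_fin_add]
        simpa using ⟨hs, ht⟩
      rw [dif_pos hs, dif_pos ht, dif_pos hst, wedgeι_mul]
      congr 1
      funext i
      refine Fin.addCases (fun i => ?_) (fun i => ?_) i <;> simp
    · rw [dif_neg ht, tensorHom_zero', zero_comp, dif_neg]
      intro h
      exact ht fun i => by simpa using h (Fin.natAdd n i)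
  · rw [dif_neg hs, zero_tensorHom', zero_comp, dif_neg]
    intro h
    exact hs fun i => by simpa using h (Fin.castAdd m i)

end Zero

theorem wedgeTensorLeft_map (Y : C) {A B : C} (f : A ⟶ B) (n : ℕ) (k : SimplexCategory) :
    wedgeTensorLeft Y A n k ≫ wedgeMap (Y ◁ f) n k =
      Y ◁ wedgeMap f n k ≫ wedgeTensorLeft Y B n k := by
  refine wedge_whiskerLeft_ext fun s => ?_
  simp [← whiskerLeft_comp_assoc]

theorem wedgeTensorLeft_map_right {Y Z : C} (g : Y ⟶ Z) (A : C) (n : ℕ) (k : SimplexCategory) :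
    wedgeTensorLeft Y A n k ≫ wedgeMap (g ▷ A) n k =
      g ▷ wedge A n k ≫ wedgeTensorLeft Z A n k := by
  refine wedge_whiskerLeft_ext fun s => ?_
  simp [whisker_exchange_assoc]

theorem wedgeTensorLeft_perm (Y A : C) {n m : ℕ} (e : Fin n ≃ Fin m) (k : SimplexCategory) :
    wedgeTensorLeft Y A n k ≫ wedgePerm (Y ⊗ A) e k =
      Y ◁ wedgePerm A e k ≫ wedgeTensorLeft Y A m k := by
  refine wedge_whiskerLeft_ext fun s => ?_
  simp [← whiskerLeft_comp_assoc]

theorem exists_comp_wedgeTensorLeft {Y A Z : C} {n : ℕ} {k : SimplexCategory}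
    (f : Z ⟶ wedge (Y ⊗ A) n k) : ∃ g, g ≫ wedgeTensorLeft Y A n k = f :=
  ⟨f ≫ inv (wedgeTensorLeft Y A n k), by simp⟩

theorem wedgeι_flatten (A : C) {n m : ℕ} {k : SimplexCategory} (s : Fin n → Circ k)
    (t : Fin m → Circ k) :
    wedgeι A t ≫ wedgeι (wedge A m k) s ≫ wedgeFlatten A n m k = wedgeι A (Fin.append s t) := by
  simp [wedgeFlatten]

theorem whiskerLeft_ringMul {T : C} (E : SymRingTSpectrum T) (Z : C) {n m : ℕ}
    {k : SimplexCategory} (s : Fin n → Circ k) (t : Fin m → Circ k) :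
    (Z ◁ wedgeι (E.seq.obj ⟨n⟩) s ⊗ₘ wedgeι (E.seq.obj ⟨m⟩) t) ≫ (α_ _ _ _).hom ≫
        Z ◁ wedgeRingMul E n m k ≫ wedgeTensorLeft Z (E.seq.obj ⟨n + m⟩) (n + m) k =
      (α_ _ _ _).hom ≫ Z ◁ E.mul n m ≫ wedgeι (Z ⊗ E.seq.obj ⟨n + m⟩) (Fin.append s t) := by
  have h := associator_naturality (𝟙 Z) (wedgeι (E.seq.obj ⟨n⟩) s) (wedgeι (E.seq.obj ⟨m⟩) t)
  rw [id_tensorHom, id_tensorHom] at h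
  rw [reassoc_of% h, ← whiskerLeft_comp_assoc, wedgeι_ringMul, whiskerLeft_comp_assoc,
    wedgeι_tensorLeft]

variable {P T : C} (σ : P ⟶ T) (E : SymRingTSpectrum T) (hE : E.IsCommutative)
  {k l : SimplexCategory}

/-- A graded parametrised morphism `X ∧ P^{∧n} ⟶ Y ∧ (E n ∧ S^n)` as a correspondence. -/
def toCorr {X Y : C} {n : ℕ} (f : GrHom P (wedgeMon E hE k) X Y n) : Corr P E X Y n k :=
  (f : X ⊗ powObj P n ⟶ Y ⊗ wedge (E.seq.obj ⟨n⟩) n k) ≫ wedgeTensorLeft Y (E.seq.obj ⟨n⟩) n k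

/-- As `toCorr` is onto, laws of correspondences may be checked on graded parametrised
morphisms. -/
theorem toCorr_surjective {X Y : C} {n : ℕ} (f : Corr P E X Y n k) : ∃ g, toCorr E hE g = f :=
  exists_comp_wedgeTensorLeft f

variable {X X' Y Y' Z : C} {n m : ℕ}

/-- The composition of correspondences is the convolution of parametrised morphisms; the two sides
are compared on the summands of both spheres. -/
theorem corrComp_eq (f : X ⊗ powObj P n ⟶ Y ⊗ wedge (E.seq.obj ⟨n⟩) n k)
    (g : Y ⊗ powObj P m ⟶ Z ⊗ wedge (E.seq.obj ⟨m⟩) m k) :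
    corrComp E (f ≫ wedgeTensorLeft Y (E.seq.obj ⟨n⟩) n k)
      (g ≫ wedgeTensorLeft Z (E.seq.obj ⟨m⟩) m k) =
    (X ◁ powSplit P n m ≫ paramComp f g ≫ Z ◁ wedgeRingMul E n m k) ≫
      wedgeTensorLeft Z (E.seq.obj ⟨n + m⟩) (n + m) k := by
  simp only [corrComp, paramComp, Category.assoc, comp_whiskerRight]
  congr 3
  refine wedge_whiskerLeft_whiskerRight_ext fun s => ?_
  rw [← comp_whiskerRight_assoc, wedgeι_tensorLeft, wedgeι_tensorRight_assoc, wedgeι_map_assoc,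
    reassoc_of% swapRight_naturality_mid Y (wedgeι (E.seq.obj ⟨n⟩) s) (powObj P m),
    whisker_exchange_assoc,
    reassoc_of% swapRight_naturality_right Z (wedge (E.seq.obj ⟨m⟩) m k)
      (wedgeι (E.seq.obj ⟨n⟩) s), swapRight]
  simp only [Category.assoc]
  congr 4
  refine wedge_whiskerLeft_whiskerRight_ext fun t => ?_
  rw [← comp_whiskerRight_assoc, wedgeι_tensorLeft, wedgeι_tensorRight_assoc, wedgeι_map_assoc,
    wedgeι_flatten,
    reassoc_of% swapRight_naturality_mid Z (wedgeι (E.seq.obj ⟨m⟩) t) (E.seq.obj ⟨n⟩),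
    ← MonoidalCategory.tensorHom_def'_assoc, whiskerLeft_ringMul, swapRight]
  simp

theorem toCorr_comp (f : GrHom P (wedgeMon E hE k) X Y n) (g : GrHom P (wedgeMon E hE k) Y Z m) :
    corrComp E (toCorr E hE f) (toCorr E hE g) = toCorr E hE (GrHom.comp f g) :=
  corrComp_eq E f g

theorem corrTensor_eq (f : X ⊗ powObj P n ⟶ X' ⊗ wedge (E.seq.obj ⟨n⟩) n k)
    (g : Y ⊗ powObj P m ⟶ Y' ⊗ wedge (E.seq.obj ⟨m⟩) m k) :
    corrTensor E (f ≫ wedgeTensorLeft X' (E.seq.obj ⟨n⟩) n k)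
      (g ≫ wedgeTensorLeft Y' (E.seq.obj ⟨m⟩) m k) =
    ((X ⊗ Y) ◁ powSplit P n m ≫ paramTensor f g ≫ (X' ⊗ Y') ◁ wedgeRingMul E n m k) ≫
      wedgeTensorLeft (X' ⊗ Y') (E.seq.obj ⟨n + m⟩) (n + m) k := by
  have e1 : (wedgeTensorLeft X' (E.seq.obj ⟨n⟩) n k ⊗ₘ wedgeTensorLeft Y' (E.seq.obj ⟨m⟩) m k) ≫
      wedgeMul _ _ n m k ≫ wedgeMap (tensorμ X' (E.seq.obj ⟨n⟩) Y' (E.seq.obj ⟨m⟩) ≫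
        (X' ⊗ Y') ◁ E.mul n m) (n + m) k =
      tensorμ _ _ _ _ ≫ (X' ⊗ Y') ◁ wedgeRingMul E n m k ≫ wedgeTensorLeft _ _ _ _ := by
    refine wedge_whiskerLeft_whiskerRight_ext fun s => ?_
    rw [← cancel_epi (α_ _ _ _).hom]
    refine wedge_whiskerLeft_ext fun t => ?_
    have e2 : (X' ◁ wedgeι (E.seq.obj ⟨n⟩) s) ▷ (Y' ⊗ wedge (E.seq.obj ⟨m⟩) m k) ≫
        tensorμ _ _ _ _ = tensorμ _ _ _ _ ≫ (X' ⊗ Y') ◁ (wedgeι (E.seq.obj ⟨n⟩) s ▷ _) := by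
      have := tensorμ_natural_left (𝟙 X') (wedgeι (E.seq.obj ⟨n⟩) s) Y' (wedge (E.seq.obj ⟨m⟩) m k)
      simpa using this
    have e3 : (X' ⊗ E.seq.obj ⟨n⟩) ◁ (Y' ◁ wedgeι (E.seq.obj ⟨m⟩) t) ≫
        tensorμ _ _ _ _ = tensorμ _ _ _ _ ≫ (X' ⊗ Y') ◁ (_ ◁ wedgeι (E.seq.obj ⟨m⟩) t) := by
      have := tensorμ_natural_right X' (E.seq.obj ⟨n⟩) (𝟙 Y') (wedgeι (E.seq.obj ⟨m⟩) t)
      simpa using this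
    rw [associator_naturality_right_assoc, associator_naturality_right_assoc, reassoc_of% e2,
      reassoc_of% e3, ← whiskerLeft_comp_assoc, ← whiskerLeft_comp_assoc, Category.assoc,
      ← MonoidalCategory.tensorHom_def'_assoc, ← MonoidalCategory.tensorHom_def'_assoc,
      wedgeι_ringMul, whiskerLeft_comp_assoc, wedgeι_tensorLeft, tensorHom_comp_tensorHom_assoc]
    simp
  simp only [corrTensor, paramTensor, smashMaps_eq, ← tensorHom_comp_tensorHom, Category.assoc, e1]

theorem toCorr_tensor (f : GrHom P (wedgeMon E hE k) X X' n)
    (g : GrHom P (wedgeMon E hE k) Y Y' m) :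
    corrTensor E (toCorr E hE f) (toCorr E hE g) = toCorr E hE (GrHom.tensor f g) :=
  corrTensor_eq E f g

/-- Acting by `r` is composing with the parametrised identity `Y ◁ r`. -/
theorem corrAct_eq (f : X ⊗ powObj P n ⟶ Y ⊗ wedge (E.seq.obj ⟨n⟩) n k)
    (r : powObj P m ⟶ wedge (E.seq.obj ⟨m⟩) m k) :
    corrAct E (f ≫ wedgeTensorLeft Y (E.seq.obj ⟨n⟩) n k) r =
    (X ◁ powSplit P n m ≫ paramComp f (Y ◁ r) ≫ Y ◁ wedgeRingMul E n m k) ≫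
      wedgeTensorLeft Y (E.seq.obj ⟨n + m⟩) (n + m) k := by
  have e : (wedgeTensorLeft Y (E.seq.obj ⟨n⟩) n k ▷ wedge (E.seq.obj ⟨m⟩) m k) ≫
      wedgeMul _ _ n m k ≫ wedgeMap ((α_ Y (E.seq.obj ⟨n⟩) (E.seq.obj ⟨m⟩)).hom ≫
        Y ◁ E.mul n m) (n + m) k = (α_ _ _ _).hom ≫ Y ◁ wedgeRingMul E n m k ≫
          wedgeTensorLeft _ _ _ _ := by
    refine wedge_whiskerLeft_whiskerRight_ext fun s => wedge_whiskerLeft_ext fun t => ?_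
    have e := whiskerLeft_ringMul E Y s t
    rw [MonoidalCategory.tensorHom_def', Category.assoc] at e
    rw [e, ← comp_whiskerRight_assoc, wedgeι_tensorLeft, ← MonoidalCategory.tensorHom_def'_assoc,
      wedgeι_mul_assoc, wedgeι_map]
    simp
  have e' : (f ≫ wedgeTensorLeft Y (E.seq.obj ⟨n⟩) n k) ⊗ₘ r =
      (f ⊗ₘ r) ≫ wedgeTensorLeft Y (E.seq.obj ⟨n⟩) n k ▷ _ := by
    rw [← tensorHom_id, tensorHom_comp_tensorHom, Category.comp_id]
  simp only [corrAct, smashMaps_eq, paramComp_whiskerLeft, Category.assoc, e, e']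

theorem toCorr_act (f : GrHom P (wedgeMon E hE k) X Y n)
    (r : powObj P m ⟶ wedge (E.seq.obj ⟨m⟩) m k) :
    corrAct E (toCorr E hE f) r =
      toCorr E hE (GrHom.comp f (GrHom.scalar (F := wedgeMon E hE k) Y r)) :=
  corrAct_eq E f r

theorem toCorr_ofHom (f : X ⟶ Y) :
    corrOfHom P E f k = toCorr E hE (GrHom.ofHom P (wedgeMon E hE k) f) := by
  have key : (f ⊗ₘ E.one₀) ≫ wedgeι (Y ⊗ E.seq.obj ⟨0⟩) (fun i => i.elim0) =
      (f ▷ 𝟙_ C ≫ Y ◁ (E.one₀ ≫ wedgeι (E.seq.obj ⟨0⟩) (fun i => i.elim0))) ≫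
        wedgeTensorLeft Y (E.seq.obj ⟨0⟩) 0 k := by
    simp [MonoidalCategory.tensorHom_def]
  exact key

theorem toCorr_whiskerRight (f : GrHom P (wedgeMon E hE k) X Y n) (h : Y ⟶ Z) :
    toCorr E hE (f ≫ h ▷ (wedgeMon E hE k).seq.obj ⟨n⟩ : GrHom P (wedgeMon E hE k) X Z n) =
      toCorr E hE f ≫ wedgeMap (h ▷ E.seq.obj ⟨n⟩) n k := by
  have key : ∀ (f : X ⊗ powObj P n ⟶ Y ⊗ wedge (E.seq.obj ⟨n⟩) n k),
      (f ≫ h ▷ wedge (E.seq.obj ⟨n⟩) n k) ≫ wedgeTensorLeft Z (E.seq.obj ⟨n⟩) n k =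
      (f ≫ wedgeTensorLeft Y (E.seq.obj ⟨n⟩) n k) ≫ wedgeMap (h ▷ E.seq.obj ⟨n⟩) n k := by
    intro f
    rw [Category.assoc, Category.assoc, wedgeTensorLeft_map_right]
  exact key f

variable [HasZeroMorphisms C]

theorem toCorr_perm (e : Fin n ≃ Fin m) (f : GrHom P (wedgeMon E hE k) X Y n) :
    (corrSeq P E X Y).perm e (toCorr E hE f) = toCorr E hE (GrHom.perm e f) := by
  have key : ∀ (f : X ⊗ powObj P n ⟶ Y ⊗ wedge (E.seq.obj ⟨n⟩) n k),
      X ◁ powPerm P e.symm ≫ (f ≫ wedgeTensorLeft Y (E.seq.obj ⟨n⟩) n k) ≫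
        wedgeMap (Y ◁ E.seq.map (FinBij.of e)) n k ≫ wedgePerm (Y ⊗ E.seq.obj ⟨m⟩) e k =
      (X ◁ powPerm P e.symm ≫ f ≫ Y ◁ wedgeAct E e k) ≫
        wedgeTensorLeft Y (E.seq.obj ⟨m⟩) m k := by
    intro f
    simp only [Category.assoc]
    rw [reassoc_of% wedgeTensorLeft_map, wedgeTensorLeft_perm, ← whiskerLeft_comp_assoc]
    rfl
  exact key f

/-- The ring spectrum `1^E` multiplies by convolution from tensor powers of `P` to `E n ∧ S^n`. -/
theorem oneE_mul_eq (r : (oneE σ E).seq.el n k) (s : (oneE σ E).seq.el m k) :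
    (oneE σ E).mul r s = GrHom.smul (P := P) (F := wedgeMon E hE k) (n := n) (m := m) r s := by
  have key : ∀ (r : powObj P n ⟶ wedge (E.seq.obj ⟨n⟩) n k)
      (s : powObj P m ⟶ wedge (E.seq.obj ⟨m⟩) m k),
      powSplit P n m ≫ smashMaps r s ≫ wedgeMap (E.mul n m) (n + m) k =
        powSplit P n m ≫ (r ⊗ₘ s) ≫ wedgeRingMul E n m k := by
    intro r s
    rw [smashMaps_eq, Category.assoc]
    rfl
  exact key r s

variable [HasZeroObject C]

theorem wedgeRingMul_res (n m : ℕ) (f : k ⟶ l) :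
    wedgeRingMul E n m l ≫ wedgeRes (E.seq.obj ⟨n + m⟩) (n + m) f =
      (wedgeRes (E.seq.obj ⟨n⟩) n f ⊗ₘ wedgeRes (E.seq.obj ⟨m⟩) m f) ≫ wedgeRingMul E n m k := by
  rw [wedgeRingMul, Category.assoc, wedgeMap_res, reassoc_of% wedgeMul_res]
  rfl

end CorrGr

/-! ### The ring spectrum `1^E` -/

section Main

variable {C : Type u} [Category.{v} C] [MonoidalCategory C] [SymmetricCategory C]
  [HasFiniteCoproducts C] [∀ B : C, PreservesFiniteCoproducts (tensorRight B)]
  [HasZeroObject C] [HasZeroMorphisms C]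
  {P T : C} (σ : P ⟶ T) (E : SymRingTSpectrum T) (hE : E.IsCommutative)

theorem oneE_isCommutative (hE : E.IsCommutative) : (oneE σ E).IsCommutative := by
  intro n m k r s
  rw [oneE_mul_eq σ E hE, oneE_mul_eq σ E hE]
  exact GrHom.smul_comm (F := wedgeMon E hE k) r s

theorem oneE_isSymRing (hE : E.IsCommutative) : (oneE σ E).IsSymRing where
  pt_mul {n m k} y := by
    rw [oneE_mul_eq σ E hE]
    have key : ∀ (y : powObj P m ⟶ wedge (E.seq.obj ⟨m⟩) m k),
      powSplit P n m ≫ ((0 : powObj P n ⟶ wedge (E.seq.obj ⟨n⟩) n k) ⊗ₘ y) ≫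
        wedgeRingMul E n m k = 0 := by
      intro y
      rw [zero_tensorHom', zero_comp, comp_zero]
    exact key y
  mul_pt {n m k} y := by
    rw [oneE_mul_eq σ E hE]
    have key : ∀ (y : powObj P n ⟶ wedge (E.seq.obj ⟨n⟩) n k),
      powSplit P n m ≫ (y ⊗ₘ (0 : powObj P m ⟶ wedge (E.seq.obj ⟨m⟩) m k)) ≫
        wedgeRingMul E n m k = 0 := by
      intro y
      rw [tensorHom_zero', zero_comp, comp_zero]
    exact key y
  mul_res {n m k l} f x y := by
    rw [oneE_mul_eq σ E hE, oneE_mul_eq σ E hE]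
    have key : ∀ (x : powObj P n ⟶ wedge (E.seq.obj ⟨n⟩) n l)
        (y : powObj P m ⟶ wedge (E.seq.obj ⟨m⟩) m l),
        (powSplit P n m ≫ (x ⊗ₘ y) ≫ wedgeRingMul E n m l) ≫ wedgeRes _ _ f =
        powSplit P n m ≫ ((x ≫ wedgeRes _ _ f) ⊗ₘ (y ≫ wedgeRes _ _ f)) ≫
          wedgeRingMul E n m k := by
      intro x y
      simp only [Category.assoc, wedgeRingMul_res, ← tensorHom_comp_tensorHom]
    exact key x y
  mul_perm {n m k} e f x y := by
    rw [oneE_mul_eq σ E hE, oneE_mul_eq σ E hE]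
    exact GrHom.smul_perm (F := wedgeMon E hE k) e f x y
  mul_assoc {n m p k} x y z := by
    rw [oneE_mul_eq σ E hE, oneE_mul_eq σ E hE, oneE_mul_eq σ E hE, oneE_mul_eq σ E hE]
    exact GrHom.smul_assoc (F := wedgeMon E hE k) x y z
  one₀_res {k l} f := by
    have key : (E.one₀ ≫ wedgeι (E.seq.obj ⟨0⟩) (fun i => i.elim0)) ≫ wedgeRes _ 0 f =
        E.one₀ ≫ wedgeι (E.seq.obj ⟨0⟩) (fun i : Fin 0 => (i.elim0 : Circ k)) := by
      rw [Category.assoc, wedgeι_res, dif_pos fun i => i.elim0]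
      congr 2
      funext i
      exact i.elim0
    exact key
  mul_one {n k} x := by
    rw [oneE_mul_eq σ E hE]
    exact GrHom.smul_one (F := wedgeMon E hE k) x
  one_mul {n k} x := by
    rw [oneE_mul_eq σ E hE]
    exact GrHom.one_smul (F := wedgeMon E hE k) x
  one₁_pt k := rfl
  one₁_res {k l} f s := by
    cases s with
    | none => exact zero_comp
    | some s =>
      have key : ((λ_ P).hom ≫ σ ≫ E.one₁ ≫ wedgeι (E.seq.obj ⟨1⟩) (fun _ => s)) ≫
          wedgeRes _ 1 f = (oneE σ E).one₁ (circRes f (some s)) := by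
        simp only [Category.assoc]
        rw [wedgeι_res, circRes]
        by_cases h : Function.Surjective (f ≫ s.1).toOrderHom
        · rw [dif_pos fun _ => h, dif_pos h]
          rfl
        · rw [dif_neg fun h' => h (h' 0), dif_neg h, comp_zero, comp_zero, comp_zero]
          rfl
      exact key
  central {n k} x s := oneE_isCommutative σ E hE x _

end Main

/-! ### The calculus of correspondences -/

theorem shuffle_trans_shuffle (n m : ℕ) :
    (shuffle n m).trans (shuffle m n) = Equiv.refl (Fin (n + m)) := by
  simp [Equiv.ext_iff, Fin.forall_fin_add, shuffle]

/-- A scalar may be moved from the target to the source. -/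
theorem GrHom.comp_scalar {C : Type u} [Category.{v} C] [MonoidalCategory C] [SymmetricCategory C]
    {P : C} {F : CommGrMon C} {X Y : C} {n m : ℕ} (r : powObj P n ⟶ F.seq.obj ⟨n⟩)
    (f : GrHom P F X Y m) : comp f (scalar Y r) = perm (shuffle n m) (comp (scalar X r) f) := by
  rw [scalar_comp, perm_perm, shuffle_trans_shuffle, perm_refl]

section CorrLaws

variable {C : Type u} [Category.{v} C] [MonoidalCategory C] [SymmetricCategory C]
  [HasFiniteCoproducts C] [∀ B : C, PreservesFiniteCoproducts (tensorRight B)]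
  [HasZeroObject C] [HasZeroMorphisms C]
  {P T : C} (σ : P ⟶ T) (E : SymRingTSpectrum T) {k l : SimplexCategory}
  {X X' X'' Y Y' Y'' Z Z' W : C} {n n' m m' p q : ℕ}

theorem wedgeMap_zero (A B : C) : wedgeMap (0 : A ⟶ B) n k = 0 :=
  wedge_ext fun s => by simp

theorem corrComp_res (φ : k ⟶ l) (f : Corr P E X Y n l) (g : Corr P E Y Z m l) :
    corrComp E f g ≫ wedgeRes _ _ φ = corrComp E (f ≫ wedgeRes _ _ φ) (g ≫ wedgeRes _ _ φ) := by
  obtain ⟨f, rfl⟩ := exists_comp_wedgeTensorLeft f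
  obtain ⟨g, rfl⟩ := exists_comp_wedgeTensorLeft g
  have h := paramComp_naturality f g (𝟙 _) (𝟙 _) (wedgeRes _ n φ) (wedgeRes _ m φ)
  simp only [MonoidalCategory.whiskerLeft_id, Category.id_comp, id_tensorHom_id] at h
  simp only [Category.assoc, wedgeTensorLeft_res]
  simp only [← Category.assoc f, ← Category.assoc g, corrComp_eq]
  rw [h]
  simp only [Category.assoc, wedgeTensorLeft_res]
  rw [← whiskerLeft_comp_assoc, ← whiskerLeft_comp_assoc, wedgeRingMul_res]

theorem corrTensor_res (φ : k ⟶ l) (f : Corr P E X X' n l) (g : Corr P E Y Y' m l) :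
    corrTensor E f g ≫ wedgeRes _ _ φ =
      corrTensor E (f ≫ wedgeRes _ _ φ) (g ≫ wedgeRes _ _ φ) := by
  obtain ⟨f, rfl⟩ := exists_comp_wedgeTensorLeft f
  obtain ⟨g, rfl⟩ := exists_comp_wedgeTensorLeft g
  have h := paramTensor_naturality f g (𝟙 _) (𝟙 _) (wedgeRes _ n φ) (wedgeRes _ m φ)
  simp only [MonoidalCategory.whiskerLeft_id, Category.id_comp, id_tensorHom_id] at h
  simp only [Category.assoc, wedgeTensorLeft_res]
  simp only [← Category.assoc f, ← Category.assoc g, corrTensor_eq]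
  rw [h]
  simp only [Category.assoc, wedgeTensorLeft_res]
  rw [← whiskerLeft_comp_assoc, ← whiskerLeft_comp_assoc, wedgeRingMul_res]

theorem zero_corrComp (g : Corr P E Y Z m k) : corrComp E (0 : Corr P E X Y n k) g = 0 := by
  simp [corrComp, zero_whiskerRight']

theorem corrComp_zero (f : Corr P E X Y n k) : corrComp E f (0 : Corr P E Y Z m k) = 0 := by
  simp [corrComp, zero_whiskerRight', wedgeMap_zero]

theorem zero_corrTensor (g : Corr P E Y Y' m k) :
    corrTensor E (0 : Corr P E X X' n k) g = 0 := by
  simp [corrTensor, smashMaps, zero_tensorHom']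

theorem corrTensor_zero (f : Corr P E X X' n k) :
    corrTensor E f (0 : Corr P E Y Y' m k) = 0 := by
  simp [corrTensor, smashMaps, tensorHom_zero']

theorem corrComp_perm (hE : E.IsCommutative) (e : Fin n ≃ Fin n') (e' : Fin m ≃ Fin m')
    (f : Corr P E X Y n k)
    (g : Corr P E Y Z m k) :
    corrComp E ((corrSeq P E X Y).perm e f) ((corrSeq P E Y Z).perm e' g) =
      (corrSeq P E X Z).perm (blockSum e e') (corrComp E f g) := by
  obtain ⟨f, rfl⟩ := toCorr_surjective E hE f
  obtain ⟨g, rfl⟩ := toCorr_surjective E hE g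
  simp only [toCorr_comp, toCorr_perm, GrHom.comp_perm]

theorem corrTensor_perm (hE : E.IsCommutative) (e : Fin n ≃ Fin n') (e' : Fin m ≃ Fin m')
    (f : Corr P E X X' n k)
    (g : Corr P E Y Y' m k) :
    corrTensor E ((corrSeq P E X X').perm e f) ((corrSeq P E Y Y').perm e' g) =
      (corrSeq P E (X ⊗ Y) (X' ⊗ Y')).perm (blockSum e e') (corrTensor E f g) := by
  obtain ⟨f, rfl⟩ := toCorr_surjective E hE f
  obtain ⟨g, rfl⟩ := toCorr_surjective E hE g
  simp only [toCorr_tensor, toCorr_perm, GrHom.tensor_perm]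

theorem corrComp_assoc (hE : E.IsCommutative) (f : Corr P E X Y n k) (g : Corr P E Y Z m k)
    (h : Corr P E Z W p k) :
    (corrSeq P E X W).perm (finCongr (Nat.add_assoc n m p)) (corrComp E (corrComp E f g) h) =
      corrComp E f (corrComp E g h) := by
  obtain ⟨f, rfl⟩ := toCorr_surjective E hE f
  obtain ⟨g, rfl⟩ := toCorr_surjective E hE g
  obtain ⟨h, rfl⟩ := toCorr_surjective E hE h
  simp only [toCorr_comp, toCorr_perm, GrHom.comp_assoc]
  rfl

theorem corrComp_ofHom (hE : E.IsCommutative) (f : Corr P E X Y n k) (h : Y ⟶ Z) :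
    corrComp E f (corrOfHom P E h k) = f ≫ wedgeMap (h ▷ E.seq.obj ⟨n⟩) n k := by
  obtain ⟨f, rfl⟩ := toCorr_surjective E hE f
  rw [toCorr_ofHom E hE, toCorr_comp, GrHom.comp_ofHom]
  exact toCorr_whiskerRight E hE f h

theorem toCorr_whiskerRight_comp (hE : E.IsCommutative) (h : X ⟶ Y)
    (f : GrHom P (wedgeMon E hE k) Y Z n) :
    h ▷ powObj P n ≫ toCorr E hE f = toCorr E hE (h ▷ powObj P n ≫ f) :=
  (Category.assoc _ _ _).symm

theorem ofHom_corrComp (hE : E.IsCommutative) (h : X ⟶ Y) (f : Corr P E Y Z n k) :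
    corrComp E (corrOfHom P E h k) f = (corrSeq P E X Z).perm (finCongr (Nat.zero_add n).symm)
      (h ▷ powObj P n ≫ f : Corr P E X Z n k) := by
  obtain ⟨f, rfl⟩ := toCorr_surjective E hE f
  rw [toCorr_ofHom E hE, toCorr_comp, GrHom.ofHom_comp, toCorr_whiskerRight_comp, toCorr_perm]

/-- The interchange law. -/
theorem corrComp_corrTensor (hE : E.IsCommutative)
    (f : Corr P E X X' n k) (f' : Corr P E X' X'' m k)
    (g : Corr P E Y Y' p k) (g' : Corr P E Y' Y'' q k) :
    corrComp E (corrTensor E f g) (corrTensor E f' g') =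
      (corrSeq P E (X ⊗ Y) (X'' ⊗ Y'')).perm (midSwap n m p q)
        (corrTensor E (corrComp E f f') (corrComp E g g')) := by
  obtain ⟨f, rfl⟩ := toCorr_surjective E hE f
  obtain ⟨g, rfl⟩ := toCorr_surjective E hE g
  obtain ⟨f', rfl⟩ := toCorr_surjective E hE f'
  obtain ⟨g', rfl⟩ := toCorr_surjective E hE g'
  simp only [toCorr_comp, toCorr_perm, toCorr_tensor, GrHom.comp_tensor]

theorem corrTensor_assoc (hE : E.IsCommutative) (f : Corr P E X X' n k) (g : Corr P E Y Y' m k)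
    (h : Corr P E Z Z' p k) :
    (corrSeq P E ((X ⊗ Y) ⊗ Z) (X' ⊗ Y' ⊗ Z')).perm (finCongr (Nat.add_assoc n m p))
        (corrTensor E (corrTensor E f g) h ≫
          wedgeMap ((α_ X' Y' Z').hom ▷ E.seq.obj ⟨n + m + p⟩) (n + m + p) k) =
      (α_ X Y Z).hom ▷ powObj P (n + (m + p)) ≫ corrTensor E f (corrTensor E g h) := by
  obtain ⟨f, rfl⟩ := toCorr_surjective E hE f
  obtain ⟨g, rfl⟩ := toCorr_surjective E hE g
  obtain ⟨h, rfl⟩ := toCorr_surjective E hE h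
  have e := toCorr_whiskerRight E hE (GrHom.tensor (GrHom.tensor f g) h) (α_ X' Y' Z').hom
  simp only [toCorr_tensor, toCorr_whiskerRight_comp, ← GrHom.tensor_assoc]
  rw [← toCorr_perm]
  exact congrArg _ e.symm

theorem corrTensor_braiding (hE : E.IsCommutative) (f : Corr P E X X' n k) (g : Corr P E Y Y' m k) :
    (corrSeq P E (X ⊗ Y) (Y' ⊗ X')).perm (shuffle n m)
        (corrTensor E f g ≫ wedgeMap ((β_ X' Y').hom ▷ E.seq.obj ⟨n + m⟩) (n + m) k) =
      (β_ X Y).hom ▷ powObj P (m + n) ≫ corrTensor E g f := by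
  obtain ⟨f, rfl⟩ := toCorr_surjective E hE f
  obtain ⟨g, rfl⟩ := toCorr_surjective E hE g
  have e := toCorr_whiskerRight E hE (GrHom.tensor f g) (β_ X' Y').hom
  simp only [toCorr_tensor, toCorr_whiskerRight_comp, ← GrHom.tensor_braiding]
  rw [← toCorr_perm]
  exact congrArg _ e.symm

theorem corrTensor_ofHom_ofHom (hE : E.IsCommutative) (f : X ⟶ X') (g : Y ⟶ Y') :
    corrTensor E (corrOfHom P E f k) (corrOfHom P E g k) = corrOfHom P E (f ⊗ₘ g) k := by
  simp only [toCorr_ofHom E hE, toCorr_tensor, GrHom.tensor_ofHom_ofHom]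

theorem unit_corrTensor (hE : E.IsCommutative) (f : Corr P E X Y n k) :
    corrTensor E (corrOfHom P E (𝟙 (𝟙_ C)) k) f ≫
        wedgeMap ((λ_ Y).hom ▷ E.seq.obj ⟨0 + n⟩) (0 + n) k =
      (corrSeq P E (𝟙_ C ⊗ X) Y).perm (finCongr (Nat.zero_add n).symm)
        ((λ_ X).hom ▷ powObj P n ≫ f : Corr P E (𝟙_ C ⊗ X) Y n k) := by
  obtain ⟨f, rfl⟩ := toCorr_surjective E hE f
  have e := toCorr_whiskerRight E hE (GrHom.tensor (GrHom.ofHom P (wedgeMon E hE k)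
    (𝟙 (𝟙_ C))) f) (λ_ Y).hom
  rw [toCorr_whiskerRight_comp, toCorr_perm, ← GrHom.unit_tensor, toCorr_ofHom E hE, toCorr_tensor]
  exact e.symm

theorem corrTensor_unit (hE : E.IsCommutative) (f : Corr P E X Y n k) :
    corrTensor E f (corrOfHom P E (𝟙 (𝟙_ C)) k) ≫
        wedgeMap ((ρ_ Y).hom ▷ E.seq.obj ⟨n⟩) n k = (ρ_ X).hom ▷ powObj P n ≫ f := by
  obtain ⟨f, rfl⟩ := toCorr_surjective E hE f
  have h := toCorr_whiskerRight E hE (GrHom.tensor f (GrHom.ofHom P (wedgeMon E hE k)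
    (𝟙 (𝟙_ C)))) (ρ_ Y).hom
  simp only [toCorr_ofHom E hE, toCorr_tensor, toCorr_whiskerRight_comp, ← GrHom.tensor_unit]
  exact h.symm

/-- The composition is linear in the second variable. -/
theorem corrAct_corrComp (hE : E.IsCommutative) (f : Corr P E X Y n k) (g : Corr P E Y Z m k)
    (r : powObj P p ⟶ wedge (E.seq.obj ⟨p⟩) p k) :
    corrComp E f (corrAct E g r) = (corrSeq P E X Z).perm (finCongr (Nat.add_assoc n m p))
      (corrAct E (corrComp E f g) r) := by
  obtain ⟨f, rfl⟩ := toCorr_surjective E hE f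
  obtain ⟨g, rfl⟩ := toCorr_surjective E hE g
  simp only [toCorr_act E hE, toCorr_comp, toCorr_perm, GrHom.comp_assoc]

/-- The composition is balanced: a scalar moves from the first variable to the second at the cost of
a shuffle. -/
theorem corrAct_left_corrComp (hE : E.IsCommutative) (f : Corr P E X Y n k) (g : Corr P E Y Z m k)
    (r : powObj P p ⟶ wedge (E.seq.obj ⟨p⟩) p k) :
    corrComp E f (corrAct E g r) = (corrSeq P E X Z).perm
      ((finCongr (Nat.add_assoc n p m)).trans (blockSum (Equiv.refl (Fin n)) (shuffle p m)))
      (corrComp E (corrAct E f r) g) := by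
  obtain ⟨f, rfl⟩ := toCorr_surjective E hE f
  obtain ⟨g, rfl⟩ := toCorr_surjective E hE g
  have e : GrHom.comp g (GrHom.scalar (F := wedgeMon E hE k) (P := P) (n := p) Z r) =
      GrHom.perm (shuffle p m) (GrHom.comp (GrHom.scalar Y r) g) := by
    exact GrHom.comp_scalar (F := wedgeMon E hE k) (P := P) (n := p) r g
  have e' := GrHom.comp_perm (Equiv.refl (Fin n)) (shuffle p m) f
    (GrHom.comp (GrHom.scalar (F := wedgeMon E hE k) (P := P) (n := p) Y r) g)
  rw [toCorr_act E hE, toCorr_comp, e, toCorr_act E hE, toCorr_comp, toCorr_perm,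
    ← GrHom.perm_perm, GrHom.comp_assoc, ← e', GrHom.perm_refl]

end CorrLaws

/-! ### The modules of correspondences -/

section CorrMod

variable {C : Type u} [Category.{v} C] [MonoidalCategory C] [SymmetricCategory C]
  [HasFiniteCoproducts C] [∀ B : C, PreservesFiniteCoproducts (tensorRight B)]
  [HasZeroObject C] [HasZeroMorphisms C]
  {P T : C} (σ : P ⟶ T) (E : SymRingTSpectrum T) {k l : SimplexCategory}
  {X X' X'' Y Y' Y'' Z Z' W : C} {n n' m m' p q : ℕ}

theorem zero_corrAct (r : powObj P m ⟶ wedge (E.seq.obj ⟨m⟩) m k) :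
    corrAct E (0 : Corr P E X Y n k) r = 0 := by
  simp [corrAct, smashMaps, zero_tensorHom']

theorem corrAct_zero (f : Corr P E X Y n k) :
    corrAct E f (0 : powObj P m ⟶ wedge (E.seq.obj ⟨m⟩) m k) = 0 := by
  simp [corrAct, smashMaps, tensorHom_zero']

theorem corrAct_res (φ : k ⟶ l) (f : Corr P E X Y n l)
    (r : powObj P m ⟶ wedge (E.seq.obj ⟨m⟩) m l) :
    corrAct E f r ≫ wedgeRes _ _ φ = corrAct E (f ≫ wedgeRes _ _ φ) (r ≫ wedgeRes _ _ φ) := by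
  obtain ⟨f, rfl⟩ := exists_comp_wedgeTensorLeft f
  have h := paramComp_naturality f (Y ◁ r) (𝟙 _) (𝟙 _) (wedgeRes _ n φ) (wedgeRes _ m φ)
  simp only [MonoidalCategory.whiskerLeft_id, Category.id_comp, id_tensorHom_id,
    ← MonoidalCategory.whiskerLeft_comp] at h
  simp only [Category.assoc, wedgeTensorLeft_res]
  simp only [← Category.assoc f, corrAct_eq]
  rw [h]
  simp only [Category.assoc, wedgeTensorLeft_res]
  rw [← whiskerLeft_comp_assoc, ← whiskerLeft_comp_assoc, wedgeRingMul_res]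

theorem corrAct_perm (hE : E.IsCommutative) (e : Fin n ≃ Fin n') (e' : Fin m ≃ Fin m')
    (f : Corr P E X Y n k) (r : powObj P m ⟶ wedge (E.seq.obj ⟨m⟩) m k) :
    corrAct E ((corrSeq P E X Y).perm e f) (powPerm P e'.symm ≫ r ≫ wedgeAct E e' k) =
      (corrSeq P E X Y).perm (blockSum e e') (corrAct E f r) := by
  obtain ⟨f, rfl⟩ := toCorr_surjective E hE f
  have h : ∀ (r' : powObj P m ⟶ (wedgeMon E hE k).seq.obj ⟨m⟩),
      GrHom.scalar Y (powPerm P e'.symm ≫ r' ≫ (wedgeMon E hE k).seq.map (FinBij.of e')) =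
        GrHom.perm e' (GrHom.scalar Y r') := fun r' => by
    simp only [GrHom.scalar, GrHom.perm, MonoidalCategory.whiskerLeft_comp]
  rw [toCorr_perm, toCorr_act E hE f r, toCorr_perm, ← GrHom.comp_perm]
  exact (toCorr_act E hE _ _).trans (congrArg (fun t => toCorr E hE (GrHom.comp _ t)) (h r))

theorem corrAct_mul (hE : E.IsCommutative) (f : Corr P E X Y n k)
    (r : powObj P m ⟶ wedge (E.seq.obj ⟨m⟩) m k) (s : powObj P p ⟶ wedge (E.seq.obj ⟨p⟩) p k) :
    (corrSeq P E X Y).perm (finCongr (Nat.add_assoc n m p)) (corrAct E (corrAct E f r) s) =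
      corrAct E f (GrHom.smul (F := wedgeMon E hE k) r s) := by
  obtain ⟨f, rfl⟩ := toCorr_surjective E hE f
  have h := GrHom.scalar_smul (F := wedgeMon E hE k) (X := Y) r s
  rw [toCorr_act E hE, toCorr_act E hE, toCorr_perm, GrHom.comp_assoc, ← h]
  exact (toCorr_act E hE f _).symm

theorem corrAct_one (hE : E.IsCommutative) (f : Corr P E X Y n k) :
    corrAct E f (GrHom.one P (wedgeMon E hE k)) = f := by
  obtain ⟨f, rfl⟩ := toCorr_surjective E hE f
  have h := GrHom.ofHom_id (P := P) (F := wedgeMon E hE k) Y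
  refine (toCorr_act E hE f (GrHom.one P (wedgeMon E hE k))).trans ?_
  rw [← h, GrHom.comp_ofHom, id_whiskerRight, Category.comp_id]

/-- The structure maps of the spectrum of correspondences are given by the action of the unit
`S¹ ⟶ 1^E 1`. -/
theorem corrStr_some (f : Corr P E X Y n k) (s : Circ k) :
    corrStr σ E f (some s) =
      corrAct E f (m := 1) ((λ_ P).hom ≫ σ ≫ E.one₁ ≫ wedgeι (E.seq.obj ⟨1⟩) (fun _ => s)) := by
  -- The right unitor and the associator in `powSplit P n 1` cancel against `λ_ P`.
  have e₁ : ∀ {A G D H : C} (f : X ⊗ A ⟶ D) (g : P ⟶ G) (h : G ⟶ H) {K : C}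
      (w : D ⊗ H ⟶ K),
      X ◁ ((ρ_ A).inv ▷ P ≫ (α_ A (𝟙_ C) P).hom) ≫ (α_ X A (𝟙_ C ⊗ P)).inv ≫
        (f ⊗ₘ ((λ_ P).hom ≫ g ≫ h)) ≫ w = (α_ X A P).inv ≫ (f ⊗ₘ g) ≫ D ◁ h ≫ w := by
    intro A G D H f g h K w
    have t : (ρ_ A).inv ▷ P ≫ (α_ A (𝟙_ C) P).hom ≫ A ◁ (λ_ P).hom = 𝟙 _ := by
      rw [MonoidalCategory.triangle, ← comp_whiskerRight, Iso.inv_hom_id, id_whiskerRight]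
    have t' := congrArg (X ◁ ·) t
    simp only [MonoidalCategory.whiskerLeft_comp, MonoidalCategory.whiskerLeft_id] at t'
    rw [MonoidalCategory.tensorHom_def', MonoidalCategory.whiskerLeft_comp]
    simp [MonoidalCategory.tensorHom_def', ← whisker_exchange_assoc, reassoc_of% t']
  have e₂ : wedge (Y ⊗ E.seq.obj ⟨n⟩) n k ◁ (E.one₁ ≫ wedgeι (E.seq.obj ⟨1⟩) (fun _ => s)) ≫
      wedgeMul _ _ n 1 k ≫ wedgeMap ((α_ Y (E.seq.obj ⟨n⟩) (E.seq.obj ⟨1⟩)).hom ≫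
        Y ◁ E.mul n 1) (n + 1) k =
      wedgeTensorRight (Y ⊗ E.seq.obj ⟨n⟩) T n k ≫
      wedgeMap ((α_ Y (E.seq.obj ⟨n⟩) T).hom ≫ Y ◁ (E.seq.obj ⟨n⟩ ◁ E.one₁ ≫ E.mul n 1)) n k ≫
      wedgeDesc fun t => wedgeι (Y ⊗ E.seq.obj ⟨n + 1⟩) (Fin.snoc t s) := by
    refine wedge_whiskerRight_ext fun t => ?_
    rw [← whisker_exchange_assoc, MonoidalCategory.whiskerLeft_comp, Category.assoc,
      ← MonoidalCategory.tensorHom_def'_assoc, wedgeι_mul_assoc, wedgeι_map, Fin.append_right_eq_snoc]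
    simp
  rw [corrStr, ← e₂, corrAct, smashMaps_eq, Category.assoc]
  exact (e₁ f σ (E.one₁ ≫ wedgeι (n := 1) (E.seq.obj ⟨1⟩) (fun _ => s)) _).symm

theorem corrData_isModule (hE : E.IsCommutative) (X Y : C) :
    (corrData σ E (oneE_isSymRing σ E hE) (oneE_isCommutative σ E hE) X Y).IsModule where
  pt_act r := zero_corrAct E r
  act_pt f := corrAct_zero E f
  act_res φ f r := corrAct_res E φ f r
  act_perm e e' f r := corrAct_perm E hE e e' f r
  act_mul f r s := (corrAct_mul E hE f r s).trans
    (congrArg (corrAct E f) (oneE_mul_eq σ E hE r s).symm)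
  act_one f := corrAct_one E hE f
  str_eq f s := by
    cases s with
    | none => exact (corrAct_zero E f).symm
    | some s => exact corrStr_some σ E f s

/-- The commutative ring spectrum `1^E`. -/
abbrev oneRing (hE : E.IsCommutative) : CommSymRing.{v} :=
  oneERing σ E (oneE_isSymRing σ E hE) (oneE_isCommutative σ E hE)

/-- The right `1^E`-module of correspondences. -/
abbrev corrModule (hE : E.IsCommutative) (X Y : C) : SymMod (oneRing σ E hE) :=
  corrMod σ E (oneE_isSymRing σ E hE) (oneE_isCommutative σ E hE) X Y
    (corrData_isModule σ E hE X Y)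

/-- The composition of correspondences as a bimorphism. -/
def compBi (hE : E.IsCommutative) (X Y Z : C) :
    SymMod.BiMor (corrModule σ E hE X Y) (corrModule σ E hE Y Z) (corrModule σ E hE X Z) where
  b f g := corrComp E f g
  pt_b g := zero_corrComp E g
  b_pt f := corrComp_zero E f
  b_res φ f g := corrComp_res E φ f g
  b_perm e e' f g := corrComp_perm E hE e e' f g
  b_act_right f g r := corrAct_corrComp E hE f g r
  b_act_left f g r := corrAct_left_corrComp E hE f g r

theorem blockSum_refl_finCongr {n m m' : ℕ} (h : m = m') :
    blockSum (Equiv.refl (Fin n)) (finCongr h) = finCongr (congrArg (n + ·) h) := by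
  subst h
  exact blockSum_refl_refl

theorem blockSum_finCongr_refl {n n' m : ℕ} (h : n = n') :
    blockSum (finCongr h) (Equiv.refl (Fin m)) = finCongr (congrArg (· + m) h) := by
  subst h
  exact blockSum_refl_refl

/-- A scalar may be moved out of the second factor of a monoidal product, by interchange with an
identity. -/
theorem GrHom.tensor_comp_scalar {F : CommGrMon C} (f : GrHom P F X X' n) (g : GrHom P F Y Y' m)
    (r : powObj P p ⟶ F.seq.obj ⟨p⟩) : tensor f (comp g (scalar Y' r)) =
      perm (finCongr (Nat.add_assoc n m p)) (comp (tensor f g) (scalar (X' ⊗ Y') r)) := by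
  have h := comp_tensor f (ofHom P F (𝟙 X')) g (scalar Y' r)
  rw [comp_ofHom, id_whiskerRight, Category.comp_id, ofHom_id, tensor_scalar_scalar, one_smul] at h
  have e : scalar (X' ⊗ Y') (powPerm P (finCongr (Nat.zero_add p)) ≫ r ≫
      F.seq.map (FinBij.of (finCongr (Nat.zero_add p).symm))) =
      perm (finCongr (Nat.zero_add p).symm) (scalar (X' ⊗ Y') r) := by
    simp only [scalar, perm, MonoidalCategory.whiskerLeft_comp]
    rfl
  have e' := comp_perm (Equiv.refl _) (finCongr (Nat.zero_add p).symm) (tensor f g)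
    (scalar (X' ⊗ Y') r)
  rw [e, ← perm_refl (tensor f g), e'] at h
  have h' := congrArg (perm (midSwap n 0 m p).symm) h
  rw [perm_perm, perm_perm, Equiv.self_trans_symm, perm_refl] at h'
  refine h'.symm.trans ?_
  congr 1
  rw [midSwap_symm]
  -- With an empty second block, `midSwap` is built from identifications of equal numbers.
  have trans : ∀ {a b c : ℕ} (h : a = b) (h' : b = c),
      (finCongr h).trans (finCongr h') = finCongr (h.trans h') := fun _ _ => rfl
  simp only [midSwap, shuffle_zero_right, blockSum_refl_finCongr, blockSum_finCongr_refl,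
    finCongr_symm, trans]

theorem GrHom.tensor_comp_scalar_left {F : CommGrMon C} (f : GrHom P F X X' n)
    (g : GrHom P F Y Y' m) (r : powObj P p ⟶ F.seq.obj ⟨p⟩) : tensor f (comp g (scalar Y' r)) =
      perm ((finCongr (Nat.add_assoc n p m)).trans (blockSum (Equiv.refl (Fin n)) (shuffle p m)))
        (tensor (comp f (scalar X' r)) g) := by
  have h := comp_tensor f (scalar X' r) g (ofHom P F (𝟙 Y'))
  rw [comp_ofHom, id_whiskerRight, Category.comp_id, ofHom_id, tensor_scalar_scalar, smul_one] at h
  rw [tensor_comp_scalar, h, perm_perm]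
  congr 1
  have e : blockSum (shuffle p m) (Equiv.refl (Fin 0)) = shuffle p m := blockSum_refl_zero _
  rw [midSwap, e]
  rfl

theorem corrTensor_act (hE : E.IsCommutative) (f : Corr P E X X' n k) (g : Corr P E Y Y' m k)
    (r : powObj P p ⟶ wedge (E.seq.obj ⟨p⟩) p k) :
    corrTensor E f (corrAct E g r) = (corrSeq P E (X ⊗ Y) (X' ⊗ Y')).perm
      (finCongr (Nat.add_assoc n m p)) (corrAct E (corrTensor E f g) r) := by
  obtain ⟨f, rfl⟩ := toCorr_surjective E hE f
  obtain ⟨g, rfl⟩ := toCorr_surjective E hE g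
  rw [toCorr_act E hE g r, toCorr_tensor, toCorr_tensor, toCorr_act E hE _ r, toCorr_perm]
  exact congrArg (toCorr E hE) (GrHom.tensor_comp_scalar (F := wedgeMon E hE k) f g r)

theorem corrTensor_act_left (hE : E.IsCommutative) (f : Corr P E X X' n k) (g : Corr P E Y Y' m k)
    (r : powObj P p ⟶ wedge (E.seq.obj ⟨p⟩) p k) :
    corrTensor E f (corrAct E g r) = (corrSeq P E (X ⊗ Y) (X' ⊗ Y')).perm
      ((finCongr (Nat.add_assoc n p m)).trans (blockSum (Equiv.refl (Fin n)) (shuffle p m)))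
      (corrTensor E (corrAct E f r) g) := by
  obtain ⟨f, rfl⟩ := toCorr_surjective E hE f
  obtain ⟨g, rfl⟩ := toCorr_surjective E hE g
  rw [toCorr_act E hE g r, toCorr_act E hE f r, toCorr_tensor, toCorr_tensor, toCorr_perm]
  exact congrArg (toCorr E hE) (GrHom.tensor_comp_scalar_left (F := wedgeMon E hE k) f g r)

/-- The monoidal product of correspondences as a bimorphism. -/
def tensorBi (hE : E.IsCommutative) (X X' Y Y' : C) :
    SymMod.BiMor (corrModule σ E hE X X') (corrModule σ E hE Y Y')
      (corrModule σ E hE (X ⊗ Y) (X' ⊗ Y')) where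
  b f g := corrTensor E f g
  pt_b g := zero_corrTensor E g
  b_pt f := corrTensor_zero E f
  b_res φ f g := corrTensor_res E φ f g
  b_perm e e' f g := corrTensor_perm E hE e e' f g
  b_act_right f g r := corrTensor_act E hE f g r
  b_act_left f g r := corrTensor_act_left E hE f g r

end CorrMod

/-! ### Morphisms out of the monoidal unit -/

namespace SymMod

variable {R : CommSymRing.{w}} {M N X Y Z W : SymMod R} {n m p q : ℕ} {k l : SimplexCategory}

/-- The morphism from the monoidal unit `R` that takes the unit of `R` to a given compatible
family of elements of degree `0`. -/
def ofElement (M : SymMod R) (x : ∀ k : SimplexCategory, M.seq.el 0 k)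
    (hx : ∀ {k l : SimplexCategory} (f : k ⟶ l), M.seq.res f (x l) = x k) : 𝟙_ (SymMod R) ⟶ M where
  hom := PtdSymSeq.homMk
    (fun {n k} s => M.seq.perm (finCongr (Nat.zero_add n)) (M.act (x k) (ofUnit s)))
    (fun {n k} => by
      refine (congrArg _ (act_pt (x k))).trans ?_
      rw [PtdSymSeq.perm_pt])
    (fun {n k l} f s => by
      rw [PtdSymSeq.res_perm, res_act, hx]
      rfl)
    (fun {n m k} e s => by
      have h := act_perm_right e (x k) (ofUnit s)
      refine (congrArg _ h).trans ?_
      rw [PtdSymSeq.perm_perm, PtdSymSeq.perm_perm]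
      congr 1
      refine Equiv.ext fun i => ?_
      refine Fin.addCases (fun i => i.elim0) (fun j => Fin.ext ?_) i
      rw [Equiv.trans_apply, blockSum_natAdd]
      simp)
  map_act {n m k} s t := by
    change M.seq.perm _ (M.act (x k) (R.mul (ofUnit s) t)) =
      M.act (M.seq.perm _ (M.act (x k) (ofUnit s))) t
    rw [act_perm_left, act_act, PtdSymSeq.perm_perm]
    congr 1
    rw [blockSum_finCongr_refl]
    rfl

theorem ofElement_unitEl (M : SymMod R) (x : ∀ k : SimplexCategory, M.seq.el 0 k)
    (hx : ∀ {k l : SimplexCategory} (f : k ⟶ l), M.seq.res f (x l) = x k) :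
    ap (ofElement M x hx) (unitEl R k) = x k := by
  change M.seq.perm (finCongr (Nat.zero_add 0)) (M.act (x k) (R.one₀ k)) = x k
  rw [act_one]
  exact PtdSymSeq.perm_refl _

/-- A morphism out of the unit is determined by the image of the unit element. -/
theorem unit_hom_ext {f g : 𝟙_ (SymMod R) ⟶ M}
    (h : ∀ k, ap f (unitEl R k) = ap g (unitEl R k)) : f = g := by
  refine hom_ext fun n k s => ?_
  have e : s = (𝟙_ (SymMod R)).seq.perm (finCongr (Nat.zero_add n))
      ((𝟙_ (SymMod R)).act (unitEl R k) (ofUnit s)) :=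
    PtdSymSeq.eq_perm_symm (R.isSymRing.one_mul (ofUnit s)).symm
  rw [e, ap_perm, ap_perm, ap_act, ap_act, h]

theorem ap_unit_tensor (f : 𝟙_ (SymMod R) ⟶ X) (g : 𝟙_ (SymMod R) ⟶ Y) (φ : X ⊗ Y ⟶ Z) :
    ap ((λ_ (𝟙_ (SymMod R))).inv ≫ (f ⊗ₘ g) ≫ φ) (unitEl R k) =
      ap φ ((sm X Y).b (ap f (unitEl R k)) (ap g (unitEl R k))) := by
  rw [ap_comp, ap_comp, leftUnitor_inv_ap, ap_perm, tensorHom_sm, ap_perm]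
  exact PtdSymSeq.perm_refl _

theorem ap_rightUnitor_inv_comp (g : 𝟙_ (SymMod R) ⟶ Y) (φ : X ⊗ Y ⟶ Z) (x : X.seq.el n k) :
    ap ((ρ_ X).inv ≫ X ◁ g ≫ φ) x = ap φ ((sm X Y).b x (ap g (unitEl R k))) := by
  rw [ap_comp, ap_comp, rightUnitor_inv_ap, whiskerLeft_sm]

theorem ap_leftUnitor_inv_comp (f : 𝟙_ (SymMod R) ⟶ X) (φ : X ⊗ Y ⟶ Z) (y : Y.seq.el n k) :
    ap ((λ_ Y).inv ≫ f ▷ Y ≫ φ) y = Z.seq.perm (finCongr (Nat.zero_add n))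
      (ap φ ((sm X Y).b (ap f (unitEl R k)) y)) := by
  rw [ap_comp, ap_comp, leftUnitor_inv_ap, ap_perm, whiskerRight_sm, ap_perm]

/-- The exchange of the two middle factors, on products of elements. -/
theorem tensorμ_sm (x : X.seq.el n k) (y : Y.seq.el m k) (z : Z.seq.el p k) (t : W.seq.el q k) :
    ap (tensorμ X Y Z W) ((sm (X ⊗ Y) (Z ⊗ W)).b ((sm X Y).b x y) ((sm Z W).b z t)) =
      ((X ⊗ Z) ⊗ (Y ⊗ W)).seq.perm (midSwap n p m q)
        ((sm (X ⊗ Z) (Y ⊗ W)).b ((sm X Z).b x z) ((sm Y W).b y t)) := by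
  simp only [tensorμ, ap_comp, associator_hom_sm, associator_inv_sm, ap_perm, braiding_hom_sm,
    whiskerRight_sm, whiskerLeft_sm, BiMor.b_perm_left, BiMor.b_perm_right, PtdSymSeq.perm_perm]
  congr 1
  simp [Equiv.ext_iff, Fin.forall_fin_add, midSwap, -Fin.cast_cast]

end SymMod

/-! ### The enriched category of correspondences -/

section CorrEnriched

open SymMod

variable {C : Type u} [Category.{v} C] [MonoidalCategory C] [SymmetricCategory C]
  [HasFiniteCoproducts C] [∀ B : C, PreservesFiniteCoproducts (tensorRight B)]
  [HasZeroObject C] [HasZeroMorphisms C]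
  {P T : C} (σ : P ⟶ T) (E : SymRingTSpectrum T) (hE : E.IsCommutative) {k l : SimplexCategory}
  {X X' X'' Y Y' Y'' Z Z' W : C} {n m p q : ℕ}

theorem corrOfHom_res {X Y : C} (f : X ⟶ Y) (φ : k ⟶ l) :
    (corrSeq P E X Y).res (n := 0) φ (corrOfHom P E f l) = corrOfHom P E f k := by
  have key : ((f ⊗ₘ E.one₀) ≫ wedgeι (Y ⊗ E.seq.obj ⟨0⟩) (fun i : Fin 0 => (i.elim0 : Circ l))) ≫
      wedgeRes _ 0 φ =
        (f ⊗ₘ E.one₀) ≫ wedgeι (Y ⊗ E.seq.obj ⟨0⟩) (fun i : Fin 0 => (i.elim0 : Circ k)) := by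
    rw [Category.assoc, wedgeι_res, dif_pos fun i => i.elim0]
    congr 2
    funext i
    exact i.elim0
  exact key

theorem id_corrComp (hE : E.IsCommutative) {X Y : C} (f : Corr P E X Y n k) :
    corrComp E (corrOfHom P E (𝟙 X) k) f =
      (corrSeq P E X Y).perm (finCongr (Nat.zero_add n).symm) f := by
  rw [ofHom_corrComp E hE, id_whiskerRight, Category.id_comp]

theorem corrComp_id (hE : E.IsCommutative) {X Y : C} (f : Corr P E X Y n k) :
    corrComp E f (corrOfHom P E (𝟙 Y) k) = f := by
  rw [corrComp_ofHom E hE, id_whiskerRight, wedgeMap_id, Category.comp_id]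

/-- The correspondence given by a morphism of `C`, as an element of the module. -/
def homEl (f : X ⟶ Y) (k : SimplexCategory) : (corrModule σ E hE X Y).seq.el 0 k :=
  corrOfHom P E f k

/-- The morphism of modules from the unit given by a morphism of `C`. -/
def unitOfHom (f : X ⟶ Y) : 𝟙_ (SymMod (oneRing σ E hE)) ⟶ corrModule σ E hE X Y :=
  ofElement (corrModule σ E hE X Y) (homEl σ E hE f) fun φ => corrOfHom_res E f φ

/-- The composition of correspondences as a morphism of modules. -/
def corrCompHom (X Y Z : C) :
    corrModule σ E hE X Y ⊗ corrModule σ E hE Y Z ⟶ corrModule σ E hE X Z :=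
  smashDesc (compBi σ E hE X Y Z)

/-- The monoidal product of correspondences as a morphism of modules. -/
def corrTensorHom (X X' Y Y' : C) :
    corrModule σ E hE X X' ⊗ corrModule σ E hE Y Y' ⟶ corrModule σ E hE (X ⊗ Y) (X' ⊗ Y') :=
  smashDesc (tensorBi σ E hE X X' Y Y')

theorem unitOfHom_unitEl (f : X ⟶ Y) :
    ap (unitOfHom σ E hE f) (unitEl _ k) = homEl σ E hE f k :=
  ofElement_unitEl _ _ _

theorem corrCompHom_sm (f : (corrModule σ E hE X Y).seq.el n k)
    (g : (corrModule σ E hE Y Z).seq.el m k) :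
    ap (corrCompHom σ E hE X Y Z) ((sm _ _).b f g) = (compBi σ E hE X Y Z).b f g :=
  smashDesc_b (compBi σ E hE X Y Z) f g

theorem corrTensorHom_sm (f : (corrModule σ E hE X X').seq.el n k)
    (g : (corrModule σ E hE Y Y').seq.el m k) :
    ap (corrTensorHom σ E hE X X' Y Y') ((sm _ _).b f g) = (tensorBi σ E hE X X' Y Y').b f g :=
  smashDesc_b (tensorBi σ E hE X X' Y Y') f g

theorem id_corrCompHom (X Y : C) : (λ_ _).inv ≫ unitOfHom σ E hE (𝟙 X) ▷ _ ≫
    corrCompHom σ E hE X X Y = 𝟙 (corrModule σ E hE X Y) := hom_ext fun n k f => by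
  rw [ap_leftUnitor_inv_comp, unitOfHom_unitEl, corrCompHom_sm, ap_id]
  exact PtdSymSeq.perm_symm_eq (id_corrComp E hE f).symm

theorem corrCompHom_id (X Y : C) : (ρ_ _).inv ≫ _ ◁ unitOfHom σ E hE (𝟙 Y) ≫
    corrCompHom σ E hE X Y Y = 𝟙 (corrModule σ E hE X Y) := hom_ext fun n k f => by
  rw [ap_rightUnitor_inv_comp, unitOfHom_unitEl, corrCompHom_sm, ap_id]
  exact corrComp_id E hE f

theorem corrCompHom_assoc (W X Y Z : C) :
    (α_ _ _ _).inv ≫ corrCompHom σ E hE W X Y ▷ _ ≫ corrCompHom σ E hE W Y Z =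
      _ ◁ corrCompHom σ E hE X Y Z ≫ corrCompHom σ E hE W X Z :=
  tensor_hom_ext₃' fun f g h => by
    rw [ap_comp, ap_comp, ap_comp, associator_inv_sm, ap_perm, ap_perm, whiskerRight_sm,
      whiskerLeft_sm, corrCompHom_sm, corrCompHom_sm, corrCompHom_sm, corrCompHom_sm]
    exact corrComp_assoc E hE f g h

/-- The monoidal product of correspondences is functorial. -/
theorem corrTensorHom_comp (X X' X'' Y Y' Y'' : C) :
    tensorμ _ _ _ _ ≫ (corrCompHom σ E hE X X' X'' ⊗ₘ corrCompHom σ E hE Y Y' Y'') ≫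
        corrTensorHom σ E hE X X'' Y Y'' =
      (corrTensorHom σ E hE X X' Y Y' ⊗ₘ corrTensorHom σ E hE X' X'' Y' Y'') ≫
        corrCompHom σ E hE (X ⊗ Y) (X' ⊗ Y') (X'' ⊗ Y'') :=
  tensor_hom_ext₄ fun f g f' g' => by
    rw [ap_comp, ap_comp, ap_comp, tensorμ_sm, ap_perm, ap_perm, tensorHom_sm, tensorHom_sm,
      corrCompHom_sm, corrCompHom_sm, corrTensorHom_sm, corrTensorHom_sm, corrTensorHom_sm,
      corrCompHom_sm]
    exact (corrComp_corrTensor E hE f f' g g').symm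

theorem unitOfHom_comp (f : X ⟶ Y) (g : Y ⟶ Z) :
    (λ_ _).inv ≫ (unitOfHom σ E hE f ⊗ₘ unitOfHom σ E hE g) ≫ corrCompHom σ E hE X Y Z =
      unitOfHom σ E hE (f ≫ g) := unit_hom_ext fun k => by
  rw [ap_unit_tensor, unitOfHom_unitEl, unitOfHom_unitEl, unitOfHom_unitEl, corrCompHom_sm]
  refine (corrComp_ofHom E hE (corrOfHom P E f k) g).trans ?_
  have key : ((f ⊗ₘ E.one₀) ≫ wedgeι (Y ⊗ E.seq.obj ⟨0⟩) (fun i : Fin 0 => (i.elim0 : Circ k))) ≫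
      wedgeMap (g ▷ E.seq.obj ⟨0⟩) 0 k =
        ((f ≫ g) ⊗ₘ E.one₀) ≫ wedgeι (Z ⊗ E.seq.obj ⟨0⟩) (fun i => i.elim0) := by
    rw [Category.assoc, wedgeι_map]
    simp [MonoidalCategory.tensorHom_def', whisker_exchange_assoc]
  exact key

theorem unitOfHom_tensor (f : X ⟶ X') (g : Y ⟶ Y') :
    (λ_ _).inv ≫ (unitOfHom σ E hE f ⊗ₘ unitOfHom σ E hE g) ≫ corrTensorHom σ E hE X X' Y Y' =
      unitOfHom σ E hE (f ⊗ₘ g) := unit_hom_ext fun k => by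
  rw [ap_unit_tensor, unitOfHom_unitEl, unitOfHom_unitEl, unitOfHom_unitEl, corrTensorHom_sm]
  exact corrTensor_ofHom_ofHom E hE f g

/-- Composition with a morphism of `C` on the side of the target. -/
def corrPost (X : C) (h : Y ⟶ Z) : corrModule σ E hE X Y ⟶ corrModule σ E hE X Z :=
  (ρ_ _).inv ≫ _ ◁ unitOfHom σ E hE h ≫ corrCompHom σ E hE X Y Z

/-- Composition with a morphism of `C` on the side of the source. -/
def corrPre (h : X ⟶ Y) (Z : C) : corrModule σ E hE Y Z ⟶ corrModule σ E hE X Z :=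
  (λ_ _).inv ≫ unitOfHom σ E hE h ▷ _ ≫ corrCompHom σ E hE X Y Z

theorem corrPost_ap (h : Y ⟶ Z) (f : (corrModule σ E hE X Y).seq.el n k) :
    ap (corrPost σ E hE X h) f = (compBi σ E hE X Y Z).b f (homEl σ E hE h k) := by
  rw [corrPost, ap_rightUnitor_inv_comp, unitOfHom_unitEl, corrCompHom_sm]

theorem corrPre_ap (h : X ⟶ Y) (f : (corrModule σ E hE Y Z).seq.el n k) :
    ap (corrPre σ E hE h Z) f = (corrModule σ E hE X Z).seq.perm (finCongr (Nat.zero_add n))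
      ((compBi σ E hE X Y Z).b (homEl σ E hE h k) f) := by
  rw [corrPre, ap_leftUnitor_inv_comp, unitOfHom_unitEl, corrCompHom_sm]

theorem compBi_homEl (f : (corrModule σ E hE X Y).seq.el n k) (h : Y ⟶ Z) :
    (compBi σ E hE X Y Z).b f (homEl σ E hE h k) =
      (f : Corr P E X Y n k) ≫ wedgeMap (h ▷ E.seq.obj ⟨n⟩) n k :=
  corrComp_ofHom E hE f h

theorem homEl_compBi (h : X ⟶ Y) (f : (corrModule σ E hE Y Z).seq.el n k) :
    (corrModule σ E hE X Z).seq.perm (finCongr (Nat.zero_add n))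
      ((compBi σ E hE X Y Z).b (homEl σ E hE h k) f) =
      h ▷ powObj P n ≫ (f : Corr P E Y Z n k) :=
  PtdSymSeq.perm_symm_eq (ofHom_corrComp E hE h f).symm

theorem tensorBi_assoc (f : (corrModule σ E hE X X').seq.el n k)
    (g : (corrModule σ E hE Y Y').seq.el m k) (h : (corrModule σ E hE Z Z').seq.el p k) :
    (corrModule σ E hE ((X ⊗ Y) ⊗ Z) (X' ⊗ Y' ⊗ Z')).seq.perm (finCongr (Nat.add_assoc n m p))
      ((compBi σ E hE _ _ _).b (q := 0) ((tensorBi σ E hE _ _ _ _).b ((tensorBi σ E hE _ _ _ _).b f g) h)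
        (homEl σ E hE (α_ X' Y' Z').hom k)) =
    (corrModule σ E hE ((X ⊗ Y) ⊗ Z) (X' ⊗ Y' ⊗ Z')).seq.perm (finCongr (Nat.zero_add _))
      ((compBi σ E hE _ _ _).b (p := 0) (homEl σ E hE (α_ X Y Z).hom k)
        ((tensorBi σ E hE _ _ _ _).b f ((tensorBi σ E hE _ _ _ _).b g h))) := by
  rw [homEl_compBi, compBi_homEl]
  exact corrTensor_assoc E hE f g h

theorem tensorBi_braiding (f : (corrModule σ E hE X X').seq.el n k)
    (g : (corrModule σ E hE Y Y').seq.el m k) :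
    (corrModule σ E hE (X ⊗ Y) (Y' ⊗ X')).seq.perm (shuffle n m)
      ((compBi σ E hE _ _ _).b (q := 0) ((tensorBi σ E hE _ _ _ _).b f g)
        (homEl σ E hE (β_ X' Y').hom k)) =
    (corrModule σ E hE (X ⊗ Y) (Y' ⊗ X')).seq.perm (finCongr (Nat.zero_add _))
      ((compBi σ E hE _ _ _).b (p := 0) (homEl σ E hE (β_ X Y).hom k)
        ((tensorBi σ E hE _ _ _ _).b g f)) := by
  rw [homEl_compBi, compBi_homEl]
  exact corrTensor_braiding E hE f g

/-- Naturality of the associativity isomorphism, for morphism objects. -/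
theorem corrTensorHom_assoc (X X' Y Y' Z Z' : C) :
    corrTensorHom σ E hE X X' Y Y' ▷ _ ≫ corrTensorHom σ E hE (X ⊗ Y) (X' ⊗ Y') Z Z' ≫
        corrPost σ E hE ((X ⊗ Y) ⊗ Z) (α_ X' Y' Z').hom =
      (α_ _ _ _).hom ≫ _ ◁ corrTensorHom σ E hE Y Y' Z Z' ≫
        corrTensorHom σ E hE X X' (Y ⊗ Z) (Y' ⊗ Z') ≫
        corrPre σ E hE (α_ X Y Z).hom (X' ⊗ Y' ⊗ Z') :=
  tensor_hom_ext₃ fun f g h => by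
    simp only [ap_comp]
    rw [whiskerRight_sm, corrTensorHom_sm, corrTensorHom_sm, corrPost_ap, associator_hom_sm, ap_perm,
      whiskerLeft_sm, ap_perm, ap_perm, corrTensorHom_sm, corrTensorHom_sm, corrPre_ap]
    rw [PtdSymSeq.perm_perm]
    refine (PtdSymSeq.eq_perm_symm (tensorBi_assoc σ E hE f g h)).trans ?_
    rw [PtdSymSeq.perm_perm]
    rfl

/-- Naturality of the symmetry, for morphism objects. -/
theorem corrTensorHom_braiding (X X' Y Y' : C) :
    corrTensorHom σ E hE X X' Y Y' ≫ corrPost σ E hE (X ⊗ Y) (β_ X' Y').hom =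
      (β_ _ _).hom ≫ corrTensorHom σ E hE Y Y' X X' ≫
        corrPre σ E hE (β_ X Y).hom (Y' ⊗ X') :=
  tensor_hom_ext fun f g => by
    simp only [ap_comp]
    rw [corrTensorHom_sm, corrPost_ap, braiding_hom_sm, ap_perm, ap_perm, corrTensorHom_sm,
      corrPre_ap, PtdSymSeq.perm_perm]
    refine (PtdSymSeq.eq_perm_symm (tensorBi_braiding σ E hE f g)).trans ?_
    rw [PtdSymSeq.perm_perm]
    rfl

theorem corrTensorHom_leftUnitor (X X' : C) :
    (λ_ (corrModule σ E hE X X')).inv ≫ unitOfHom σ E hE (𝟙 (𝟙_ C)) ▷ _ ≫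
        corrTensorHom σ E hE (𝟙_ C) (𝟙_ C) X X' ≫ corrPost σ E hE (𝟙_ C ⊗ X) (λ_ X').hom =
      corrPre σ E hE (λ_ X).hom X' := hom_ext fun n k f => by
  rw [ap_leftUnitor_inv_comp, unitOfHom_unitEl, ap_comp, corrTensorHom_sm, corrPost_ap, corrPre_ap,
    compBi_homEl, homEl_compBi]
  exact PtdSymSeq.perm_symm_eq (unit_corrTensor E hE f).symm

theorem corrTensorHom_rightUnitor (X X' : C) :
    (ρ_ (corrModule σ E hE X X')).inv ≫ _ ◁ unitOfHom σ E hE (𝟙 (𝟙_ C)) ≫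
        corrTensorHom σ E hE X X' (𝟙_ C) (𝟙_ C) ≫ corrPost σ E hE (X ⊗ 𝟙_ C) (ρ_ X').hom =
      corrPre σ E hE (ρ_ X).hom X' := hom_ext fun n k f => by
  rw [ap_rightUnitor_inv_comp, unitOfHom_unitEl, ap_comp, corrTensorHom_sm, corrPost_ap, corrPre_ap,
    compBi_homEl, homEl_compBi]
  exact corrTensor_unit E hE f

end CorrEnriched

/-! ### The symmetric monoidal enriched category -/

section MainStructures

open SymMod

variable {C : Type u} [Category.{v} C] [MonoidalCategory C] [SymmetricCategory C]
  [HasFiniteCoproducts C] [∀ B : C, PreservesFiniteCoproducts (tensorRight B)]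
  [HasZeroObject C] [HasZeroMorphisms C]
  {P T : C} (σ : P ⟶ T) (E : SymRingTSpectrum T) (hE : E.IsCommutative)
  (B : ObjectProperty C) [B.IsMonoidal]

/-- The category enriched in `1^E`-modules whose morphism objects are the modules of
correspondences between objects of `B`. -/
def corrEnrichment :
    EnrichmentOn fun X Y : B.FullSubcategory => corrModule σ E hE X.obj Y.obj where
  id X := unitOfHom σ E hE (𝟙 X.obj)
  comp X Y Z := corrCompHom σ E hE X.obj Y.obj Z.obj
  id_comp X Y := id_corrCompHom σ E hE X.obj Y.obj
  comp_id X Y := corrCompHom_id σ E hE X.obj Y.obj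
  assoc W X Y Z := corrCompHom_assoc σ E hE W.obj X.obj Y.obj Z.obj

/-- The enriched category of correspondences between objects of `B`. -/
@[reducible]
def corrCategory : EnrichedCategory (SymMod (oneRing σ E hE)) B.FullSubcategory :=
  (corrEnrichment σ E hE B).toEnrichedCategory

theorem uComp_unitOfHom (X Y Z : B.FullSubcategory) {f : X.obj ⟶ Y.obj} {g : Y.obj ⟶ Z.obj}
    {f' : 𝟙_ _ ⟶ corrModule σ E hE X.obj Y.obj} {g' : 𝟙_ _ ⟶ corrModule σ E hE Y.obj Z.obj}
    (hf : f' = unitOfHom σ E hE f) (hg : g' = unitOfHom σ E hE g) :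
    letI := corrCategory σ E hE B
    uComp (SymMod (oneRing σ E hE)) (X := X) (Y := Y) (Z := Z) f' g' =
      unitOfHom σ E hE (f ≫ g) := by
  subst hf hg
  exact unitOfHom_comp σ E hE f g

/-- An isomorphism of `C` as an isomorphism in the underlying category of correspondences. -/
def unitOfIso {X Y : B.FullSubcategory} (e : X.obj ≅ Y.obj) :
    letI := corrCategory σ E hE B
    UIso (SymMod (oneRing σ E hE)) X Y :=
  letI := corrCategory σ E hE B
  { hom := unitOfHom σ E hE e.hom
    inv := unitOfHom σ E hE e.inv
    hom_inv_id := (uComp_unitOfHom σ E hE B _ _ _ rfl rfl).trans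
      (congrArg (unitOfHom σ E hE) e.hom_inv_id)
    inv_hom_id := (uComp_unitOfHom σ E hE B _ _ _ rfl rfl).trans
      (congrArg (unitOfHom σ E hE) e.inv_hom_id) }

/-- The symmetric monoidal structure on the enriched category of correspondences. -/
def corrSymMonEnrichment :
    letI := corrCategory σ E hE B
    SymMonEnrichment (SymMod (oneRing σ E hE)) (D := B.FullSubcategory)
      (fun X Y => X ⊗ Y) (𝟙_ B.FullSubcategory) :=
  letI := corrCategory σ E hE B
  { tensorHom := fun X X' Y Y' => corrTensorHom σ E hE X.obj X'.obj Y.obj Y'.obj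
    tensorHom_id := fun X Y => (unitOfHom_tensor σ E hE (𝟙 X.obj) (𝟙 Y.obj)).trans
      (congrArg (unitOfHom σ E hE) (id_tensorHom_id _ _))
    tensorHom_comp := fun X X' X'' Y Y' Y'' =>
      corrTensorHom_comp σ E hE X.obj X'.obj X''.obj Y.obj Y'.obj Y''.obj
    associator := fun X Y Z => unitOfIso σ E hE B (α_ X.obj Y.obj Z.obj)
    leftUnitor := fun X => unitOfIso σ E hE B (λ_ X.obj)
    rightUnitor := fun X => unitOfIso σ E hE B (ρ_ X.obj)
    braiding := fun X Y => unitOfIso σ E hE B (β_ X.obj Y.obj)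
    associator_naturality := fun X X' Y Y' Z Z' =>
      corrTensorHom_assoc σ E hE X.obj X'.obj Y.obj Y'.obj Z.obj Z'.obj
    leftUnitor_naturality := fun X X' => corrTensorHom_leftUnitor σ E hE X.obj X'.obj
    rightUnitor_naturality := fun X X' => corrTensorHom_rightUnitor σ E hE X.obj X'.obj
    braiding_naturality := fun X X' Y Y' =>
      corrTensorHom_braiding σ E hE X.obj X'.obj Y.obj Y'.obj
    -- Each coherence diagram is carried to the underlying category by `unitOfHom`.
    pentagon := fun W X Y Z => by
      have e := MonoidalCategory.pentagon W.obj X.obj Y.obj Z.obj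
      rw [← tensorHom_id, ← id_tensorHom] at e
      exact (uComp_unitOfHom σ E hE B (((W ⊗ X) ⊗ Y) ⊗ Z) ((W ⊗ X ⊗ Y) ⊗ Z) (W ⊗ X ⊗ Y ⊗ Z)
        (unitOfHom_tensor σ E hE (α_ W.obj X.obj Y.obj).hom (𝟙 Z.obj))
        (uComp_unitOfHom σ E hE B ((W ⊗ X ⊗ Y) ⊗ Z) (W ⊗ (X ⊗ Y) ⊗ Z) (W ⊗ X ⊗ Y ⊗ Z) rfl
          (unitOfHom_tensor σ E hE (𝟙 W.obj) (α_ X.obj Y.obj Z.obj).hom))).trans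
        ((congrArg (unitOfHom σ E hE) e).trans (uComp_unitOfHom σ E hE B (((W ⊗ X) ⊗ Y) ⊗ Z)
          ((W ⊗ X) ⊗ Y ⊗ Z) (W ⊗ X ⊗ Y ⊗ Z) rfl rfl).symm)
    triangle := fun X Y => by
      have e := MonoidalCategory.triangle X.obj Y.obj
      rw [← tensorHom_id, ← id_tensorHom] at e
      exact (uComp_unitOfHom σ E hE B ((X ⊗ 𝟙_ _) ⊗ Y) (X ⊗ 𝟙_ _ ⊗ Y) (X ⊗ Y) rfl
        (unitOfHom_tensor σ E hE (𝟙 X.obj) (λ_ Y.obj).hom)).trans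
        ((congrArg (unitOfHom σ E hE) e).trans
          (unitOfHom_tensor σ E hE (ρ_ X.obj).hom (𝟙 Y.obj)).symm)
    hexagon := fun X Y Z => by
      have e := BraidedCategory.hexagon_forward X.obj Y.obj Z.obj
      rw [← tensorHom_id, ← id_tensorHom] at e
      exact (uComp_unitOfHom σ E hE B ((X ⊗ Y) ⊗ Z) (X ⊗ Y ⊗ Z) (Y ⊗ Z ⊗ X) rfl
        (uComp_unitOfHom σ E hE B (X ⊗ Y ⊗ Z) ((Y ⊗ Z) ⊗ X) (Y ⊗ Z ⊗ X) rfl rfl)).trans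
        ((congrArg (unitOfHom σ E hE) e).trans
          (uComp_unitOfHom σ E hE B ((X ⊗ Y) ⊗ Z) ((Y ⊗ X) ⊗ Z) (Y ⊗ Z ⊗ X)
            (unitOfHom_tensor σ E hE (β_ X.obj Y.obj).hom (𝟙 Z.obj))
            (uComp_unitOfHom σ E hE B ((Y ⊗ X) ⊗ Z) (Y ⊗ X ⊗ Z) (Y ⊗ Z ⊗ X) rfl
              (unitOfHom_tensor σ E hE (𝟙 Y.obj) (β_ X.obj Z.obj).hom))).symm)
    symmetry := fun X Y =>
      (uComp_unitOfHom σ E hE B _ _ _ rfl rfl).trans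
        (congrArg (unitOfHom σ E hE) (SymmetricCategory.symmetry _ _)) }

end MainStructures

end

theorem mainTheorem8 {C : Type u} [Category.{v} C] [MonoidalCategory C] [SymmetricCategory C]
    [HasFiniteCoproducts C] [HasZeroObject C] [HasZeroMorphisms C]
    [∀ A : C, PreservesFiniteCoproducts (tensorRight A)]
    (B : ObjectProperty C) [B.IsMonoidal] {P T : C} (σ : P ⟶ T)
    (E : SymRingTSpectrum T) (hE : E.IsCommutative) :
    ∃ (hR : (oneE σ E).IsSymRing) (hc : (oneE σ E).IsCommutative)
      (hM : ∀ X Y : B.FullSubcategory, (corrData σ E hR hc X.obj Y.obj).IsModule)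
      (_ : MonoidalCategory (SymMod (oneERing σ E hR hc)))
      (_ : SymmetricCategory (SymMod (oneERing σ E hR hc)))
      (_ : MonoidalClosed (SymMod (oneERing σ E hR hc)))
      (S : SymMod.SmashStructure (oneERing σ E hR hc))
      (enr : EnrichmentOn fun X Y : B.FullSubcategory =>
        corrMod σ E hR hc X.obj Y.obj (hM X Y)),
      letI : EnrichedCategory (SymMod (oneERing σ E hR hc)) B.FullSubcategory :=
        enr.toEnrichedCategory
      ∃ M : SymMonEnrichment (SymMod (oneERing σ E hR hc)) (D := B.FullSubcategory)
          (fun X Y => X ⊗ Y) (𝟙_ B.FullSubcategory),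
        -- composition and identities of the enriched category
        (∀ (X Y Z : B.FullSubcategory) (n m : ℕ) (k : SimplexCategory)
          (f : Corr P E X.obj Y.obj n k) (g : Corr P E Y.obj Z.obj m k),
          SymMod.ap (enr.comp X Y Z) ((S.smash _ _).b f g) = corrComp E f g) ∧
        (∀ (X : B.FullSubcategory) (k : SimplexCategory),
          SymMod.ap (enr.id X) (SymMod.ap S.unitIso.inv ((oneE σ E).one₀ k)) =
            corrOfHom P E (𝟙 X.obj) k) ∧
        -- the monoidal product on morphism objects
        (∀ (X X' Y Y' : B.FullSubcategory) (n m : ℕ) (k : SimplexCategory)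
          (f : Corr P E X.obj X'.obj n k) (g : Corr P E Y.obj Y'.obj m k),
          SymMod.ap (M.tensorHom X X' Y Y') ((S.smash _ _).b f g) = corrTensor E f g) ∧
        -- the coherence isomorphisms are the images of those of `B`
        (∀ (X Y Z : B.FullSubcategory) (k : SimplexCategory),
          SymMod.ap (M.associator X Y Z).hom (SymMod.ap S.unitIso.inv ((oneE σ E).one₀ k)) =
            corrOfHom P E (α_ X.obj Y.obj Z.obj).hom k) ∧
        (∀ (X : B.FullSubcategory) (k : SimplexCategory),
          SymMod.ap (M.leftUnitor X).hom (SymMod.ap S.unitIso.inv ((oneE σ E).one₀ k)) =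
            corrOfHom P E (λ_ X.obj).hom k) ∧
        (∀ (X : B.FullSubcategory) (k : SimplexCategory),
          SymMod.ap (M.rightUnitor X).hom (SymMod.ap S.unitIso.inv ((oneE σ E).one₀ k)) =
            corrOfHom P E (ρ_ X.obj).hom k) ∧
        (∀ (X Y : B.FullSubcategory) (k : SimplexCategory),
          SymMod.ap (M.braiding X Y).hom (SymMod.ap S.unitIso.inv ((oneE σ E).one₀ k)) =
            corrOfHom P E (β_ X.obj Y.obj).hom k) := by
  refine ⟨oneE_isSymRing σ E hE, oneE_isCommutative σ E hE,
    fun X Y => corrData_isModule σ E hE X.obj Y.obj, inferInstance, inferInstance, inferInstance,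
    SymMod.smashStructure _, corrEnrichment σ E hE B, corrSymMonEnrichment σ E hE B,
    ?_, ?_, ?_, ?_, ?_, ?_, ?_⟩
  · exact fun X Y Z n m k f g => corrCompHom_sm σ E hE f g
  · exact fun X k => unitOfHom_unitEl σ E hE (𝟙 X.obj)
  · exact fun X X' Y Y' n m k f g => corrTensorHom_sm σ E hE f g
  · exact fun X Y Z k => unitOfHom_unitEl σ E hE (α_ X.obj Y.obj Z.obj).hom
  · exact fun X k => unitOfHom_unitEl σ E hE (λ_ X.obj).hom
  · exact fun X k => unitOfHom_unitEl σ E hE (ρ_ X.obj).hom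
  · exact fun X Y k => unitOfHom_unitEl σ E hE (β_ X.obj Y.obj).hom
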